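/- **Conventions.** A monoid is a commutative monoid $A$ with an identity $1$ and an absorbing base point $0$; morphisms preserve $0$, $1$ and products, and are local if only units map to units. A prime ideal is a proper ideal with multiplicatively closed complement; $\mathrm{MSpec}(A)$ is the set of primes with the Zariski topology and the sheaf with stalks $A_{\mathfrak p}$. A monoid scheme is a space with a sheaf of monoids that is locally isomorphic to some $\mathrm{MSpec}(A)$; morphisms are continuous maps with maps of sheaves that are local on stalks. For points, $x\le y$ means $y\in\overline{\{x\}}$; minimal points are called generic. The stalk of $(X,\mathcal A)$ at $x$ is written $A(x)$. A *closed immersion* is a morphism that is a homeomorphism onto its image and for which the preimage of every affine open $U$ is affine (possibly empty), with surjective map on sections over $U$. A *toric monoid scheme* is a monoid scheme that is separated (the diagonal $X\to X\times X$ is a closed immersion), connected, of finite type (a finite cover by spectra of finitely generated monoids), torsionfree (in the stalks, $a^n=b^n$ with $n\ge1$ implies $a=b$) and normal (the stalks are cancellative, and contain every $\alpha$ in their pointed group completion with some $\alpha^n$, $n\ge 1$, in the stalk). A *fan* $(N,\Delta)$ is a free abelian group $N$ of finite rank with a nonempty finite set $\Delta$ of strongly convex rational polyhedral cones in $N_{\mathbb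 R}$ that contains every face of its members and in which the intersection of two members is a face of each. A morphism $(N,\Delta)\to(N',\Delta')$ is a homomorphism $\phi:N\to N'$ such that the image of each $\sigma\in\Delta$ lies in some $\sigma'\in\Delta'$. Let $M=\mathrm{Hom}(N,\mathbb Z)$ and let $A(\sigma)=(\sigma^\vee\cap M)\cup\{\ast\}$, with $\ast$ an added base point. The space $X(N,\Delta)$ has underlying set $\Delta$, open sets the subsets closed under passing to smaller cones, and sheaf $U\mapsto\varprojlim_{\sigma\in U}A(\sigma)$, whose stalk at $\sigma$ is $A(\sigma)$. The morphism $X(\phi)$ sends $\sigma$ to the smallest cone of $\Delta'$ containing $\phi(\sigma)$ and is given on stalks by precomposition with $\phi$. **Theorem.** The assignment $(N,\Delta)\mapsto X(N,\Delta)$, $\phi\mapsto X(\phi)$ is a faithful and essentially surjective functor from fans to toric monoid schemes. Moreover: 1. Let $X$ be a toric monoid scheme. It has a unique minimal point $\eta$, and $\eta\le x$ for all $x\in X$. The set $M_\eta=A(\eta)\setminus\{0\}$ is the group of units of $A(\eta)$. Put $N=\mathrm{Hom}(M_\eta,\mathbb Z)$, and for $x\in X$ let $\sigma_x\subset N_{\mathbb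 R}$ be the dual cone of the convex hull in $(M_\eta)_{\mathbb R}$ of the image of $A(x)\setminus\{0\}$ under $A(x)\to A(\eta)$. Then $N$ is free of finite rank, $\Delta=\{\sigma_x : x\in X\}$ is a fan in $N_{\mathbb R}$, $x\le y$ if and only if $\sigma_x\subseteq\sigma_y$, and there is an isomorphism $X\cong X(N,\Delta)$ that sends each $x$ to $\sigma_x$ and on generic stalks is the canonical identification $\mathrm{Hom}(N,\mathbb Z)\cong M_\eta$. 2. Let $(N,\Delta)$, $(N',\Delta')$ be fans, let $\eta$, $\eta'$ be the generic points of $X(\Delta)$, $X(\Delta')$, and let $f:X(\Delta)\to X(\Delta')$ be a morphism of monoid schemes. Then $f=X(\phi)$ for some morphism of fans $\phi$ if and only if $f(\eta)=\eta'$, and then $\phi$ is unique. The stalks at $\eta$ and $\eta'$ are canonically $M\cup\{\ast\}$ and $M'\cup\{\ast\}$, and if $f=X(\phi)$, then $\phi$ is the $\mathbb Z$-linear dual of $f^\#_\eta:M'\to M$; that is, $f^\#_\eta(m')=m'\circ\phi$ for all $m'\in M'$. -/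

import Mathlib

open CategoryTheory TopologicalSpace TensorProduct

universe u

namespace MonoidScheme

noncomputable section

/-! ## Monoids

A (pointed abelian) monoid is a `CommMonoidWithZero`; the zero monoid `{0}` is allowed.
A morphism of monoids is a `MonoidWithZeroHom`, and it is local when it is an `IsLocalHom`. -/

/-- A prime ideal of a pointed monoid: a proper ideal (containing the base point and stable under
multiplication) whose complement is multiplicatively closed. -/
@[ext]
structure PrimeIdeal (A : Type u) [CommMonoidWithZero A] where
  carrier : Set A
  zero_mem : (0 : A) ∈ carrier
  mul_mem : ∀ (a : A) {b : A}, b ∈ carrier → a * b ∈ carrier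
  one_notMem : (1 : A) ∉ carrier
  prime : ∀ {a b : A}, a ∉ carrier → b ∉ carrier → a * b ∉ carrier

namespace PrimeIdeal

variable {A : Type u} [CommMonoidWithZero A]

/-- The complement of a prime ideal. -/
def compl (p : PrimeIdeal A) : Submonoid A where
  carrier := {a | a ∉ p.carrier}
  one_mem' := p.one_notMem
  mul_mem' := p.prime

/-- The Zariski topology: the closed sets are the sets `{p | S ⊆ p}` for `S ⊆ A` (equivalently,
for `S` an ideal of `A`). -/
instance : TopologicalSpace (PrimeIdeal A) where
  IsOpen U := ∃ S : Set A, U = {p | ¬ S ⊆ p.carrier}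
  isOpen_univ := ⟨Set.univ, by
    ext p
    exact ⟨fun _ h => p.one_notMem (h (Set.mem_univ _)), fun _ => trivial⟩⟩
  isOpen_inter := by
    rintro _ _ ⟨S, rfl⟩ ⟨T, rfl⟩
    refine ⟨Set.image2 (· * ·) S T, ?_⟩
    ext p
    simp only [Set.mem_inter_iff, Set.mem_ofPred_eq, Set.not_subset]
    constructor
    · rintro ⟨⟨s, hs, hsp⟩, ⟨t, ht, htp⟩⟩
      exact ⟨s * t, ⟨s, hs, t, ht, rfl⟩, p.prime hsp htp⟩
    · rintro ⟨_, ⟨s, hs, t, ht, rfl⟩, h⟩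
      refine ⟨⟨s, hs, fun h' => h ?_⟩, ⟨t, ht, fun h' => h (p.mul_mem s h')⟩⟩
      have := p.mul_mem t h'
      rwa [mul_comm] at this
  isOpen_sUnion := by
    intro 𝒰 h
    choose S hS using h
    refine ⟨⋃ (U : Set (PrimeIdeal A)) (hU : U ∈ 𝒰), S U hU, ?_⟩
    ext p
    simp only [Set.mem_sUnion, Set.mem_ofPred_eq, Set.not_subset, Set.mem_iUnion]
    constructor
    · rintro ⟨U, hU, hp⟩
      rw [hS U hU] at hp
      obtain ⟨s, hs, hsp⟩ := Set.not_subset.mp hp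
      exact ⟨s, ⟨U, hU, hs⟩, hsp⟩
    · rintro ⟨s, ⟨U, hU, hs⟩, hsp⟩
      refine ⟨U, hU, ?_⟩
      rw [hS U hU]
      exact Set.not_subset.mpr ⟨s, hs, hsp⟩

/-- The localization `A_p` of a pointed monoid at a prime ideal. -/
abbrev Loc (p : PrimeIdeal A) : Type u := Localization p.compl

end PrimeIdeal

/-- A pointed monoid is normal if it is cancellative and contains every element `α` of its pointed
group completion such that `α ^ n` lies in `A` for some `n ≥ 1`. For cancellative `A ≠ 0` the
submonoid `nonZeroDivisors A` is `A ∖ {0}`, and the localization there is the pointed group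
completion. -/
def IsNormal (A : Type u) [CommMonoidWithZero A] : Prop :=
  IsCancelMulZero A ∧
    ∀ α : Localization (nonZeroDivisors A),
      (∃ n : ℕ, 1 ≤ n ∧ ∃ a : A, α ^ n = Localization.mk a 1) →
        ∃ a : A, α = Localization.mk a 1

/-! ## Monoid spaces -/

end

/-- A monoid space: a topological space with a sheaf of pointed abelian monoids. -/
structure MonoidSpace where
  carrier : Type u
  [top : TopologicalSpace carrier]
  sec : Opens carrier → Type u
  [mon : ∀ U, CommMonoidWithZero (sec U)]
  res : ∀ {U V : Opens carrier}, V ≤ U → sec U →*₀ sec V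
  res_id : ∀ {U : Opens carrier} (s : sec U), res (le_refl U) s = s
  res_res : ∀ {U V W : Opens carrier} (h : V ≤ U) (h' : W ≤ V) (s : sec U),
    res h' (res h s) = res (h'.trans h) s
  glue : ∀ {ι : Type u} (U : ι → Opens carrier) (W : Opens carrier) (hU : ∀ i, U i ≤ W),
    W ≤ iSup U → ∀ s : ∀ i, sec (U i),
      (∀ i j, res (inf_le_left : U i ⊓ U j ≤ U i) (s i) =
        res (inf_le_right : U i ⊓ U j ≤ U j) (s j)) →
      ∃! t : sec W, ∀ i, res (hU i) t = s i

instance : CoeSort MonoidSpace.{u} (Type u) := ⟨MonoidSpace.carrier⟩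

attribute [instance] MonoidSpace.top MonoidSpace.mon

noncomputable section

namespace MonoidSpace

/-- The open neighbourhoods of a point, ordered by reverse inclusion. -/
abbrev Nhd (X : MonoidSpace.{u}) (x : X) : Type u := {U : Opens X // x ∈ U}ᵒᵈ

/-- The open set underlying a neighbourhood. -/
abbrev Nhd.open {X : MonoidSpace.{u}} {x : X} (U : X.Nhd x) : Opens X := (OrderDual.ofDual U).1

instance (X : MonoidSpace.{u}) (x : X) : Nonempty (X.Nhd x) := ⟨OrderDual.toDual ⟨⊤, trivial⟩⟩

instance (X : MonoidSpace.{u}) (x : X) : IsDirectedOrder (X.Nhd x) where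
  directed U V := ⟨OrderDual.toDual ⟨U.open ⊓ V.open,
    (OrderDual.ofDual U).2, (OrderDual.ofDual V).2⟩,
    (inf_le_left : U.open ⊓ V.open ≤ U.open), (inf_le_right : U.open ⊓ V.open ≤ V.open)⟩

/-- The restriction maps between the sections over the neighbourhoods of a point. -/
abbrev nhdRes (X : MonoidSpace.{u}) (x : X) (U V : X.Nhd x) (h : U ≤ V) :
    X.sec U.open →*₀ X.sec V.open :=
  X.res (show V.open ≤ U.open from h)

instance (X : MonoidSpace.{u}) (x : X) :
    DirectedSystem (fun U : X.Nhd x => X.sec U.open) (fun U V h => X.nhdRes x U V h) where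
  map_self _ s := X.res_id s
  map_map _ _ _ _ _ s := X.res_res _ _ s

/-- The stalk of the structure sheaf at `x`, the filtered colimit of the sections over the open
neighbourhoods of `x`. -/
def stalk (X : MonoidSpace.{u}) (x : X) : Type u :=
  DirectLimit (fun U : X.Nhd x => X.sec U.open) (X.nhdRes x)

instance (X : MonoidSpace.{u}) (x : X) : CommMonoidWithZero (X.stalk x) where
  __ := (inferInstance : MonoidWithZero (DirectLimit (fun U : X.Nhd x => X.sec U.open)
    (X.nhdRes x)))
  mul_comm := (inferInstance : CommMonoid (DirectLimit (fun U : X.Nhd x => X.sec U.open)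
    (X.nhdRes x))).mul_comm

/-- The germ at `x` of a section over an open neighbourhood of `x`. -/
def germ (X : MonoidSpace.{u}) (x : X) (U : Opens X) (hx : x ∈ U) : X.sec U →*₀ X.stalk x where
  toFun s := Quotient.mk _ ⟨OrderDual.toDual ⟨U, hx⟩, s⟩
  map_zero' := (DirectLimit.zero_def _).symm
  map_one' := (DirectLimit.one_def _).symm
  map_mul' _ _ := (DirectLimit.mul_def _ _ _).symm

theorem germ_res (X : MonoidSpace.{u}) (x : X) {U V : Opens X} (h : V ≤ U) (hx : x ∈ V)
    (s : X.sec U) : X.germ x V hx (X.res h s) = X.germ x U (h hx) s :=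
  (DirectLimit.eq_of_le (F := fun U : X.Nhd x => X.sec U.open) (f := fun U V h => X.nhdRes x U V h)
    ⟨OrderDual.toDual ⟨U, h hx⟩, s⟩ (OrderDual.toDual ⟨V, hx⟩) h).symm

theorem germ_exists (X : MonoidSpace.{u}) (x : X) (t : X.stalk x) :
    ∃ (U : Opens X) (hx : x ∈ U) (s : X.sec U), X.germ x U hx s = t := by
  obtain ⟨⟨U, s⟩, rfl⟩ := Quotient.exists_rep t
  exact ⟨U.open, (OrderDual.ofDual U).2, s, rfl⟩

theorem germ_eq_iff (X : MonoidSpace.{u}) (x : X) {U V : Opens X} (hU : x ∈ U) (hV : x ∈ V)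
    (s : X.sec U) (t : X.sec V) :
    X.germ x U hU s = X.germ x V hV t ↔
      ∃ (W : Opens X) (_ : x ∈ W) (h₁ : W ≤ U) (h₂ : W ≤ V), X.res h₁ s = X.res h₂ t := by
  constructor
  · intro h
    obtain ⟨W, h₁, h₂, h⟩ := Quotient.exact h
    exact ⟨W.open, (OrderDual.ofDual W).2, h₁, h₂, h⟩
  · rintro ⟨W, hW, h₁, h₂, h⟩
    rw [← X.germ_res x h₁ hW, ← X.germ_res x h₂ hW, h]

/-- A compatible family of monoid morphisms on the sections over the neighbourhoods of `x` induces
a morphism on the stalk. -/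
def stalkLift (X : MonoidSpace.{u}) (x : X) {B : Type u} [CommMonoidWithZero B]
    (g : ∀ U : Opens X, x ∈ U → X.sec U →*₀ B)
    (hg : ∀ (U V : Opens X) (hU : x ∈ U) (hV : x ∈ V) (h : V ≤ U) (s : X.sec U),
      g V hV (X.res h s) = g U hU s) : X.stalk x →*₀ B where
  toFun := DirectLimit.lift (X.nhdRes x) (fun U s => g U.open (OrderDual.ofDual U).2 s)
    (fun U V h s => (hg U.open V.open (OrderDual.ofDual U).2 (OrderDual.ofDual V).2 h s).symm)
  map_zero' := (congrArg _ (map_zero (X.germ x ⊤ trivial)).symm).trans (map_zero (g ⊤ trivial))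
  map_one' := (congrArg _ (map_one (X.germ x ⊤ trivial)).symm).trans (map_one (g ⊤ trivial))
  map_mul' := DirectLimit.induction₂ _ fun U s t => by
    have : (Quotient.mk _ ⟨U, s⟩ * Quotient.mk _ ⟨U, t⟩ :
      DirectLimit (fun U : X.Nhd x => X.sec U.open) (X.nhdRes x)) = Quotient.mk _ ⟨U, s * t⟩ :=
      DirectLimit.mul_def _ _ _
    erw [this]
    exact map_mul (g U.open (OrderDual.ofDual U).2) s t

@[simp]
theorem stalkLift_germ (X : MonoidSpace.{u}) (x : X) {B : Type u} [CommMonoidWithZero B]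
    (g : ∀ U : Opens X, x ∈ U → X.sec U →*₀ B)
    (hg : ∀ (U V : Opens X) (hU : x ∈ U) (hV : x ∈ V) (h : V ≤ U) (s : X.sec U),
      g V hV (X.res h s) = g U hU s) (U : Opens X) (hx : x ∈ U) (s : X.sec U) :
    X.stalkLift x g hg (X.germ x U hx s) = g U hx s := rfl

/-- If `x` lies in the closure of `y`, every neighbourhood of `x` contains `y`, and there is a
canonical morphism from the stalk at `x` to the stalk at `y`. -/
def stalkSpec (X : MonoidSpace.{u}) {y x : X} (h : y ⤳ x) : X.stalk x →*₀ X.stalk y :=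
  X.stalkLift x (fun U hx => X.germ y U (h.mem_open U.isOpen hx))
    (fun _ _ _ hV h' s => X.germ_res y h' (h.mem_open (Opens.isOpen _) hV) s)

/-- The data of a morphism of spaces with a sheaf of monoids, without the locality condition. -/
structure PreHom (X Y : MonoidSpace.{u}) where
  base : C(X, Y)
  app : ∀ V : Opens Y, Y.sec V →*₀ X.sec (V.comap base)
  naturality : ∀ {V W : Opens Y} (h : W ≤ V) (s : Y.sec V),
    app W (Y.res h s) = X.res (Opens.comap_mono base h) (app V s)

/-- The map on stalks `Y_{f x} → X_x` induced by a morphism. -/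
def PreHom.stalkMap {X Y : MonoidSpace.{u}} (f : PreHom X Y) (x : X) :
    Y.stalk (f.base x) →*₀ X.stalk x :=
  Y.stalkLift (f.base x) (fun V hV => (X.germ x (V.comap f.base) hV).comp (f.app V))
    (fun U V _ hV h s => by
      simp only [MonoidWithZeroHom.comp_apply, f.naturality h]
      exact X.germ_res x _ hV _)

/-- A morphism of monoid spaces: the maps on stalks are local. -/
structure Hom (X Y : MonoidSpace.{u}) extends PreHom X Y where
  isLocal : ∀ x, IsLocalHom (toPreHom.stalkMap x)

theorem PreHom.stalkMap_germ {X Y : MonoidSpace.{u}} (f : PreHom X Y) (x : X) (V : Opens Y)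
    (hV : f.base x ∈ V) (s : Y.sec V) :
    f.stalkMap x (Y.germ (f.base x) V hV s) = X.germ x (V.comap f.base) hV (f.app V s) := rfl

theorem Hom.ext_iff' {X Y : MonoidSpace.{u}} {f g : Hom X Y} :
    f = g ↔ ∃ h : f.base = g.base, ∀ (V : Opens Y) (s : Y.sec V),
      X.res (h ▸ le_refl _ : V.comap g.base ≤ V.comap f.base) (f.app V s) = g.app V s := by
  constructor
  · rintro rfl
    exact ⟨rfl, fun V s => X.res_id _⟩
  · obtain ⟨⟨b, a, n⟩, l⟩ := f
    obtain ⟨⟨b', a', n'⟩, l'⟩ := g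
    rintro ⟨h, h'⟩
    dsimp at h
    subst h
    have : a = a' := by
      funext V
      ext s
      rw [← h' V s]
      exact (X.res_id _).symm
    subst this
    rfl

instance : Category.{u} MonoidSpace.{u} where
  Hom := Hom
  id X :=
    { base := ContinuousMap.id X
      app := fun V => MonoidWithZeroHom.id (X.sec V)
      naturality := fun _ _ => rfl
      isLocal := fun x => ⟨fun t ht => by
        obtain ⟨U, hU, s, rfl⟩ := X.germ_exists _ t
        exact ht⟩ }
  comp {X Y Z} f g :=
    { base := g.base.comp f.base
      app := fun V => (f.app (V.comap g.base)).comp (g.app V)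
      naturality := fun h s =>
        (congrArg (f.app _) (g.naturality h s)).trans (f.naturality _ _)
      isLocal := fun x => ⟨fun t ht => by
        obtain ⟨U, hU, s, rfl⟩ := Z.germ_exists _ t
        apply (g.isLocal (f.base x)).map_nonunit
        apply (f.isLocal x).map_nonunit
        exact ht⟩ }
  id_comp f := rfl
  comp_id f := rfl
  assoc f g h := rfl

/-- The open set of `X` underlying an open subset of an open subset of `X`. -/
def imageOpens (X : MonoidSpace.{u}) (U : Opens X) (V : Opens U) : Opens X :=
  ⟨Subtype.val '' (V : Set U), U.isOpen.isOpenMap_subtype_val _ V.isOpen⟩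

theorem imageOpens_mono (X : MonoidSpace.{u}) (U : Opens X) {V W : Opens U} (h : V ≤ W) :
    X.imageOpens U V ≤ X.imageOpens U W := Set.image_mono h

/-- The open subspace `(U, 𝒜|_U)` of a monoid space. -/
def restrict (X : MonoidSpace.{u}) (U : Opens X) : MonoidSpace.{u} where
  carrier := U
  sec V := X.sec (X.imageOpens U V)
  res h := X.res (X.imageOpens_mono U h)
  res_id s := X.res_id s
  res_res _ _ s := X.res_res _ _ s
  glue V W hV hW s hs := by
    refine X.glue (fun i => X.imageOpens U (V i)) (X.imageOpens U W)
      (fun i => X.imageOpens_mono U (hV i)) ?_ s ?_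
    · rintro _ ⟨x, hx, rfl⟩
      obtain ⟨i, hi⟩ := Opens.mem_iSup.mp (hW hx)
      exact Opens.mem_iSup.mpr ⟨i, x, hi, rfl⟩
    · intro i j
      have hle : X.imageOpens U (V i) ⊓ X.imageOpens U (V j) ≤ X.imageOpens U (V i ⊓ V j) := by
        rintro _ ⟨⟨x, hx, rfl⟩, ⟨y, hy, hxy⟩⟩
        obtain rfl : y = x := Subtype.ext hxy
        exact ⟨y, ⟨hx, hy⟩, rfl⟩
      have := congrArg (X.res hle) (hs i j)
      rwa [X.res_res, X.res_res] at this

/-- The monoid space whose sections over `U` are the families `(s x)_{x ∈ U}` of elements of given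
monoids `F x` that satisfy a predicate which is local on `U` and stable under the monoid
operations. -/
def ofFamily (X : Type u) [TopologicalSpace X] (F : X → Type u)
    [∀ x, CommMonoidWithZero (F x)] (P : ∀ U : Opens X, (∀ x : U, F x) → Prop)
    (zero : ∀ U, P U 0) (one : ∀ U, P U 1)
    (mul : ∀ U s t, P U s → P U t → P U (s * t))
    (restr : ∀ (U V : Opens X) (h : V ≤ U) (s : ∀ x : U, F x), P U s →
      P V (fun x => s ⟨x, h x.2⟩))
    (loc : ∀ (U : Opens X) (s : ∀ x : U, F x),
      (∀ x ∈ U, ∃ (V : Opens X) (_ : x ∈ V) (h : V ≤ U), P V (fun y => s ⟨y, h y.2⟩)) → P U s) :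
    MonoidSpace.{u} :=
  letI mon (U : Opens X) : CommMonoidWithZero {s : ∀ x : U, F x // P U s} :=
    { zero := ⟨0, zero U⟩
      one := ⟨1, one U⟩
      mul := fun s t => ⟨s.1 * t.1, mul U _ _ s.2 t.2⟩
      mul_assoc := fun _ _ _ => Subtype.ext (mul_assoc _ _ _)
      mul_comm := fun _ _ => Subtype.ext (mul_comm _ _)
      one_mul := fun _ => Subtype.ext (one_mul _)
      mul_one := fun _ => Subtype.ext (mul_one _)
      zero_mul := fun _ => Subtype.ext (zero_mul _)
      mul_zero := fun _ => Subtype.ext (mul_zero _) }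
  { carrier := X
    sec := fun U => {s : ∀ x : U, F x // P U s}
    mon := mon
    res := fun {U V} h =>
      { toFun := fun s : {s : ∀ x : U, F x // P U s} => ⟨fun x => s.1 ⟨x, h x.2⟩, restr U V h s.1 s.2⟩
        map_zero' := rfl
        map_one' := rfl
        map_mul' := fun _ _ => rfl }
    res_id := fun _ => rfl
    res_res := fun _ _ _ => rfl
    glue := fun {ι} U W hU hW s hs => by
      have hc : ∀ x : W, ∃ i, x.1 ∈ U i := fun x => Opens.mem_iSup.mp (hW x.2)
      have heq : ∀ i j (x : X) (hi : x ∈ U i) (hj : x ∈ U j),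
          (s i).1 ⟨x, hi⟩ = (s j).1 ⟨x, hj⟩ := fun i j x hi hj =>
        congrFun (congrArg Subtype.val (hs i j)) ⟨x, hi, hj⟩
      choose c hc using hc
      let t : ∀ x : W, F x := fun x => (s (c x)).1 ⟨x, hc x⟩
      have ht : ∀ i (x : U i), t ⟨x, hU i x.2⟩ = (s i).1 x := fun i x => heq _ _ _ _ _
      refine ⟨⟨t, loc W t fun x hx => ⟨U (c ⟨x, hx⟩), hc _, hU _, ?_⟩⟩, ?_, ?_⟩
      · simp only [ht]
        exact (s _).2
      · intro i
        exact Subtype.ext (funext fun x => ht i x)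
      · rintro ⟨t', h'⟩ ht'
        refine Subtype.ext (funext fun x => ?_)
        exact congrFun (congrArg Subtype.val (ht' (c x))) ⟨x, hc x⟩ }

/-- The order on points: `x ≤ y` when `y` lies in the closure of `x` (written `x ⤳ y`). A point is
minimal, or generic, if there is no point strictly below it. -/
def IsMinimalPoint (X : MonoidSpace.{u}) (x : X) : Prop :=
  ∀ y : X, y ⤳ x → y = x

end MonoidSpace

open MonoidSpace

/-! ## Affine monoid schemes and monoid schemes -/

/-- The affine monoid scheme of a pointed monoid `A`: the points are the prime ideals, and a section
over `U` is a family of elements of `A_p`, `p ∈ U`, that is locally of the form `a / s`. -/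
def MSpec (A : Type u) [CommMonoidWithZero A] : MonoidSpace.{u} :=
  MonoidSpace.ofFamily (PrimeIdeal A) (fun p => p.Loc)
    (fun U f => ∀ p : U, ∃ (V : Opens (PrimeIdeal A)) (_ : p.1 ∈ V) (h : V ≤ U) (a s : A),
      ∀ q : V, ∃ hs : s ∉ q.1.carrier, f ⟨q, h q.2⟩ = Localization.mk a ⟨s, hs⟩)
    (fun U p => ⟨U, p.2, le_rfl, 0, 1, fun q => ⟨q.1.one_notMem, by
      exact (Localization.mk_zero _).symm⟩⟩)
    (fun U p => ⟨U, p.2, le_rfl, 1, 1, fun q => ⟨q.1.one_notMem, by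
      exact Localization.mk_one.symm⟩⟩)
    (fun U f g hf hg p => by
      obtain ⟨V, hV, h, a, s, H⟩ := hf p
      obtain ⟨V', hV', h', a', s', H'⟩ := hg p
      refine ⟨V ⊓ V', ⟨hV, hV'⟩, inf_le_left.trans h, a * a', s * s', fun q => ?_⟩
      obtain ⟨hs, e⟩ := H ⟨q, q.2.1⟩
      obtain ⟨hs', e'⟩ := H' ⟨q, q.2.2⟩
      refine ⟨q.1.prime hs hs', ?_⟩
      change f _ * g _ = _
      rw [e, e', Localization.mk_mul]
      rfl)
    (fun U V h f hf p => by
      obtain ⟨W, hW, h', a, s, H⟩ := hf ⟨p, h p.2⟩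
      exact ⟨W ⊓ V, ⟨hW, p.2⟩, inf_le_right, a, s, fun q => H ⟨q, q.2.1⟩⟩)
    (fun U f hf p => by
      obtain ⟨V, hV, h, H⟩ := hf p p.2
      obtain ⟨W, hW, h', a, s, H'⟩ := H ⟨p, hV⟩
      exact ⟨W, hW, h'.trans h, a, s, H'⟩)

/-- An open subset is affine if the open subspace is isomorphic to some `MSpec A`. -/
def IsAffineOpen (X : MonoidSpace.{u}) (U : Opens X) : Prop :=
  ∃ (A : Type u) (_ : CommMonoidWithZero A), Nonempty (X.restrict U ≅ MSpec A)

/-- A monoid scheme: a monoid space in which every point has an affine open neighbourhood. -/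
def IsMonoidScheme (X : MonoidSpace.{u}) : Prop :=
  ∀ x : X, ∃ U : Opens X, x ∈ U ∧ IsAffineOpen X U

/-- Finite type: there is a finite open cover by spectra of finitely generated monoids. -/
def IsFiniteType (X : MonoidSpace.{u}) : Prop :=
  ∃ 𝒰 : Set (Opens X), 𝒰.Finite ∧ sSup 𝒰 = ⊤ ∧
    ∀ U ∈ 𝒰, ∃ (A : Type u) (_ : CommMonoidWithZero A), Monoid.FG A ∧
      Nonempty (X.restrict U ≅ MSpec A)

/-- A closed immersion of monoid schemes: a homeomorphism onto the image such that for every affine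
open `U` of the target, the preimage of `U` is affine (possibly empty) and the map on sections over
`U` is surjective. -/
def IsClosedImmersion {X Y : MonoidSpace.{u}} (f : Y ⟶ X) : Prop :=
  Topology.IsEmbedding f.base ∧
    ∀ U : Opens X, IsAffineOpen X U →
      IsAffineOpen Y (U.comap f.base) ∧ Function.Surjective (f.app U)

/-- `P` with the projections `p₁`, `p₂` is a product of `X` and `Y` in the category of monoid
schemes. -/
def IsProduct {P X Y : MonoidSpace.{u}} (p₁ : P ⟶ X) (p₂ : P ⟶ Y) : Prop :=
  IsMonoidScheme P ∧ ∀ T : MonoidSpace.{u}, IsMonoidScheme T → ∀ (f : T ⟶ X) (g : T ⟶ Y),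
    ∃! h : T ⟶ P, h ≫ p₁ = f ∧ h ≫ p₂ = g

/-- A monoid scheme is separated (over the terminal monoid scheme `MSpec {0, 1}`) if its diagonal
`X ⟶ X × X` is a closed immersion. -/
def IsSeparated (X : MonoidSpace.{u}) : Prop :=
  ∃ (P : MonoidSpace.{u}) (p₁ p₂ : P ⟶ X), IsProduct p₁ p₂ ∧
    ∃ d : X ⟶ P, d ≫ p₁ = 𝟙 X ∧ d ≫ p₂ = 𝟙 X ∧ IsClosedImmersion d

/-- A toric monoid scheme: a separated, connected, torsionfree, normal monoid scheme of finite
type. -/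
structure IsToric (X : MonoidSpace.{u}) : Prop where
  isMonoidScheme : IsMonoidScheme X
  isSeparated : IsSeparated X
  connected : ConnectedSpace X
  torsionfree : ∀ x : X, IsMulTorsionFree (X.stalk x)
  normal : ∀ x : X, IsNormal (X.stalk x)
  finiteType : IsFiniteType X

/-- The property of being toric, as a property of objects of the category of monoid spaces. -/
def toric : ObjectProperty MonoidSpace.{u} := fun X => IsToric X

/-- The category of toric monoid schemes, a full subcategory of the category of monoid spaces. -/
abbrev ToricMonoidScheme : Type (u + 1) := (toric.{u}).FullSubcategory

/-! ## Fans -/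

section Cones

variable {N : Type u} [AddCommGroup N] {N' : Type u} [AddCommGroup N']
  {N'' : Type u} [AddCommGroup N'']

/-- The extension of a homomorphism `m : N → ℤ` to a linear functional on `N_ℝ = ℝ ⊗ N`. -/
def realFunctional : Module.Dual ℤ N →ₗ[ℤ] ((ℝ ⊗[ℤ] N) →ₗ[ℝ] ℝ) where
  toFun m := LinearMap.liftBaseChange ℝ ((Int.castAddHom ℝ).toIntLinearMap ∘ₗ m)
  map_add' m m' := by ext n; simp
  map_smul' c m := by ext n; simp

@[simp]
theorem realFunctional_tmul (m : Module.Dual ℤ N) (r : ℝ) (n : N) :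
    realFunctional m (r ⊗ₜ n) = r * (m n : ℝ) := by
  simp [realFunctional]

theorem realFunctional_comp (φ : N →ₗ[ℤ] N') (m : Module.Dual ℤ N') (v : ℝ ⊗[ℤ] N) :
    realFunctional (m ∘ₗ φ) v = realFunctional m (φ.baseChange ℝ v) := by
  have : realFunctional (m ∘ₗ φ) = realFunctional m ∘ₗ φ.baseChange ℝ := by
    ext n
    simp
  rw [this]
  rfl

/-- The pairing `M_ℝ × N_ℝ → ℝ`, where `N` is the dual of `M`. -/
def realPairing (M : Type u) [AddCommGroup M] :
    (ℝ ⊗[ℤ] M) →ₗ[ℝ] (ℝ ⊗[ℤ] Module.Dual ℤ M) →ₗ[ℝ] ℝ :=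
  (LinearMap.liftBaseChange ℝ (realFunctional (N := M))).flip

/-- A strongly convex rational polyhedral cone in `N_ℝ`: generated by finitely many elements of
`N`, and containing no line through the origin. -/
def IsCone (σ : PointedCone ℝ (ℝ ⊗[ℤ] N)) : Prop :=
  (∃ S : Finset N, σ = PointedCone.hull ℝ ((fun n : N => (1 : ℝ) ⊗ₜ[ℤ] n) '' (S : Set N))) ∧
    ∀ v ∈ σ, -v ∈ σ → v = 0

/-- `τ` is a face of the cone `σ`: it is cut out of `σ` by the vanishing of a linear functional
that is nonnegative on `σ`. -/
def IsFace (τ σ : PointedCone ℝ (ℝ ⊗[ℤ] N)) : Prop :=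
  ∃ m : (ℝ ⊗[ℤ] N) →ₗ[ℝ] ℝ, (∀ v ∈ σ, 0 ≤ m v) ∧ ∀ v, v ∈ τ ↔ v ∈ σ ∧ m v = 0

variable (N) in
/-- A nonempty finite collection of strongly convex rational polyhedral cones in `N_ℝ` that
contains the faces of its members and in which the intersection of any two members is a face of
each. -/
structure FanIn where
  cones : Set (PointedCone ℝ (ℝ ⊗[ℤ] N))
  finite : cones.Finite
  nonempty : cones.Nonempty
  isCone : ∀ σ ∈ cones, IsCone σ
  face_mem : ∀ σ ∈ cones, ∀ τ, IsFace τ σ → τ ∈ cones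
  inter_face : ∀ σ ∈ cones, ∀ τ ∈ cones, IsFace (σ ⊓ τ) σ ∧ IsFace (σ ⊓ τ) τ

/-- The monoid `σ^∨ ∩ M` of the elements of `M = Hom(N, ℤ)` that are nonnegative on `σ`. -/
def dualMonoid (σ : PointedCone ℝ (ℝ ⊗[ℤ] N)) : AddSubmonoid (Module.Dual ℤ N) where
  carrier := {m | ∀ v ∈ σ, 0 ≤ realFunctional m v}
  zero_mem' := fun v _ => by simp
  add_mem' := fun {m m'} h h' v hv => by
    rw [map_add, LinearMap.add_apply]
    exact add_nonneg (h v hv) (h' v hv)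

/-- The pointed monoid `A(σ) = (σ^∨ ∩ M)_*`, written multiplicatively. -/
abbrev coneMonoid (σ : PointedCone ℝ (ℝ ⊗[ℤ] N)) : Type u :=
  WithZero (Multiplicative (dualMonoid σ))

/-- The inclusion of `A(σ) = (σ^∨ ∩ M)_*` in `M_*`. -/
def coneMonoidToLattice (σ : PointedCone ℝ (ℝ ⊗[ℤ] N)) :
    coneMonoid σ →*₀ WithZero (Multiplicative (Module.Dual ℤ N)) :=
  WithZero.map' (AddMonoidHom.toMultiplicative (dualMonoid σ).subtype)

/-- The inclusion `A(σ) → A(τ)` for `τ ⊆ σ`. -/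
def coneRes {τ σ : PointedCone ℝ (ℝ ⊗[ℤ] N)} (h : τ ≤ σ) : coneMonoid σ →*₀ coneMonoid τ :=
  WithZero.map' (AddMonoidHom.toMultiplicative
    (AddSubmonoid.inclusion fun _ hm v hv => hm v (h hv)))

/-- Precomposition with `φ : N → N'`, as a map `A(σ') → A(σ)`, if `φ(σ) ⊆ σ'`. -/
def conePull (φ : N →ₗ[ℤ] N') {σ : PointedCone ℝ (ℝ ⊗[ℤ] N)} {σ' : PointedCone ℝ (ℝ ⊗[ℤ] N')}
    (h : σ.map (φ.baseChange ℝ) ≤ σ') : coneMonoid σ' →*₀ coneMonoid σ :=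
  WithZero.map' (AddMonoidHom.toMultiplicative
    { toFun := fun m => ⟨m.1 ∘ₗ φ, fun v hv => by
        rw [realFunctional_comp]
        exact m.2 _ (h (PointedCone.mem_map.mpr ⟨v, hv, rfl⟩))⟩
      map_zero' := rfl
      map_add' := fun _ _ => rfl })

/-- The map `M'_* → M_*` given by precomposition with `φ : N → N'`. -/
def latticePull (φ : N →ₗ[ℤ] N') :
    WithZero (Multiplicative (Module.Dual ℤ N')) →*₀ WithZero (Multiplicative (Module.Dual ℤ N)) :=
  WithZero.map' (AddMonoidHom.toMultiplicative (φ.dualMap : _ →+ _))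

end Cones

end

/-- A fan: a free abelian group `N` of finite rank with a collection of cones in `N_ℝ`. -/
structure Fan where
  N : Type u
  [grp : AddCommGroup N]
  [free : Module.Free ℤ N]
  [fin : Module.Finite ℤ N]
  toFanIn : FanIn N

attribute [instance] Fan.grp Fan.free Fan.fin

noncomputable section

namespace Fan

/-- The set of cones of a fan, ordered by inclusion. -/
def Pt (Δ : Fan.{u}) : Type u := {σ : PointedCone ℝ (ℝ ⊗[ℤ] Δ.N) // σ ∈ Δ.toFanIn.cones}

/-- The cone underlying a point. -/
abbrev Pt.cone {Δ : Fan.{u}} (σ : Δ.Pt) : PointedCone ℝ (ℝ ⊗[ℤ] Δ.N) := σ.1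

instance (Δ : Fan.{u}) : PartialOrder Δ.Pt := inferInstanceAs (PartialOrder (Subtype _))

/-- The poset topology: the open sets are the sets of cones that are closed under passage to
smaller cones. -/
instance (Δ : Fan.{u}) : TopologicalSpace Δ.Pt := Topology.lowerSet Δ.Pt

theorem isOpen_iff {Δ : Fan.{u}} {U : Set Δ.Pt} : IsOpen U ↔ IsLowerSet U := Iff.rfl

/-- A morphism of fans: a homomorphism `N → N'` such that the image of each cone of `Δ` is
contained in a cone of `Δ'`. -/
@[ext]
structure Hom (Δ Δ' : Fan.{u}) where
  map : Δ.N →ₗ[ℤ] Δ'.N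
  map_cone : ∀ σ ∈ Δ.toFanIn.cones, ∃ σ' ∈ Δ'.toFanIn.cones, σ.map (map.baseChange ℝ) ≤ σ'

theorem map_comp_cone {N N' N'' : Type u} [AddCommGroup N] [AddCommGroup N'] [AddCommGroup N'']
    (φ : N →ₗ[ℤ] N') (ψ : N' →ₗ[ℤ] N'') (σ : PointedCone ℝ (ℝ ⊗[ℤ] N)) :
    σ.map ((ψ ∘ₗ φ).baseChange ℝ) = (σ.map (φ.baseChange ℝ)).map (ψ.baseChange ℝ) := by
  rw [LinearMap.baseChange_comp, PointedCone.map_map]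

theorem map_id_cone {N : Type u} [AddCommGroup N] (σ : PointedCone ℝ (ℝ ⊗[ℤ] N)) :
    σ.map ((LinearMap.id : N →ₗ[ℤ] N).baseChange ℝ) = σ := by
  rw [LinearMap.baseChange_id, PointedCone.map_id]

instance : Category.{u} Fan.{u} where
  Hom := Hom
  id Δ := ⟨LinearMap.id, fun σ hσ => ⟨σ, hσ, (map_id_cone σ).le⟩⟩
  comp {Δ Δ' Δ''} f g := ⟨g.map ∘ₗ f.map, fun σ hσ => by
    obtain ⟨σ', hσ', h⟩ := f.map_cone σ hσ
    obtain ⟨σ'', hσ'', h'⟩ := g.map_cone σ' hσ'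
    refine ⟨σ'', hσ'', ?_⟩
    rw [map_comp_cone]
    exact (Submodule.map_mono h).trans h'⟩
  id_comp _ := rfl
  comp_id _ := rfl
  assoc _ _ _ := rfl

theorem inter_mem (Δ : Fan.{u}) {σ τ : PointedCone ℝ (ℝ ⊗[ℤ] Δ.N)} (hσ : σ ∈ Δ.toFanIn.cones)
    (hτ : τ ∈ Δ.toFanIn.cones) : σ ⊓ τ ∈ Δ.toFanIn.cones :=
  Δ.toFanIn.face_mem σ hσ _ (Δ.toFanIn.inter_face σ hσ τ hτ).1

theorem exists_smallest {Δ Δ' : Fan.{u}} (f : Δ ⟶ Δ') (σ : Δ.Pt) :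
    ∃ σ' : Δ'.Pt, σ.cone.map (f.map.baseChange ℝ) ≤ σ'.cone ∧
      ∀ τ ∈ Δ'.toFanIn.cones, σ.cone.map (f.map.baseChange ℝ) ≤ τ → σ'.cone ≤ τ := by
  obtain ⟨σ₀, h₀, h₀'⟩ := f.map_cone σ.1 σ.2
  let S : Set (PointedCone ℝ (ℝ ⊗[ℤ] Δ'.N)) :=
    {τ | τ ∈ Δ'.toFanIn.cones ∧ σ.cone.map (f.map.baseChange ℝ) ≤ τ}
  have hS : S.Finite := Δ'.toFanIn.finite.subset fun τ hτ => hτ.1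
  obtain ⟨ρ, hρ⟩ := hS.exists_minimal ⟨σ₀, h₀, h₀'⟩
  refine ⟨⟨ρ, hρ.1.1⟩, hρ.1.2, fun τ hτ hle => ?_⟩
  have : ρ ⊓ τ ∈ S := ⟨Δ'.inter_mem hρ.1.1 hτ, le_inf hρ.1.2 hle⟩
  exact (hρ.2 this inf_le_left).trans inf_le_right

/-- The map of posets `Δ → Δ'` of a morphism of fans: it sends `σ` to the smallest cone of `Δ'`
that contains the image of `σ`. -/
def smallest {Δ Δ' : Fan.{u}} (f : Δ ⟶ Δ') (σ : Δ.Pt) : Δ'.Pt := (exists_smallest f σ).choose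

theorem le_smallest {Δ Δ' : Fan.{u}} (f : Δ ⟶ Δ') (σ : Δ.Pt) :
    σ.cone.map (f.map.baseChange ℝ) ≤ (smallest f σ).cone := (exists_smallest f σ).choose_spec.1

theorem smallest_le {Δ Δ' : Fan.{u}} (f : Δ ⟶ Δ') (σ : Δ.Pt) (τ : Δ'.Pt)
    (h : σ.cone.map (f.map.baseChange ℝ) ≤ τ.cone) : smallest f σ ≤ τ :=
  (exists_smallest f σ).choose_spec.2 τ.1 τ.2 h

theorem smallest_mono {Δ Δ' : Fan.{u}} (f : Δ ⟶ Δ') : Monotone (smallest f) := fun _ τ h =>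
  smallest_le f _ _ ((Submodule.map_mono h).trans (le_smallest f τ))

/-- A functional on `N'_ℝ` that is nonnegative on the smallest cone containing the image of `σ`,
and vanishes on the image of `σ`, vanishes on the smallest cone. -/
theorem smallest_vanish {Δ Δ' : Fan.{u}} (f : Δ ⟶ Δ') (σ : Δ.Pt)
    (m : (ℝ ⊗[ℤ] Δ'.N) →ₗ[ℝ] ℝ) (hm : ∀ v ∈ (smallest f σ).cone, 0 ≤ m v)
    (h0 : ∀ v ∈ σ.cone, m (f.map.baseChange ℝ v) = 0) :
    ∀ v ∈ (smallest f σ).cone, m v = 0 := by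
  let F : PointedCone ℝ (ℝ ⊗[ℤ] Δ'.N) :=
    (smallest f σ).cone ⊓ PointedCone.ofSubmodule (LinearMap.ker m)
  have hF : IsFace F (smallest f σ).cone := ⟨m, hm, fun v => Iff.rfl⟩
  have hFm := Δ'.toFanIn.face_mem _ (smallest f σ).2 F hF
  have : (smallest f σ).cone ≤ F := smallest_le f σ ⟨F, hFm⟩ (by
    refine le_inf (le_smallest f σ) ?_
    rintro _ ⟨v, hv, rfl⟩
    exact h0 v hv)
  exact fun v hv => (this hv).2

theorem smallest_id (Δ : Fan.{u}) (σ : Δ.Pt) : smallest (𝟙 Δ) σ = σ := by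
  refine le_antisymm (smallest_le _ _ _ (map_id_cone _).le) ?_
  have := le_smallest (𝟙 Δ) σ
  exact (map_id_cone σ.cone).symm.le.trans this

theorem smallest_comp {Δ Δ' Δ'' : Fan.{u}} (f : Δ ⟶ Δ') (g : Δ' ⟶ Δ'') (σ : Δ.Pt) :
    smallest (f ≫ g) σ = smallest g (smallest f σ) := by
  have e : σ.cone.map ((f ≫ g).map.baseChange ℝ) =
    (σ.cone.map (f.map.baseChange ℝ)).map (g.map.baseChange ℝ) := map_comp_cone _ _ _
  apply le_antisymm
  · apply smallest_le
    rw [e]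
    exact (Submodule.map_mono (le_smallest f σ)).trans (le_smallest g _)
  · have h1 : smallest (f ≫ g) σ ≤ smallest g (smallest f σ) := by
      apply smallest_le
      rw [e]
      exact (Submodule.map_mono (le_smallest f σ)).trans (le_smallest g _)
    apply smallest_le
    obtain ⟨m, hm, hm'⟩ := (Δ''.toFanIn.inter_face _ (smallest g (smallest f σ)).2 _
      (smallest (f ≫ g) σ).2).1
    rintro _ ⟨v, hv, rfl⟩
    have hpos : ∀ w ∈ (smallest f σ).cone, 0 ≤ (m ∘ₗ g.map.baseChange ℝ) w := fun w hw =>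
      hm _ (le_smallest g _ ⟨w, hw, rfl⟩)
    have hz : ∀ w ∈ σ.cone, (m ∘ₗ g.map.baseChange ℝ) (f.map.baseChange ℝ w) = 0 := fun w hw => by
      have hw' : g.map.baseChange ℝ (f.map.baseChange ℝ w) ∈ (smallest (f ≫ g) σ).cone := by
        apply le_smallest (f ≫ g) σ
        rw [e]
        exact ⟨_, ⟨w, hw, rfl⟩, rfl⟩
      exact ((hm' _).mp ⟨h1 hw', hw'⟩).2
    have hv0 := smallest_vanish f σ _ hpos hz v hv
    exact ((hm' _).mpr ⟨le_smallest g _ ⟨v, hv, rfl⟩, hv0⟩).2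

/-- The monoid space `X(N, Δ)`: the poset of cones with the poset topology, and the sheaf
`U ↦ lim_{σ ∈ U} A(σ)` of compatible families. -/
def space (Δ : Fan.{u}) : MonoidSpace.{u} :=
  MonoidSpace.ofFamily Δ.Pt (fun σ => coneMonoid σ.cone)
    (fun U s => ∀ (σ τ : U) (h : τ.1.cone ≤ σ.1.cone), coneRes h (s σ) = s τ)
    (fun U σ τ h => map_zero _)
    (fun U σ τ h => map_one _)
    (fun U s t hs ht σ τ h => by
      rw [Pi.mul_apply, Pi.mul_apply, map_mul, hs σ τ h, ht σ τ h])
    (fun U V h s hs σ τ h' => hs ⟨σ, h σ.2⟩ ⟨τ, h τ.2⟩ h')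
    (fun U s hs σ τ h => by
      obtain ⟨V, hσ, hV, H⟩ := hs σ σ.2
      exact H ⟨σ, hσ⟩ ⟨τ, isOpen_iff.mp V.isOpen h hσ⟩ h)

/-- The cone given by a point of `X(N, Δ)`. -/
def coneOf (Δ : Fan.{u}) (x : Δ.space) : PointedCone ℝ (ℝ ⊗[ℤ] Δ.N) := Pt.cone (Δ := Δ) x

/-- The value in `A(σ)` of a section over `U ∋ σ`. -/
def value (Δ : Fan.{u}) {U : Opens Δ.space} (x : Δ.space) (hx : x ∈ U) :
    Δ.space.sec U →*₀ coneMonoid (Δ.coneOf x) where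
  toFun s := s.1 ⟨x, hx⟩
  map_zero' := rfl
  map_one' := rfl
  map_mul' _ _ := rfl

theorem value_res (Δ : Fan.{u}) {U V : Opens Δ.space} (h : V ≤ U) (x : Δ.space) (hx : x ∈ V)
    (s : Δ.space.sec U) : Δ.value x hx (Δ.space.res h s) = Δ.value x (h hx) s := rfl

theorem coneRes_value (Δ : Fan.{u}) {U : Opens Δ.space} (s : Δ.space.sec U) {x y : Δ.space}
    (hx : x ∈ U) (hy : y ∈ U) (h : Δ.coneOf y ≤ Δ.coneOf x) :
    coneRes h (Δ.value x hx s) = Δ.value y hy s := s.2 ⟨x, hx⟩ ⟨y, hy⟩ h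

theorem sec_ext (Δ : Fan.{u}) {U : Opens Δ.space} {s t : Δ.space.sec U}
    (h : ∀ (x : Δ.space) (hx : x ∈ U), Δ.value x hx s = Δ.value x hx t) : s = t :=
  Subtype.ext (funext fun x => h x.1 x.2)

/-- The section given by a compatible family of values. -/
def mkSec (Δ : Fan.{u}) (U : Opens Δ.space) (a : ∀ x : U, coneMonoid (Δ.coneOf x))
    (h : ∀ (x y : U) (h : Δ.coneOf y ≤ Δ.coneOf x), coneRes h (a x) = a y) : Δ.space.sec U :=
  ⟨a, h⟩

@[simp]
theorem value_mkSec (Δ : Fan.{u}) (U : Opens Δ.space) (a : ∀ x : U, coneMonoid (Δ.coneOf x))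
    (h : ∀ (x y : U) (h : Δ.coneOf y ≤ Δ.coneOf x), coneRes h (a x) = a y) (x : Δ.space)
    (hx : x ∈ U) : Δ.value x hx (Δ.mkSec U a h) = a ⟨x, hx⟩ := rfl

theorem mem_of_le (Δ : Fan.{u}) (U : Opens Δ.space) {x y : Δ.space} (hx : x ∈ U)
    (h : Δ.coneOf y ≤ Δ.coneOf x) : y ∈ U := isOpen_iff.mp U.isOpen h hx

/-- The smallest open neighbourhood of a point. -/
def below (Δ : Fan.{u}) (x : Δ.space) : Opens Δ.space :=
  ⟨{y | Δ.coneOf y ≤ Δ.coneOf x}, isOpen_iff.mpr fun _ _ h h' => le_trans h h'⟩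

/-- Evaluation of germs at `σ`, the canonical map from the stalk of `X(N, Δ)` at `σ` to `A(σ)`. -/
def evalStalk (Δ : Fan.{u}) (x : Δ.space) : Δ.space.stalk x →*₀ coneMonoid (Δ.coneOf x) :=
  Δ.space.stalkLift x (fun _ hx => Δ.value x hx) (fun _ _ _ _ _ _ => rfl)

/-- The canonical map from the stalk of `X(N, Δ)` at `σ` to `M_*`. -/
def stalkToLattice (Δ : Fan.{u}) (x : Δ.space) :
    Δ.space.stalk x →*₀ WithZero (Multiplicative (Module.Dual ℤ Δ.N)) :=
  (coneMonoidToLattice (Δ.coneOf x)).comp (Δ.evalStalk x)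

theorem coneRes_coneRes {N : Type u} [AddCommGroup N] {ρ τ σ : PointedCone ℝ (ℝ ⊗[ℤ] N)}
    (h : ρ ≤ τ) (h' : τ ≤ σ) (a : coneMonoid σ) :
    coneRes h (coneRes h' a) = coneRes (h.trans h') a := by
  induction a using WithZero.recZeroCoe with
  | zero => rfl
  | coe a => rfl

theorem evalStalk_isUnit (Δ : Fan.{u}) (x : Δ.space) (t : Δ.space.stalk x)
    (ht : IsUnit (Δ.evalStalk x t)) : IsUnit t := by
  obtain ⟨U, hU, s, rfl⟩ := Δ.space.germ_exists x t
  obtain ⟨b, hb⟩ := isUnit_iff_exists_inv.mp ht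
  have hb' : Δ.value x hU s * b = 1 := hb
  have hxW : x ∈ Δ.below x := le_refl (Δ.coneOf x)
  have hWU : Δ.below x ≤ U := fun y hy => Δ.mem_of_le U hU hy
  let r : Δ.space.sec (Δ.below x) := Δ.mkSec (Δ.below x) (fun y => coneRes y.2 b)
    (fun _ _ _ => coneRes_coneRes _ _ _)
  have hr : Δ.space.res hWU s * r = 1 := Δ.sec_ext fun y hy => by
    rw [map_mul, map_one, value_res, ← Δ.coneRes_value s hU (hWU hy) hy, value_mkSec, ← map_mul,
      hb', map_one]
  have := congrArg (Δ.space.germ x (Δ.below x) hxW) hr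
  rw [map_mul, map_one, Δ.space.germ_res] at this
  exact IsUnit.of_mul_eq_one _ this

theorem conePull_isUnit {Δ Δ' : Fan.{u}} (f : Δ ⟶ Δ') (σ : Δ.Pt)
    (a : coneMonoid (smallest f σ).cone) (ha : IsUnit (conePull f.map (le_smallest f σ) a)) :
    IsUnit a := by
  obtain ⟨b, hb⟩ := isUnit_iff_exists_inv.mp ha
  induction a using WithZero.recZeroCoe with
  | zero => simp at hb
  | coe a =>
    induction b using WithZero.recZeroCoe with
    | zero => simp at hb
    | coe b =>
      have hab : (Multiplicative.toAdd a).1 ∘ₗ f.map + (Multiplicative.toAdd b).1 = 0 := by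
        have h1 : (conePull f.map (le_smallest f σ) (a : WithZero _)) * (b : WithZero _) = 1 := hb
        have h2 := WithZero.coe_injective h1
        exact congrArg (fun z : Multiplicative (dualMonoid σ.cone) =>
          (Multiplicative.toAdd z).1) h2
      have hz : ∀ v ∈ σ.cone,
          realFunctional (Multiplicative.toAdd a).1 (f.map.baseChange ℝ v) = 0 := fun v hv => by
        have h1 := congrArg (fun z => realFunctional z v) hab
        simp only [map_add, map_zero, LinearMap.add_apply, LinearMap.zero_apply,
          realFunctional_comp] at h1
        have h2 := (Multiplicative.toAdd a).2 _ (le_smallest f σ ⟨v, hv, rfl⟩)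
        have h3 := (Multiplicative.toAdd b).2 v hv
        have h4 : 0 ≤ realFunctional (Multiplicative.toAdd a).1 (f.map.baseChange ℝ v) := h2
        linarith
      have hz' := smallest_vanish f σ _ (Multiplicative.toAdd a).2 hz
      let c : dualMonoid (smallest f σ).cone := ⟨-(Multiplicative.toAdd a).1, fun v hv => by
        rw [map_neg, LinearMap.neg_apply, hz' v hv, neg_zero]⟩
      refine IsUnit.of_mul_eq_one ((Multiplicative.ofAdd c : Multiplicative _) : WithZero _) ?_
      rw [← WithZero.coe_mul, ← WithZero.coe_one]
      congr 1
      exact Subtype.ext (add_neg_cancel (Multiplicative.toAdd a).1)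

/-- The map of spaces underlying `X(φ)`. -/
def mapBase {Δ Δ' : Fan.{u}} (f : Δ ⟶ Δ') : C(Δ.space, Δ'.space) where
  toFun := smallest f
  continuous_toFun := ⟨fun _ hV => isOpen_iff.mpr fun _ _ h hσ =>
    isOpen_iff.mp hV (smallest_mono f h) hσ⟩

theorem coneRes_conePull {N N' : Type u} [AddCommGroup N] [AddCommGroup N'] (φ : N →ₗ[ℤ] N')
    {σ τ : PointedCone ℝ (ℝ ⊗[ℤ] N)} {σ' τ' : PointedCone ℝ (ℝ ⊗[ℤ] N')}
    (hσ : σ.map (φ.baseChange ℝ) ≤ σ') (hτ : τ.map (φ.baseChange ℝ) ≤ τ') (h : τ ≤ σ)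
    (h' : τ' ≤ σ') (a : coneMonoid σ') :
    coneRes h (conePull φ hσ a) = conePull φ hτ (coneRes h' a) := by
  induction a using WithZero.recZeroCoe with
  | zero => rfl
  | coe a => rfl

theorem map_coneOf {Δ Δ' : Fan.{u}} (f : Δ ⟶ Δ') (x : Δ.space) :
    (Δ.coneOf x).map (f.map.baseChange ℝ) ≤ Δ'.coneOf (mapBase f x) := le_smallest f x

theorem mapBase_mono {Δ Δ' : Fan.{u}} (f : Δ ⟶ Δ') {x y : Δ.space}
    (h : Δ.coneOf y ≤ Δ.coneOf x) : Δ'.coneOf (mapBase f y) ≤ Δ'.coneOf (mapBase f x) :=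
  smallest_mono f h

/-- The morphism `X(φ) : X(Δ) ⟶ X(Δ')` of a morphism of fans: on points it sends `σ` to the
smallest cone containing `φ(σ)`, and on sections it is precomposition with `φ`. -/
def mapSpace {Δ Δ' : Fan.{u}} (f : Δ ⟶ Δ') : Δ.space ⟶ Δ'.space where
  base := mapBase f
  app V :=
    { toFun := fun s => Δ.mkSec (V.comap (mapBase f))
        (fun x => conePull f.map (map_coneOf f x) (Δ'.value (mapBase f x) x.2 s))
        (fun x y h => by
          rw [coneRes_conePull f.map (map_coneOf f x) (map_coneOf f y) h (mapBase_mono f h),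
            Δ'.coneRes_value s x.2 y.2])
      map_zero' := Δ.sec_ext fun x hx => by simp
      map_one' := Δ.sec_ext fun x hx => by simp
      map_mul' := fun s t => Δ.sec_ext fun x hx => by simp }
  naturality _ _ := rfl
  isLocal x := ⟨fun t ht => by
    obtain ⟨V, hV, s, rfl⟩ := Δ'.space.germ_exists _ t
    apply evalStalk_isUnit
    exact conePull_isUnit f x _ (ht.map (Δ.evalStalk x))⟩

theorem value_mapSpace {Δ Δ' : Fan.{u}} (f : Δ ⟶ Δ') (V : Opens Δ'.space) (s : Δ'.space.sec V)
    (x : Δ.space) (hx : mapBase f x ∈ V) :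
    Δ.value x hx ((mapSpace f).app V s) =
      conePull f.map (map_coneOf f x) (Δ'.value (mapBase f x) hx s) := rfl

theorem mapBase_id (Δ : Fan.{u}) (x : Δ.space) : mapBase (𝟙 Δ) x = x := smallest_id Δ x

theorem mapBase_comp {Δ Δ' Δ'' : Fan.{u}} (f : Δ ⟶ Δ') (g : Δ' ⟶ Δ'') (x : Δ.space) :
    mapBase (f ≫ g) x = mapBase g (mapBase f x) := smallest_comp f g x

/-- The functor `Δ ↦ X(Δ)` from fans to monoid spaces. -/
def functor : Fan.{u} ⥤ MonoidSpace.{u} where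
  obj := space
  map := mapSpace
  map_id Δ := by
    refine MonoidSpace.Hom.ext_iff'.mpr ⟨ContinuousMap.ext (mapBase_id Δ), fun V s =>
      Δ.sec_ext fun x hx => ?_⟩
    have hx' : x ∈ V := hx
    have hm : mapBase (𝟙 Δ) x ∈ V := (mapBase_id Δ x).symm ▸ hx'
    have hle : Δ.coneOf x ≤ Δ.coneOf (mapBase (𝟙 Δ) x) := (mapBase_id Δ x).symm ▸ le_rfl
    change conePull (𝟙 Δ : Δ ⟶ Δ).map (map_coneOf (𝟙 Δ) x) (Δ.value (mapBase (𝟙 Δ) x) hm s) =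
      Δ.value x hx' s
    rw [← Δ.coneRes_value s hm hx' hle]
    generalize Δ.value (mapBase (𝟙 Δ) x) hm s = a
    induction a using WithZero.recZeroCoe with
    | zero => rfl
    | coe a => rfl
  map_comp {Δ Δ' Δ''} f g := by
    refine MonoidSpace.Hom.ext_iff'.mpr ⟨ContinuousMap.ext (mapBase_comp f g), fun V s =>
      Δ.sec_ext fun x hx => ?_⟩
    have hx' : mapBase g (mapBase f x) ∈ V := hx
    have hm : mapBase (f ≫ g) x ∈ V := (mapBase_comp f g x).symm ▸ hx'
    have hle : Δ''.coneOf (mapBase g (mapBase f x)) ≤ Δ''.coneOf (mapBase (f ≫ g) x) :=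
      (mapBase_comp f g x).symm ▸ le_rfl
    change conePull (f ≫ g).map (map_coneOf (f ≫ g) x) (Δ''.value (mapBase (f ≫ g) x) hm s) =
      conePull f.map (map_coneOf f x) (conePull g.map (map_coneOf g _)
        (Δ''.value (mapBase g (mapBase f x)) hx' s))
    rw [← Δ''.coneRes_value s hm hx' hle]
    generalize Δ''.value (mapBase (f ≫ g) x) hm s = a
    induction a using WithZero.recZeroCoe with
    | zero => rfl
    | coe a => rfl

end Fan

/-! ## The lattice and the cones of a toric monoid scheme -/

/-- The group `M_η` of the nonzero elements of the stalk at the generic point `η`, written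
additively. It is defined as the group of units of the stalk; on a toric monoid scheme every
nonzero element of this stalk is a unit. -/
abbrev GenericGroup (X : MonoidSpace.{u}) (η : X) : Type u := Additive (X.stalk η)ˣ

/-- The `ℤ`-linear dual `N` of `M_η`. -/
abbrev GenericLattice (X : MonoidSpace.{u}) (η : X) : Type u :=
  Module.Dual ℤ (GenericGroup X η)

/-- The set of the elements `1 ⊗ m` of `M_ℝ`, where `m ∈ M_η` is the image of a nonzero element of
the stalk at `x`. -/
def stalkSet (X : MonoidSpace.{u}) {η : X} (h : ∀ x : X, η ⤳ x) (x : X) :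
    Set (ℝ ⊗[ℤ] GenericGroup X η) :=
  {v | ∃ m : GenericGroup X η,
    (∃ a : X.stalk x, a ≠ 0 ∧ X.stalkSpec (h x) a = (m.toMul : X.stalk η)) ∧ v = 1 ⊗ₜ m}

/-- The cone `σ_x` in `N_ℝ`: the dual cone of the convex hull in `M_ℝ` of the nonzero elements of
the stalk at `x`. -/
def stalkCone (X : MonoidSpace.{u}) {η : X} (h : ∀ x : X, η ⤳ x) (x : X) :
    PointedCone ℝ (ℝ ⊗[ℤ] GenericLattice X η) :=
  PointedCone.dual (realPairing (GenericGroup X η)) (convexHull ℝ (stalkSet X h x))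

end

end MonoidScheme

/-!
The idea is to describe both sides by the same data: a poset `P` with a family of submonoids
`S_p` of an abelian group `M`, decreasing in `p`. Such a family, a `MonoidSystem`, has a monoid
space with points `P`, the open sets being the lower sets, and stalks `(S_p)_*`. The space of a
fan is by definition of this form, with `P = Δ` and `S_σ = σ^∨ ∩ M`. A toric monoid scheme `X` is
isomorphic to a space of this form, with `P` the points of `X` ordered by specialization,
`M = M_η` and `S_x` the image of the stalk at `x` (`MonoidSystem.exists_iso`).

Two properties of a system carry the argument. It is *localized* (`MonoidSystem.IsLocalized`) if
`S_q` is a localization of `S_p` at one element for `q ≤ p`, the faces of `S_p` correspond to the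
elements below `p`, and `q ≤ p` can be read off from `S_q`; then the smallest neighbourhood of `p`
is the spectrum of `(S_p)_*`, and the space is a monoid scheme. To recognize a spectrum, `Chart`
lists elementary conditions on a homomorphism `A → 𝒜(U)` that make `U` isomorphic to `MSpec A`.
For a localized system with a least element, separatedness is equivalent to
`MonoidSystem.HasInfSum`:
any two elements `p`, `q` have an infimum `r`, and `S_r = S_p + S_q`. Here the product of the space
with itself is the space of the system `S_p × S_q` on `P × P`, so that the diagonal is explicit.

For a fan, both properties are convex geometry. Faces of `σ` are cut out by integral functionals,
which become invertible on the face (`Fan.system_isLocalized`), and `S_{σ ∩ τ} = S_σ + S_τ` is the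
separation lemma (`Fan.exists_separating`). Gordan's lemma gives finite generation.

For a toric monoid scheme, connectedness and cancellation give the generic point
(`IsToric.exists_generic`), and finitely generated charts show that the system of the stalks is
localized (`IsModel`, `Chart.exists_isModel`), while separatedness gives `HasInfSum`. By normality
the `S_x` are saturated, hence are recovered from their dual cones `σ_x` by Farkas' lemma over `ℤ`
(`eval_mem_dualMonoid_dualCone`). The two properties of the system then say that faces of `σ_x` are
the `σ_y` with `y ≤ x`, and that `σ_x ∩ σ_y` is a common face: the `σ_x` form a fan, and its system
is that of the stalks (`IsToric.exists_fan`).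

A morphism that preserves generic points is determined on all sections by its generic stalk map
`M' → M` (`MonoidSystem.exists_pullback`). The dual `φ : N → N'` of this map sends `σ` into the cone
of the image point, since stalks are mapped to stalks, and the image point is the smallest such
cone, since the maps on stalks are local (`Fan.exists_mapSpace_eq`).
-/

/-! ### Sections, germs and morphisms of monoid spaces -/

namespace MonoidScheme

noncomputable section

namespace MonoidSpace

/-- A section of the structure sheaf is determined by its germs. -/
theorem sec_ext (X : MonoidSpace.{u}) {U : Opens X} {s t : X.sec U}
    (h : ∀ x (hx : x ∈ U), X.germ x U hx s = X.germ x U hx t) : s = t := by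
  have h' : ∀ x : U, ∃ (W : Opens X) (_ : x.1 ∈ W) (h₁ : W ≤ U), X.res h₁ s = X.res h₁ t :=
    fun x => by
      obtain ⟨W, hW, h₁, _, e⟩ := (X.germ_eq_iff x.1 x.2 x.2 s t).mp (h x.1 x.2)
      exact ⟨W, hW, h₁, e⟩
  choose W hW h₁ e using h'
  have hcov : U ≤ iSup W := fun x hx => Opens.mem_iSup.mpr ⟨⟨x, hx⟩, hW ⟨x, hx⟩⟩
  exact (X.glue W U h₁ hcov (fun i => X.res (h₁ i) s)
    (fun i j => by rw [X.res_res, X.res_res])).unique (fun i => rfl) (fun i => (e i).symm)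

/-- A family of germs that is locally given by sections comes from a section. -/
theorem exists_sec (X : MonoidSpace.{u}) (U : Opens X) (g : ∀ x, x ∈ U → X.stalk x)
    (h : ∀ x ∈ U, ∃ (W : Opens X) (_ : x ∈ W) (hW : W ≤ U) (r : X.sec W),
      ∀ y (hy : y ∈ W), X.germ y W hy r = g y (hW hy)) :
    ∃ s : X.sec U, ∀ x (hx : x ∈ U), X.germ x U hx s = g x hx := by
  have h' : ∀ x : U, ∃ (W : Opens X) (_ : x.1 ∈ W) (hW : W ≤ U) (r : X.sec W),
      ∀ y (hy : y ∈ W), X.germ y W hy r = g y (hW hy) := fun x => h x.1 x.2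
  choose W hW hWU r hr using h'
  have hcov : U ≤ iSup W := fun x hx => Opens.mem_iSup.mpr ⟨⟨x, hx⟩, hW ⟨x, hx⟩⟩
  obtain ⟨t, ht, -⟩ := X.glue W U hWU hcov r (fun i j => X.sec_ext fun x hx => by
    rw [X.germ_res, X.germ_res, hr, hr])
  refine ⟨t, fun x hx => ?_⟩
  rw [← hr ⟨x, hx⟩ x (hW ⟨x, hx⟩), ← ht ⟨x, hx⟩, X.germ_res]

/-- If the germ of a section at `x` is a unit, the section is invertible on a neighbourhood of
`x`. -/
theorem exists_inverse (X : MonoidSpace.{u}) {U : Opens X} {x : X} (hx : x ∈ U) (s : X.sec U)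
    (hs : IsUnit (X.germ x U hx s)) :
    ∃ (W : Opens X) (_ : x ∈ W) (h : W ≤ U) (t : X.sec W), X.res h s * t = 1 := by
  obtain ⟨b, hb⟩ := isUnit_iff_exists_inv.mp hs
  obtain ⟨V, hV, t, rfl⟩ := X.germ_exists x b
  have hxVU : x ∈ U ⊓ V := ⟨hx, hV⟩
  have e : X.germ x (U ⊓ V) hxVU (X.res inf_le_left s * X.res inf_le_right t) =
      X.germ x (U ⊓ V) hxVU 1 := by
    rw [map_mul, X.germ_res, X.germ_res, hb, map_one]
  obtain ⟨W, hW, h₁, _, e⟩ := (X.germ_eq_iff x _ _ _ _).mp e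
  refine ⟨W, hW, h₁.trans inf_le_left, X.res (h₁.trans inf_le_right) t, ?_⟩
  rw [map_mul, map_one, X.res_res, X.res_res] at e
  exact e

@[simp]
theorem stalkSpec_germ (X : MonoidSpace.{u}) {y x : X} (h : y ⤳ x) (U : Opens X) (hx : x ∈ U)
    (s : X.sec U) : X.stalkSpec h (X.germ x U hx s) = X.germ y U (h.mem_open U.isOpen hx) s := rfl

theorem stalkSpec_refl (X : MonoidSpace.{u}) {x : X} (h : x ⤳ x) (t : X.stalk x) :
    X.stalkSpec h t = t := by
  obtain ⟨U, hU, s, rfl⟩ := X.germ_exists x t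
  rfl

theorem stalkSpec_stalkSpec (X : MonoidSpace.{u}) {z y x : X} (h : z ⤳ y) (h' : y ⤳ x)
    (t : X.stalk x) : X.stalkSpec h (X.stalkSpec h' t) = X.stalkSpec (h.trans h') t := by
  obtain ⟨U, hU, s, rfl⟩ := X.germ_exists x t
  rfl

theorem Hom.germ_app_congr {X Y : MonoidSpace.{u}} {f g : X ⟶ Y} (h : f = g) (V : Opens Y)
    (s : Y.sec V) (x : X) (hf : f.base x ∈ V) (hg : g.base x ∈ V) :
    X.germ x (V.comap f.base) hf (f.app V s) = X.germ x (V.comap g.base) hg (g.app V s) := by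
  subst h
  rfl

/-- A morphism is determined by the map of spaces and by the germs of the images of sections. -/
theorem Hom.ext_germ {X Y : MonoidSpace.{u}} {f g : X ⟶ Y} (hb : ∀ x, f.base x = g.base x)
    (h : ∀ (V : Opens Y) (s : Y.sec V) (x : X) (hf : f.base x ∈ V) (hg : g.base x ∈ V),
      X.germ x (V.comap f.base) hf (f.app V s) = X.germ x (V.comap g.base) hg (g.app V s)) :
    f = g := by
  have hb' : f.base = g.base := ContinuousMap.ext hb
  refine Hom.ext_iff'.mpr ⟨hb', fun V s => X.sec_ext fun x hx => ?_⟩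
  rw [X.germ_res]
  exact h V s x ((hb x).symm ▸ hx : f.base x ∈ V) hx

section OfStalk

variable {X Y : MonoidSpace.{u}} (b : C(X, Y)) (ψ : ∀ x, Y.stalk (b x) →*₀ X.stalk x)
  (hsec : ∀ (V : Opens Y) (s : Y.sec V) (x : X) (_ : b x ∈ V),
    ∃ (W : Opens X) (_ : x ∈ W) (hW : W ≤ V.comap b) (r : X.sec W),
      ∀ y (hy : y ∈ W), X.germ y W hy r = ψ y (Y.germ (b y) V (hW hy) s))

include hsec in
theorem exists_app_ofStalk (V : Opens Y) (s : Y.sec V) :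
    ∃ r : X.sec (V.comap b), ∀ x (hx : x ∈ V.comap b),
      X.germ x (V.comap b) hx r = ψ x (Y.germ (b x) V hx s) :=
  X.exists_sec (V.comap b) (fun x hx => ψ x (Y.germ (b x) V hx s)) (fun x hx => hsec V s x hx)

/-- The morphism with given underlying continuous map and given local maps on stalks, provided that
these maps take sections to families of germs that are locally given by sections. -/
def Hom.ofStalk (hloc : ∀ x, IsLocalHom (ψ x)) : X ⟶ Y where
  base := b
  app V :=
    { toFun := fun s => (exists_app_ofStalk b ψ hsec V s).choose
      map_zero' := X.sec_ext fun x hx => by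
        rw [(exists_app_ofStalk b ψ hsec V 0).choose_spec x hx]; simp
      map_one' := X.sec_ext fun x hx => by
        rw [(exists_app_ofStalk b ψ hsec V 1).choose_spec x hx]; simp
      map_mul' := fun s t => X.sec_ext fun x hx => by
        rw [(exists_app_ofStalk b ψ hsec V _).choose_spec x hx, map_mul, map_mul, map_mul,
          (exists_app_ofStalk b ψ hsec V s).choose_spec x hx,
          (exists_app_ofStalk b ψ hsec V t).choose_spec x hx] }
  naturality {V W} h s := X.sec_ext fun x hx => by
    rw [X.germ_res]
    exact ((exists_app_ofStalk b ψ hsec W _).choose_spec x hx).trans ((congrArg (ψ x)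
      (Y.germ_res _ h _ s)).trans ((exists_app_ofStalk b ψ hsec V s).choose_spec x (h hx)).symm)
  isLocal x := ⟨fun t ht => by
    obtain ⟨V, hV, s, rfl⟩ := Y.germ_exists _ t
    apply (hloc x).map_nonunit
    rw [← (exists_app_ofStalk b ψ hsec V s).choose_spec x hV]
    exact ht⟩

theorem Hom.stalkMap_ofStalk (hloc : ∀ x, IsLocalHom (ψ x)) (x : X) (t : Y.stalk (b x)) :
    (Hom.ofStalk b ψ hsec hloc).stalkMap x t = ψ x t := by
  obtain ⟨V, hV, s, rfl⟩ := Y.germ_exists _ t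
  exact (exists_app_ofStalk b ψ hsec V s).choose_spec x hV

theorem Hom.germ_app_ofStalk (hloc : ∀ x, IsLocalHom (ψ x)) (V : Opens Y) (s : Y.sec V) (x : X)
    (hx : b x ∈ V) : X.germ x (V.comap b) hx ((Hom.ofStalk b ψ hsec hloc).app V s) =
      ψ x (Y.germ (b x) V hx s) :=
  (exists_app_ofStalk b ψ hsec V s).choose_spec x hx

end OfStalk

/-- A morphism that is a homeomorphism and bijective on stalks is an isomorphism. -/
theorem Hom.exists_iso {X Y : MonoidSpace.{u}} (f : X ⟶ Y) (hb : IsHomeomorph f.base)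
    (hs : ∀ x, Function.Bijective (f.stalkMap x)) : ∃ e : X ≅ Y, e.hom = f := by
  let b := hb.homeomorph
  have hbf : ∀ y, f.base (b.symm y) = y := fun y => b.apply_symm_apply y
  have hfb : ∀ x, b.symm (f.base x) = x := fun x => b.symm_apply_apply x
  let E := fun x => MulEquiv.ofBijective (f.stalkMap x) (hs x)
  have hE : ∀ x t, (E x).symm (f.stalkMap x t) = t := fun x t => (E x).symm_apply_apply t
  let ψ : ∀ y, X.stalk (b.symm y) →*₀ Y.stalk y := fun y =>
    (Y.stalkSpec (specializes_of_eq (hbf y).symm)).comp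
      { toFun := (E (b.symm y)).symm
        map_zero' := by
          conv_lhs => rw [← map_zero (f.stalkMap (b.symm y))]
          exact hE _ _
        map_one' := map_one _
        map_mul' := map_mul _ }
  have hψ : ∀ y (V : Opens Y) (hy : f.base (b.symm y) ∈ V) (hy' : y ∈ V) (s : Y.sec V),
      ψ y (X.germ (b.symm y) (V.comap f.base) hy (f.app V s)) = Y.germ y V hy' s :=
    fun y V hy hy' s => by
      change Y.stalkSpec (specializes_of_eq (hbf y).symm)
        ((E (b.symm y)).symm (f.stalkMap _ (Y.germ _ V hy s))) = _
      rw [hE]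
      rfl
  have hψ' : ∀ y (V : Opens Y) (hy : f.base (b.symm y) ∈ V) (hy' : y ∈ V) (s : Y.sec V)
      (U : Opens X) (hU : b.symm y ∈ U) (t : X.sec U),
      X.germ (b.symm y) (V.comap f.base) hy (f.app V s) = X.germ (b.symm y) U hU t →
      ψ y (X.germ _ U hU t) = Y.germ y V hy' s := fun y V hy hy' s U hU t e => by
    rw [← e, hψ y V hy hy' s]
  have hsec : ∀ (V : Opens X) (s : X.sec V) (y : Y) (hy : b.symm y ∈ V),
      ∃ (W : Opens Y) (_ : y ∈ W) (hW : W ≤ V.comap (b.symm : C(Y, X))) (r : Y.sec W),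
        ∀ z (hz : z ∈ W), Y.germ z W hz r = ψ z (X.germ (b.symm z) V (hW hz) s) := by
    intro V s y hy
    obtain ⟨t, ht⟩ := (hs (b.symm y)).2 (X.germ _ V hy s)
    obtain ⟨W, hW, r, rfl⟩ := Y.germ_exists _ t
    obtain ⟨W', hW', h₁, h₂, e⟩ := (X.germ_eq_iff _ _ _ _ _).mp ht
    have hle : W'.comap (b.symm : C(Y, X)) ≤ W := fun z hz => by
      have : f.base (b.symm z) ∈ W := h₁ (show b.symm z ∈ W' from hz)
      rwa [hbf z] at this
    refine ⟨W'.comap (b.symm : C(Y, X)), hW', fun z hz => h₂ hz, Y.res hle r, fun z hz => ?_⟩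
    rw [Y.germ_res]
    refine (hψ' z W (h₁ hz) (hle hz) r V _ s ?_).symm
    exact (X.germ_eq_iff _ _ _ _ _).mpr ⟨W', hz, h₁, h₂, e⟩
  have hloc : ∀ y, IsLocalHom (ψ y) := fun y => ⟨fun t ht => by
    obtain ⟨t, rfl⟩ := (hs _).2 t
    refine IsUnit.map _ ?_
    change IsUnit (Y.stalkSpec (specializes_of_eq (hbf y).symm)
      ((E (b.symm y)).symm (f.stalkMap _ t))) at ht
    rw [hE] at ht
    have := ht.map (Y.stalkSpec (specializes_of_eq (hbf y)))
    rwa [Y.stalkSpec_stalkSpec, Y.stalkSpec_refl] at this⟩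
  obtain ⟨g, hgb, hg⟩ : ∃ (g : Y ⟶ X) (hgb : ∀ y, g.base y = b.symm y),
      ∀ (V : Opens X) (s : X.sec V) (y : Y) (hy : g.base y ∈ V),
        Y.germ y (V.comap g.base) hy (g.app V s) = ψ y (X.germ (b.symm y) V (hgb y ▸ hy) s) :=
    ⟨Hom.ofStalk (b.symm : C(Y, X)) ψ hsec hloc, fun _ => rfl,
      Hom.germ_app_ofStalk (b.symm : C(Y, X)) ψ hsec hloc⟩
  refine ⟨⟨f, g, ?_, ?_⟩, rfl⟩
  · refine Hom.ext_germ (fun x => (hgb _).trans (hfb x)) fun V s x hx hx' => ?_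
    replace hx : g.base (f.base x) ∈ V := hx
    replace hx' : x ∈ V := hx'
    obtain ⟨W, hW, r, e⟩ := Y.germ_exists _ ((E x).symm (X.germ x V hx' s))
    have e' : X.germ x (W.comap f.base) hW (f.app W r) = X.germ x V hx' s := by
      have := congrArg (f.stalkMap x) e
      rw [show f.stalkMap x ((E x).symm (X.germ x V hx' s)) = _ from
        (E x).apply_symm_apply _] at this
      exact this
    obtain ⟨W', hW', h₁, h₂, e''⟩ := 
      (X.germ_eq_iff x (U := W.comap f.base) (V := V) hW hx' _ _).mp e'
    have hm : b.symm (f.base x) ∈ W' := by rwa [hfb x]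
    have hx₂ : b.symm (f.base x) ∈ V := h₂ hm
    have hx₃ : f.base (b.symm (f.base x)) ∈ W := h₁ hm
    have h4 : ψ (f.base x) (X.germ _ V hx₂ s) = Y.germ (f.base x) W hW r :=
      hψ' (f.base x) W hx₃ hW r V hx₂ s
        ((X.germ_eq_iff _ (U := W.comap f.base) (V := V) hx₃ hx₂ _ _).mpr ⟨W', hm, h₁, h₂, e''⟩)
    exact (congrArg (f.stalkMap x) ((hg V s (f.base x) hx).trans h4)).trans e'
  · refine Hom.ext_germ (fun y => (congrArg f.base (hgb y)).trans (hbf y)) fun V s y hy hy' => ?_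
    replace hy : g.base y ∈ V.comap f.base := hy
    exact (hg (V.comap f.base) (f.app V s) y hy).trans (hψ y V (hgb y ▸ hy) hy' s)

theorem isHomeomorph_of_iso {X Y : MonoidSpace.{u}} (e : X ≅ Y) : IsHomeomorph e.hom.base :=
  (Homeomorph.mk ⟨e.hom.base, e.inv.base,
    fun x => congrArg (fun f : X ⟶ X => f.base x) e.hom_inv_id,
    fun x => congrArg (fun f : Y ⟶ Y => f.base x) e.inv_hom_id⟩
    e.hom.base.continuous e.inv.base.continuous).isHomeomorph

theorem app_bijective_of_iso {X Y : MonoidSpace.{u}} (e : X ≅ Y) (V : Opens Y) :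
    Function.Bijective (e.hom.app V) := by
  have hx : ∀ x, e.inv.base (e.hom.base x) = x :=
    fun x => congrArg (fun f : X ⟶ X => f.base x) e.hom_inv_id
  have hy : ∀ y, e.hom.base (e.inv.base y) = y :=
    fun y => congrArg (fun f : Y ⟶ Y => f.base y) e.inv_hom_id
  constructor
  · intro s t h
    refine Y.sec_ext fun y h' => ?_
    have hm : (e.inv ≫ e.hom).base y ∈ V := (hy y).symm ▸ h'
    have := Hom.germ_app_congr e.inv_hom_id V s y hm h'
    have h2 := Hom.germ_app_congr e.inv_hom_id V t y hm h'
    refine this.symm.trans (Eq.trans ?_ h2)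
    change Y.germ y _ hm (e.inv.app _ (e.hom.app V s)) = Y.germ y _ hm (e.inv.app _ (e.hom.app V t))
    rw [h]
  · intro r
    let W : Opens X := V.comap e.hom.base
    have hle : V ≤ W.comap e.inv.base := fun y h' => ((hy y).symm ▸ h' : e.hom.base _ ∈ V)
    refine ⟨Y.res hle (e.inv.app W r), X.sec_ext fun x h' => ?_⟩
    have h1 := e.hom.naturality hle (e.inv.app W r)
    rw [h1, X.germ_res]
    exact Hom.germ_app_congr e.hom_inv_id W r x _ h'

theorem stalkMap_bijective_of_iso {X Y : MonoidSpace.{u}} (e : X ≅ Y) (x : X) :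
    Function.Bijective (e.hom.stalkMap x) := by
  have hb := isHomeomorph_of_iso e
  -- every open subset of `X` is the preimage of an open subset of `Y`
  have hop : ∀ W : Opens X, ∃ V : Opens Y, V.comap e.hom.base = W := fun W => by
    obtain ⟨V, hV, h⟩ := hb.isInducing.isOpen_iff.mp W.isOpen
    exact ⟨⟨V, hV⟩, Opens.ext h⟩
  constructor
  · intro s t h
    obtain ⟨V, hV, s, rfl⟩ := Y.germ_exists _ s
    obtain ⟨V', hV', t, rfl⟩ := Y.germ_exists _ t
    obtain ⟨W, hW, h₁, h₂, h⟩ := (X.germ_eq_iff _ _ _ _ _).mp h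
    obtain ⟨W', rfl⟩ := hop W
    have hV₁ : W' ≤ V := fun y hy => by
      obtain ⟨x, rfl⟩ := hb.surjective y
      exact h₁ hy
    have hV₂ : W' ≤ V' := fun y hy => by
      obtain ⟨x, rfl⟩ := hb.surjective y
      exact h₂ hy
    refine (Y.germ_eq_iff _ _ _ _ _).mpr ⟨W', hW, hV₁, hV₂, (app_bijective_of_iso e W').1 ?_⟩
    rw [e.hom.naturality, e.hom.naturality]
    exact h
  · intro t
    obtain ⟨W, hW, r, rfl⟩ := X.germ_exists _ t
    obtain ⟨W', rfl⟩ := hop W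
    obtain ⟨s, rfl⟩ := (app_bijective_of_iso e W').2 r
    exact ⟨Y.germ _ W' hW s, rfl⟩

/-! ### Open subspaces -/

/-- The inclusion of an open subspace. -/
def incl (X : MonoidSpace.{u}) (U : Opens X) : PreHom (X.restrict U) X where
  base := ⟨Subtype.val, continuous_subtype_val⟩
  app V := X.res (by rintro _ ⟨y, hy, rfl⟩; exact hy)
  naturality _ _ := (X.res_res _ _ _).trans (X.res_res _ _ _).symm

theorem incl_mem (X : MonoidSpace.{u}) (U : Opens X) (x : X.restrict U) : (X.incl U).base x ∈ U :=
  x.2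

theorem mem_imageOpens (X : MonoidSpace.{u}) {U : Opens X} {V : Opens (X.restrict U)}
    {x : X.restrict U} : (X.incl U).base x ∈ X.imageOpens U V ↔ x ∈ V :=
  ⟨fun ⟨_, hy, e⟩ => (Subtype.ext e : _ = x) ▸ hy, fun h => ⟨x, h, rfl⟩⟩

/-- The sections of an open subspace are sections of the whole space. -/
def restrictSec (X : MonoidSpace.{u}) (U : Opens X) (V : Opens (X.restrict U)) :
    X.sec (X.imageOpens U V) ≃* (X.restrict U).sec V := MulEquiv.refl _

theorem stalkMap_incl_germ (X : MonoidSpace.{u}) (U : Opens X) (x : X.restrict U)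
    (V : Opens (X.restrict U)) (hx : x ∈ V) (s : X.sec (X.imageOpens U V)) :
    (X.incl U).stalkMap x (X.germ _ (X.imageOpens U V) (X.mem_imageOpens.mpr hx) s) =
      (X.restrict U).germ x V hx (X.restrictSec U V s) :=
  (X.restrict U).germ_res x (U := V) (V := (X.imageOpens U V).comap (X.incl U).base)
    (fun _ hy => X.mem_imageOpens.mp hy) (X.mem_imageOpens.mpr hx) (X.restrictSec U V s)

theorem stalkMap_incl_bijective (X : MonoidSpace.{u}) (U : Opens X) (x : X.restrict U) :
    Function.Bijective ((X.incl U).stalkMap x) := by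
  have key : ∀ t : X.stalk ((X.incl U).base x), ∃ (V : Opens (X.restrict U)) (hx : x ∈ V)
      (s : X.sec (X.imageOpens U V)),
      t = X.germ _ (X.imageOpens U V) (X.mem_imageOpens.mpr hx) s := fun t => by
    obtain ⟨V, hV, s, rfl⟩ := X.germ_exists _ t
    have hle : X.imageOpens U (V.comap (X.incl U).base) ≤ V := by
      rintro _ ⟨y, hy, rfl⟩
      exact hy
    exact ⟨V.comap (X.incl U).base, hV, X.res hle s,
      (X.germ_res _ hle (X.mem_imageOpens.mpr hV) s).symm⟩
  constructor
  · intro s t h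
    obtain ⟨V, hV, s, rfl⟩ := key s
    obtain ⟨V', hV', t, rfl⟩ := key t
    rw [X.stalkMap_incl_germ U x V hV, X.stalkMap_incl_germ U x V' hV'] at h
    obtain ⟨W, hW, h₁, h₂, h⟩ := ((X.restrict U).germ_eq_iff _ _ _ _ _).mp h
    exact (X.germ_eq_iff _ _ _ _ _).mpr ⟨X.imageOpens U W, X.mem_imageOpens.mpr hW,
      X.imageOpens_mono U h₁, X.imageOpens_mono U h₂, h⟩
  · intro t
    obtain ⟨V, hV, s, rfl⟩ := (X.restrict U).germ_exists _ t
    exact ⟨_, X.stalkMap_incl_germ U x V hV s⟩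

end MonoidSpace

end

end MonoidScheme

/-! ### Spectra and affine charts -/

namespace MonoidScheme

noncomputable section

open MonoidSpace

theorem isUnit_of_map_bijective {A B : Type u} [CommMonoidWithZero A] [CommMonoidWithZero B]
    {f : A →*₀ B} (hf : Function.Bijective f) {a : A} (h : IsUnit (f a)) : IsUnit a := by
  obtain ⟨b, hb⟩ := isUnit_iff_exists_inv.mp h
  obtain ⟨b, rfl⟩ := hf.2 b
  exact IsUnit.of_mul_eq_one b (hf.1 (by rw [map_mul, hb, map_one]))

namespace MSpec

variable {A : Type u} [CommMonoidWithZero A]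

/-- The prime ideal given by a point of the spectrum. -/
def prime (x : MSpec A) : PrimeIdeal A := x

/-- The point of the spectrum given by a prime ideal. -/
def point (p : PrimeIdeal A) : MSpec A := p

theorem isOpen_iff {U : Set (MSpec A)} :
    IsOpen U ↔ ∃ S : Set A, U = {x | ¬ S ⊆ (prime x).carrier} := Iff.rfl

/-- The open set of the primes that do not contain `a`. -/
def basicOpen (a : A) : Opens (MSpec A) :=
  ⟨{x | a ∉ (prime x).carrier}, isOpen_iff.mpr ⟨{a}, by simp⟩⟩

theorem mem_basicOpen {a : A} {x : MSpec A} : x ∈ basicOpen a ↔ a ∉ (prime x).carrier := Iff.rfl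

theorem exists_basicOpen_le {U : Opens (MSpec A)} {x : MSpec A} (hx : x ∈ U) :
    ∃ a : A, x ∈ basicOpen a ∧ basicOpen a ≤ U := by
  obtain ⟨S, hS⟩ := isOpen_iff.mp U.isOpen
  have hx' : x ∈ (U : Set (MSpec A)) := hx
  rw [hS] at hx'
  obtain ⟨a, haS, ha⟩ := Set.not_subset.mp hx'
  refine ⟨a, ha, fun y hy => ?_⟩
  change y ∈ (U : Set (MSpec A))
  rw [hS]
  exact fun h => hy (h haS)

/-- The value in `A_p` of a section over a neighbourhood of `p`. -/
def value {U : Opens (MSpec A)} (x : MSpec A) (hx : x ∈ U) :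
    (MSpec A).sec U →*₀ (prime x).Loc where
  toFun s := s.1 ⟨x, hx⟩
  map_zero' := rfl
  map_one' := rfl
  map_mul' _ _ := rfl

theorem value_res {U V : Opens (MSpec A)} (h : V ≤ U) (x : MSpec A) (hx : x ∈ V)
    (s : (MSpec A).sec U) : value x hx ((MSpec A).res h s) = value x (h hx) s := rfl

theorem value_ext {U : Opens (MSpec A)} {s t : (MSpec A).sec U}
    (h : ∀ x (hx : x ∈ U), value x hx s = value x hx t) : s = t :=
  Subtype.ext (funext fun x => h x.1 x.2)

theorem exists_frac {U : Opens (MSpec A)} (s : (MSpec A).sec U) {x : MSpec A} (hx : x ∈ U) :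
    ∃ (V : Opens (MSpec A)) (_ : x ∈ V) (h : V ≤ U) (a t : A), ∀ y (hy : y ∈ V),
      ∃ ht : t ∉ (prime y).carrier, value y (h hy) s = Localization.mk a ⟨t, ht⟩ := by
  obtain ⟨V, hV, h, a, t, H⟩ := s.2 ⟨x, hx⟩
  exact ⟨V, hV, h, a, t, fun y hy => H ⟨y, hy⟩⟩

/-- The section `a / t` over an open set on which `t` does not vanish. -/
def frac (U : Opens (MSpec A)) (a t : A) (ht : ∀ x ∈ U, t ∉ (prime x).carrier) :
    (MSpec A).sec U :=
  ⟨fun x => Localization.mk a ⟨t, ht x.1 x.2⟩, fun p => ⟨U, p.2, le_rfl, a, t,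
    fun q => ⟨ht q.1 q.2, rfl⟩⟩⟩

theorem value_frac (U : Opens (MSpec A)) (a t : A) (ht : ∀ x ∈ U, t ∉ (prime x).carrier)
    (x : MSpec A) (hx : x ∈ U) : value x hx (frac U a t ht) = Localization.mk a ⟨t, ht x hx⟩ := rfl

/-- The elements of `A` as sections of the structure sheaf. -/
def const (U : Opens (MSpec A)) : A →*₀ (MSpec A).sec U where
  toFun a := frac U a 1 fun x _ => (prime x).one_notMem
  map_zero' := value_ext fun x hx => by
    rw [value_frac, map_zero]; exact Localization.mk_zero _
  map_one' := value_ext fun x hx => by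
    rw [value_frac, map_one]; exact Localization.mk_one
  map_mul' a b := value_ext fun x hx => by
    rw [map_mul, value_frac, value_frac, value_frac, Localization.mk_mul]
    congr 1
    exact Subtype.ext (mul_one 1).symm

theorem value_const (U : Opens (MSpec A)) (a : A) (x : MSpec A) (hx : x ∈ U) :
    value x hx (const U a) = Localization.mk a 1 := rfl

/-- The canonical map from the stalk of `MSpec A` at `p` to `A_p`. -/
def evalStalk (x : MSpec A) : (MSpec A).stalk x →*₀ (prime x).Loc :=
  (MSpec A).stalkLift x (fun _ hx => value x hx) (fun _ _ _ _ _ _ => rfl)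

theorem evalStalk_germ (x : MSpec A) (U : Opens (MSpec A)) (hx : x ∈ U) (s : (MSpec A).sec U) :
    evalStalk x ((MSpec A).germ x U hx s) = value x hx s := rfl

theorem evalStalk_germ_const (x : MSpec A) (U : Opens (MSpec A)) (hx : x ∈ U) (a : A) :
    evalStalk x ((MSpec A).germ x U hx (const U a)) = Localization.mk a 1 := rfl

theorem evalStalk_bijective (x : MSpec A) : Function.Bijective (evalStalk x) := by
  constructor
  · intro s t h
    obtain ⟨U, hU, s, rfl⟩ := (MSpec A).germ_exists _ s
    obtain ⟨V, hV, t, rfl⟩ := (MSpec A).germ_exists _ t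
    rw [evalStalk_germ, evalStalk_germ] at h
    obtain ⟨U', hxU, hU', a, b, H⟩ := exists_frac s hU
    obtain ⟨V', hxV, hV', a', b', H'⟩ := exists_frac t hV
    obtain ⟨hb, e⟩ := H x hxU
    obtain ⟨hb', e'⟩ := H' x hxV
    rw [e, e', Localization.mk_eq_mk_iff, Localization.r_iff_exists] at h
    obtain ⟨c, hc⟩ := h
    refine ((MSpec A).germ_eq_iff _ _ _ _ _).mpr ⟨U' ⊓ V' ⊓ basicOpen c.1, ⟨⟨hxU, hxV⟩, c.2⟩,
      fun y hy => hU' hy.1.1, fun y hy => hV' hy.1.2, value_ext fun y hy => ?_⟩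
    obtain ⟨hb, e⟩ := H y hy.1.1
    obtain ⟨hb', e'⟩ := H' y hy.1.2
    rw [value_res, value_res, e, e', Localization.mk_eq_mk_iff, Localization.r_iff_exists]
    exact ⟨⟨c.1, hy.2⟩, hc⟩
  · intro t
    induction t using Localization.induction_on with
    | H y =>
      obtain ⟨a, b, hb⟩ := y
      exact ⟨(MSpec A).germ x (basicOpen b) hb (frac _ a b fun _ h => h), rfl⟩

theorem isUnit_germ_const (x : MSpec A) (U : Opens (MSpec A)) (hx : x ∈ U) (a : A) :
    IsUnit ((MSpec A).germ x U hx (const U a)) ↔ a ∉ (prime x).carrier := by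
  constructor
  · intro h hmem
    have h1 := h.map (evalStalk x)
    rw [evalStalk_germ, value_const] at h1
    obtain ⟨b, hb⟩ := isUnit_iff_exists_inv.mp h1
    induction b using Localization.induction_on with
    | H y =>
      obtain ⟨b, t⟩ := y
      rw [Localization.mk_mul, ← Localization.mk_one, Localization.mk_eq_mk_iff,
        Localization.r_iff_exists] at hb
      obtain ⟨c, hc⟩ := hb
      simp only [Submonoid.coe_one, one_mul, mul_one] at hc
      refine (c * t).2 ?_
      change c.1 * t.1 ∈ (prime x).carrier
      rw [← hc, mul_comm a b, ← mul_assoc]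
      exact (prime x).mul_mem _ hmem
  · intro h
    refine isUnit_of_map_bijective (evalStalk_bijective x) ?_
    rw [evalStalk_germ, value_const]
    refine IsUnit.of_mul_eq_one (Localization.mk 1 ⟨a, h⟩) ?_
    rw [Localization.mk_mul, one_mul, mul_one]
    exact Localization.mk_self (⟨a, h⟩ : (prime x).compl)

end MSpec

/-- An affine chart on an open subset `U` of a monoid space: a morphism `θ` from `A` to the
sections over `U` which identifies the points of `U`, as a topological space, with the prime ideals
of `A`, and the stalks with the localizations of `A`. The prime ideal of a point `x` consists of
the elements of `A` whose germ at `x` is not a unit. -/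
structure Chart (X : MonoidSpace.{u}) (U : Opens X) (A : Type u) [CommMonoidWithZero A] where
  θ : A →*₀ X.sec U
  not_isUnit_zero : ∀ x ∈ U, ¬ IsUnit (0 : X.stalk x)
  exists_point : ∀ p : PrimeIdeal A, ∃ (x : X) (hx : x ∈ U),
    ∀ a, a ∈ p.carrier ↔ ¬ IsUnit (X.germ x U hx (θ a))
  point_unique : ∀ (x y : X) (hx : x ∈ U) (hy : y ∈ U),
    (∀ a, IsUnit (X.germ x U hx (θ a)) ↔ IsUnit (X.germ y U hy (θ a))) → x = y
  exists_basic : ∀ (V : Opens X) (x : X) (hx : x ∈ U), x ∈ V → ∃ a,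
    IsUnit (X.germ x U hx (θ a)) ∧ ∀ (y : X) (hy : y ∈ U), IsUnit (X.germ y U hy (θ a)) → y ∈ V
  exists_frac : ∀ (x : X) (hx : x ∈ U) (t : X.stalk x), ∃ a s,
    IsUnit (X.germ x U hx (θ s)) ∧ t * X.germ x U hx (θ s) = X.germ x U hx (θ a)
  exists_of_eq : ∀ (x : X) (hx : x ∈ U) (a b : A), X.germ x U hx (θ a) = X.germ x U hx (θ b) →
    ∃ s, IsUnit (X.germ x U hx (θ s)) ∧ s * a = s * b

namespace Chart

variable {X : MonoidSpace.{u}} {U : Opens X} {A : Type u} [CommMonoidWithZero A]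

section OfIso

variable (i : X.restrict U ≅ MSpec A)

theorem le_imageOpens_comap_top {Y : MonoidSpace.{u}} (f : C(X.restrict U, Y)) :
    U ≤ X.imageOpens U ((⊤ : Opens Y).comap f) := fun x hx => ⟨⟨x, hx⟩, trivial, rfl⟩

/-- The elements of `A` as sections over an open subset isomorphic to `MSpec A`. -/
def ofIsoHom : A →*₀ X.sec U :=
  (X.res (le_imageOpens_comap_top i.hom.base)).comp ((i.hom.app ⊤).comp (MSpec.const ⊤))

theorem stalkMap_incl_ofIsoHom (x : X.restrict U) (a : A) :
    (X.incl U).stalkMap x (X.germ _ U (X.incl_mem U x) (ofIsoHom i a)) =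
      i.hom.stalkMap x ((MSpec A).germ _ ⊤ (Opens.mem_top _) (MSpec.const ⊤ a)) := by
  have h := X.stalkMap_incl_germ U x ((⊤ : Opens (MSpec A)).comap i.hom.base) trivial
    (i.hom.app ⊤ (MSpec.const ⊤ a))
  refine Eq.trans ?_ h
  exact congrArg _ (X.germ_res _ (le_imageOpens_comap_top i.hom.base) (X.incl_mem U x) _)

theorem isUnit_ofIsoHom (x : X) (hx : x ∈ U) (a : A) :
    IsUnit (X.germ x U hx (ofIsoHom i a)) ↔
      a ∉ (MSpec.prime (i.hom.base ⟨x, hx⟩)).carrier := by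
  rw [← MSpec.isUnit_germ_const _ ⊤ (Opens.mem_top _)]
  let x' : X.restrict U := ⟨x, hx⟩
  have e := stalkMap_incl_ofIsoHom i x' a
  constructor
  · intro h
    refine isUnit_of_map_bijective (stalkMap_bijective_of_iso i x') ?_
    rw [← e]
    exact h.map ((X.incl U).stalkMap x')
  · intro h
    have h2 := h.map (i.hom.stalkMap x')
    rw [← e] at h2
    exact isUnit_of_map_bijective (X.stalkMap_incl_bijective U x') h2

/-- The chart given by an isomorphism of an open subspace with a spectrum. -/
def ofIso : Chart X U A where
  θ := ofIsoHom i
  not_isUnit_zero x hx h := by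
    rw [← map_zero (X.germ x U hx), ← map_zero (ofIsoHom i), isUnit_ofIsoHom] at h
    exact h (PrimeIdeal.zero_mem _)
  exists_point p := by
    obtain ⟨⟨x, hx⟩, e⟩ := (isHomeomorph_of_iso i).surjective (MSpec.point p)
    refine ⟨x, hx, fun a => ?_⟩
    rw [isUnit_ofIsoHom, not_not]
    have : i.hom.base ⟨x, hx⟩ = MSpec.point p := e
    rw [this]
    rfl
  point_unique x y hx hy h := by
    have : MSpec.prime (i.hom.base ⟨x, hx⟩) = MSpec.prime (i.hom.base ⟨y, hy⟩) := by
      refine PrimeIdeal.ext (Set.ext fun a => not_iff_not.mp ?_)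
      rw [← isUnit_ofIsoHom, ← isUnit_ofIsoHom]
      exact h a
    exact congrArg Subtype.val ((isHomeomorph_of_iso i).injective this)
  exists_basic V x hx hV := by
    let V' : Opens (X.restrict U) := V.comap (X.incl U).base
    obtain ⟨W, hW, e⟩ := (isHomeomorph_of_iso i).isInducing.isOpen_iff.mp V'.isOpen
    have hmem : ∀ z : X.restrict U, i.hom.base z ∈ W ↔ (X.incl U).base z ∈ V := fun z =>
      Set.ext_iff.mp e z
    obtain ⟨a, ha, hle⟩ := MSpec.exists_basicOpen_le (U := ⟨W, hW⟩) ((hmem ⟨x, hx⟩).mpr hV)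
    exact ⟨a, (isUnit_ofIsoHom i x hx a).mpr ha, fun y hy hya =>
      (hmem ⟨y, hy⟩).mp (hle ((isUnit_ofIsoHom i y hy a).mp hya))⟩
  exists_frac x hx t := by
    let x' : X.restrict U := ⟨x, hx⟩
    obtain ⟨t', ht'⟩ := (stalkMap_bijective_of_iso i x').2 ((X.incl U).stalkMap x' t)
    obtain ⟨⟨a, s⟩, h⟩ : ∃ y : A × (MSpec.prime (i.hom.base x')).compl,
        MSpec.evalStalk _ t' = Localization.mk y.1 y.2 := by
      induction MSpec.evalStalk _ t' using Localization.induction_on with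
      | H y => exact ⟨y, rfl⟩
    refine ⟨a, s.1, (isUnit_ofIsoHom i x hx _).mpr s.2, ?_⟩
    apply (X.stalkMap_incl_bijective U x').1
    have e := stalkMap_incl_ofIsoHom i x'
    refine (map_mul _ _ _).trans ?_
    refine Eq.trans ?_ (e a).symm
    refine Eq.trans (congrArg₂ _ ht'.symm (e s.1)) ?_
    rw [← map_mul]
    congr 1
    apply (MSpec.evalStalk_bijective _).1
    rw [map_mul, h, MSpec.evalStalk_germ_const, MSpec.evalStalk_germ_const, Localization.mk_mul,
      mul_one, Localization.mk_eq_mk_iff, Localization.r_iff_exists]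
    exact ⟨1, by simp [mul_comm]⟩
  exists_of_eq x hx a b h := by
    let x' : X.restrict U := ⟨x, hx⟩
    have e := stalkMap_incl_ofIsoHom i x'
    have h1 := (stalkMap_bijective_of_iso i x').1
      ((e a).symm.trans ((congrArg ((X.incl U).stalkMap x') h).trans (e b)))
    have h2 := congrArg (MSpec.evalStalk _) h1
    rw [MSpec.evalStalk_germ_const, MSpec.evalStalk_germ_const, Localization.mk_eq_mk_iff,
      Localization.r_iff_exists] at h2
    obtain ⟨c, hc⟩ := h2
    refine ⟨c.1, (isUnit_ofIsoHom i x hx _).mpr c.2, by simpa using hc⟩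

end OfIso

variable (c : Chart X U A)

/-- The prime ideal of the elements whose germ at `x` is not a unit. -/
def primeAt (x : X) (hx : x ∈ U) : PrimeIdeal A where
  carrier := {a | ¬ IsUnit (X.germ x U hx (c.θ a))}
  zero_mem := by
    simpa using c.not_isUnit_zero x hx
  mul_mem a b hb h := hb (by
    rw [map_mul, map_mul] at h
    exact isUnit_of_mul_isUnit_right h)
  one_notMem := by simp
  prime {a b} ha hb := by
    simp only [Set.mem_ofPred_eq, not_not, map_mul] at *
    exact ha.mul hb

theorem mem_compl_primeAt (x : X) (hx : x ∈ U) (a : A) :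
    a ∈ (c.primeAt x hx).compl ↔ IsUnit (X.germ x U hx (c.θ a)) := not_not

theorem isUnit_of_compl (x : X) (hx : x ∈ U) (s : (c.primeAt x hx).compl) :
    IsUnit ((((X.germ x U hx).comp c.θ : A →*₀ X.stalk x) : A →* X.stalk x) s) :=
  (c.mem_compl_primeAt x hx s.1).mp s.2

/-- The morphism from `A_p` to the stalk at the point of `p`. -/
def locMap (x : X) (hx : x ∈ U) : (c.primeAt x hx).Loc →*₀ X.stalk x where
  toFun := (Localization.monoidOf (c.primeAt x hx).compl).lift (c.isUnit_of_compl x hx)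
  map_zero' := by
    rw [← Localization.mk_zero (1 : (c.primeAt x hx).compl), Localization.mk_eq_monoidOf_mk',
      Submonoid.LocalizationMap.lift_mk']
    simp
  map_one' := map_one _
  map_mul' := map_mul _

theorem locMap_mk (x : X) (hx : x ∈ U) (a : A) (s : (c.primeAt x hx).compl) :
    c.locMap x hx (Localization.mk a s) * X.germ x U hx (c.θ s) = X.germ x U hx (c.θ a) := by
  change (Localization.monoidOf (c.primeAt x hx).compl).lift (c.isUnit_of_compl x hx)
    (Localization.mk a s) * _ = _
  rw [Localization.mk_eq_monoidOf_mk', mul_comm]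
  exact (((Localization.monoidOf (c.primeAt x hx).compl).lift_mk'_spec (c.isUnit_of_compl x hx)
    _ _ _).mp rfl).symm

theorem locMap_bijective (x : X) (hx : x ∈ U) : Function.Bijective (c.locMap x hx) := by
  constructor
  · intro p q h
    induction p using Localization.induction_on with
    | H p => ?_
    induction q using Localization.induction_on with
    | H q => ?_
    obtain ⟨a, s⟩ := p
    obtain ⟨b, t⟩ := q
    have h1 := c.locMap_mk x hx a s
    have h2 := c.locMap_mk x hx b t
    replace h : c.locMap x hx (Localization.mk a s) = c.locMap x hx (Localization.mk b t) := h
    rw [h] at h1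
    have h3 : X.germ x U hx (c.θ (t.1 * a)) = X.germ x U hx (c.θ (s.1 * b)) := by
      rw [map_mul, map_mul, map_mul, map_mul, ← h1, ← h2, mul_left_comm]
      refine Eq.trans ?_ (mul_left_comm _ _ _)
      rw [mul_comm (X.germ x U hx (c.θ t.1))]
    obtain ⟨r, hr, e⟩ := c.exists_of_eq x hx _ _ h3
    rw [Localization.mk_eq_mk_iff, Localization.r_iff_exists]
    exact ⟨⟨r, (c.mem_compl_primeAt x hx r).mpr hr⟩, e⟩
  · intro t
    obtain ⟨a, s, hs, e⟩ := c.exists_frac x hx t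
    refine ⟨Localization.mk a ⟨s, (c.mem_compl_primeAt x hx s).mpr hs⟩, ?_⟩
    refine hs.mul_right_cancel ?_
    rw [e]
    exact c.locMap_mk x hx a ⟨s, _⟩

/-- The map of spaces from the domain of a chart to the spectrum. -/
def base : C(X.restrict U, MSpec A) where
  toFun x := MSpec.point (c.primeAt _ (X.incl_mem U x))
  continuous_toFun := by
    refine continuous_def.mpr fun V hV => isOpen_iff_mem_nhds.mpr fun x hx => ?_
    obtain ⟨a, ha, hle⟩ := MSpec.exists_basicOpen_le (U := ⟨V, hV⟩) hx
    have ha' := not_not.mp ha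
    obtain ⟨W, hW, hWU, t, ht⟩ := X.exists_inverse _ _ ha'
    refine mem_nhds_iff.mpr ⟨W.comap (X.incl U).base, fun y hy => hle ?_, Opens.isOpen _, hW⟩
    refine MSpec.mem_basicOpen.mpr (not_not.mpr ?_)
    refine IsUnit.of_mul_eq_one (X.germ ((X.incl U).base y) W hy t) ?_
    rw [← X.germ_res _ hWU hy, ← map_mul, ht, map_one]

theorem base_isHomeomorph : IsHomeomorph c.base := by
  have hinj : Function.Injective c.base := fun x y h => by
    refine Subtype.ext (c.point_unique _ _ (X.incl_mem U x) (X.incl_mem U y) fun a => ?_)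
    have h' : c.primeAt _ (X.incl_mem U x) = c.primeAt _ (X.incl_mem U y) := h
    have h'' : a ∈ (c.primeAt _ (X.incl_mem U x)).compl ↔
        a ∈ (c.primeAt _ (X.incl_mem U y)).compl := by rw [h']
    exact ((c.mem_compl_primeAt _ _ a).symm.trans h'').trans (c.mem_compl_primeAt _ _ a)
  have hsurj : Function.Surjective c.base := fun p => by
    obtain ⟨x, hx, h⟩ := c.exists_point (MSpec.prime p)
    refine ⟨⟨x, hx⟩, ?_⟩
    exact PrimeIdeal.ext (Set.ext fun a => (h a).symm)
  refine ⟨c.base.continuous, fun V hV => isOpen_iff_mem_nhds.mpr ?_, hinj, hsurj⟩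
  rintro _ ⟨x, hx, rfl⟩
  obtain ⟨a, ha, hle⟩ := c.exists_basic (X.imageOpens U ⟨V, hV⟩) _ (X.incl_mem U x)
    (X.mem_imageOpens.mpr hx)
  refine mem_nhds_iff.mpr ⟨MSpec.basicOpen a, fun p hp => ?_, Opens.isOpen _, not_not.mpr ha⟩
  obtain ⟨y, rfl⟩ := hsurj p
  exact ⟨y, X.mem_imageOpens.mp (hle _ (X.incl_mem U y) (not_not.mp hp)), rfl⟩

include c in
/-- The domain of a chart is isomorphic to the spectrum. -/
theorem nonempty_iso : Nonempty (X.restrict U ≅ MSpec A) := by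
  let ψ : ∀ x, (MSpec A).stalk (c.base x) →*₀ (X.restrict U).stalk x := fun x =>
    ((X.incl U).stalkMap x).comp ((c.locMap _ (X.incl_mem U x)).comp (MSpec.evalStalk (c.base x)))
  have hψ : ∀ x, Function.Bijective (ψ x) := fun x =>
    (X.stalkMap_incl_bijective U x).comp
      ((c.locMap_bijective _ (X.incl_mem U x)).comp (MSpec.evalStalk_bijective (c.base x)))
  have hsec : ∀ (V : Opens (MSpec A)) (s : (MSpec A).sec V) (x : X.restrict U) (_ : c.base x ∈ V),
      ∃ (W : Opens (X.restrict U)) (_ : x ∈ W) (hW : W ≤ V.comap c.base)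
        (r : (X.restrict U).sec W),
      ∀ y (hy : y ∈ W), (X.restrict U).germ y W hy r =
        ψ y ((MSpec A).germ (c.base y) V (hW hy) s) := by
    intro V s x hx
    obtain ⟨V', hxV, hV', a, t, H⟩ := MSpec.exists_frac s hx
    obtain ⟨ht, -⟩ := H _ hxV
    obtain ⟨W, hW, hWU, r, hr⟩ := X.exists_inverse _ _ (not_not.mp ht)
    refine ⟨W.comap (X.incl U).base ⊓ V'.comap c.base, ⟨hW, hxV⟩, fun y hy => hV' hy.2,
      (X.restrict U).res inf_le_left ((X.incl U).app W (X.res hWU (c.θ a) * r)), fun y hy => ?_⟩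
    rw [(X.restrict U).germ_res]
    obtain ⟨ht', e⟩ := H _ hy.2
    have hyW : (X.incl U).base y ∈ W := hy.1
    change (X.incl U).stalkMap y (X.germ _ W hyW (X.res hWU (c.θ a) * r)) =
      (X.incl U).stalkMap y (c.locMap _ (X.incl_mem U y) (MSpec.value (c.base y) (hV' hy.2) s))
    congr 1
    rw [e]
    have h1 := c.locMap_mk _ (X.incl_mem U y) a ⟨t, ht'⟩
    refine (((c.mem_compl_primeAt _ (X.incl_mem U y) t).mp ht').mul_right_cancel ?_)
    refine Eq.trans ?_ h1.symm
    rw [map_mul, X.germ_res, mul_assoc]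
    have h2 := congrArg (X.germ ((X.incl U).base y) W hyW) hr
    rw [map_mul, map_one, X.germ_res] at h2
    rw [mul_comm (X.germ _ W hyW r), h2, mul_one]
  have hloc : ∀ x, IsLocalHom (ψ x) := fun x => ⟨fun t ht => isUnit_of_map_bijective (hψ x) ht⟩
  obtain ⟨e, -⟩ := (Hom.ofStalk c.base ψ hsec hloc).exists_iso c.base_isHomeomorph fun x => by
    rw [show ⇑((Hom.ofStalk c.base ψ hsec hloc).stalkMap x) = ψ x from
      funext (Hom.stalkMap_ofStalk c.base ψ hsec hloc x)]
    exact hψ x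
  exact ⟨e⟩

include c in
theorem specializes_iff {x y : X} (hx : x ∈ U) (hy : y ∈ U) :
    x ⤳ y ↔ ∀ a, IsUnit (X.germ y U hy (c.θ a)) → IsUnit (X.germ x U hx (c.θ a)) := by
  constructor
  · intro h a ha
    exact ha.map (X.stalkSpec h)
  · intro h
    refine specializes_iff_forall_open.mpr fun V hV hyV => ?_
    obtain ⟨a, ha, H⟩ := c.exists_basic ⟨V, hV⟩ y hy hyV
    exact H x hx (h a ha)

include c in
/-- The domain of a chart is empty or has a point that is contained in no smaller open subset, the
closed point of the spectrum. -/
theorem eq_bot_or_exists_top : U = ⊥ ∨ ∃ (x : X) (hx : x ∈ U), (∀ y ∈ U, y ⤳ x) ∧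
    ∀ a, IsUnit (X.germ x U hx (c.θ a)) ↔ IsUnit a := by
  by_cases h : IsUnit (0 : A)
  · refine Or.inl (Opens.ext (Set.eq_empty_iff_forall_notMem.mpr fun x hx => ?_))
    apply c.not_isUnit_zero x hx
    rw [← map_zero (X.germ x U hx), ← map_zero c.θ]
    exact (h.map _).map _
  · right
    let m : PrimeIdeal A :=
      { carrier := {a | ¬ IsUnit a}
        zero_mem := h
        mul_mem := fun a b hb h => hb (isUnit_of_mul_isUnit_right h)
        one_notMem := by simp
        prime := by
          intro a b ha hb
          simp only [Set.mem_ofPred_eq, not_not] at *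
          exact ha.mul hb }
    obtain ⟨x, hx, e⟩ := c.exists_point m
    have e' : ∀ a, IsUnit (X.germ x U hx (c.θ a)) ↔ IsUnit a := fun a =>
      (not_iff_not.mp (e a)).symm
    exact ⟨x, hx, fun y hy => (c.specializes_iff hy hx).mpr fun a ha =>
      (((e' a).mp ha).map c.θ).map _, e'⟩

end Chart

theorem isAffineOpen_iff {X : MonoidSpace.{u}} {U : Opens X} :
    IsAffineOpen X U ↔ ∃ (A : Type u) (_ : CommMonoidWithZero A), Nonempty (Chart X U A) :=
  ⟨fun ⟨A, hA, ⟨i⟩⟩ => ⟨A, hA, ⟨Chart.ofIso i⟩⟩, fun ⟨A, hA, ⟨c⟩⟩ => ⟨A, hA, c.nonempty_iso⟩⟩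

end

end MonoidScheme

/-! ### Monoid spaces of systems of submonoids of a lattice -/

namespace MonoidScheme

noncomputable section

open MonoidSpace

/-- The pointed monoid `M_*` of an abelian group `M`, written multiplicatively. -/
abbrev Pointed (M : Type u) [AddCommGroup M] : Type u := WithZero (Multiplicative M)

/-- An element of `M` as an element of `M_*`. -/
def Pointed.of {M : Type u} [AddCommGroup M] (m : M) : Pointed M :=
  ((Multiplicative.ofAdd m : Multiplicative M) : WithZero (Multiplicative M))

namespace Pointed

variable {M K : Type u} [AddCommGroup M] [AddCommGroup K]

theorem of_ne_zero (m : M) : of m ≠ 0 := WithZero.coe_ne_zero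

theorem of_injective : Function.Injective (of : M → Pointed M) := fun _ _ h =>
  Multiplicative.ofAdd.injective (WithZero.coe_injective h)

theorem of_add (m n : M) : of (m + n) = of m * of n := rfl

theorem of_zero : of (0 : M) = 1 := rfl

theorem eq_zero_or_of (t : Pointed M) : t = 0 ∨ ∃ m, t = of m := by
  induction t using WithZero.recZeroCoe with
  | zero => exact Or.inl rfl
  | coe a => exact Or.inr ⟨Multiplicative.toAdd a, rfl⟩

/-- The map `M_* → K_*` of a homomorphism `M → K`. -/
def map (φ : M →+ K) : Pointed M →*₀ Pointed K := WithZero.map' (AddMonoidHom.toMultiplicative φ)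

@[simp] theorem map_of (φ : M →+ K) (m : M) : map φ (of m) = of (φ m) := rfl

theorem map_injective {φ : M →+ K} (h : Function.Injective φ) : Function.Injective (map φ) := by
  intro s t e
  rcases eq_zero_or_of s with rfl | ⟨s, rfl⟩ <;> rcases eq_zero_or_of t with rfl | ⟨t, rfl⟩
  · rfl
  · exact absurd (e.symm.trans (map_zero (map φ))) (of_ne_zero (φ t))
  · exact absurd (e.trans (map_zero (map φ))) (of_ne_zero (φ s))
  · exact congrArg of (h (of_injective e))

/-- The inclusion of `S_*` in `M_*` for a submonoid `S` of `M`. -/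
def incl (S : AddSubmonoid M) : WithZero (Multiplicative S) →*₀ Pointed M :=
  WithZero.map' (AddMonoidHom.toMultiplicative S.subtype)

theorem incl_coe (S : AddSubmonoid M) (m : M) (h : m ∈ S) :
    incl S ((Multiplicative.ofAdd (⟨m, h⟩ : S) : Multiplicative S) : WithZero _) = of m := rfl

theorem eq_zero_or_coe {S : AddSubmonoid M} (t : WithZero (Multiplicative S)) :
    t = 0 ∨ ∃ (m : M) (h : m ∈ S),
      t = ((Multiplicative.ofAdd (⟨m, h⟩ : S) : Multiplicative S) : WithZero _) := by
  induction t using WithZero.recZeroCoe with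
  | zero => exact Or.inl rfl
  | coe a => exact Or.inr ⟨(Multiplicative.toAdd a).1, (Multiplicative.toAdd a).2, rfl⟩

theorem incl_injective (S : AddSubmonoid M) : Function.Injective (incl S) := by
  intro s t e
  rcases eq_zero_or_coe s with rfl | ⟨s, hs, rfl⟩ <;>
    rcases eq_zero_or_coe t with rfl | ⟨t, ht, rfl⟩
  · rfl
  · exact absurd (e.symm.trans (map_zero (incl S))) (of_ne_zero t)
  · exact absurd (e.trans (map_zero (incl S))) (of_ne_zero s)
  · obtain rfl : s = t := of_injective e
    rfl

/-- The elements of `S_*` inside `M_*`. -/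
def Mem (S : AddSubmonoid M) (t : Pointed M) : Prop := t = 0 ∨ ∃ m ∈ S, t = of m

theorem mem_iff {S : AddSubmonoid M} {t : Pointed M} : Mem S t ↔ ∃ a, incl S a = t := by
  constructor
  · rintro (rfl | ⟨m, hm, rfl⟩)
    · exact ⟨0, map_zero _⟩
    · exact ⟨_, incl_coe S m hm⟩
  · rintro ⟨a, rfl⟩
    rcases eq_zero_or_coe a with rfl | ⟨m, hm, rfl⟩
    · exact Or.inl (map_zero _)
    · exact Or.inr ⟨m, hm, rfl⟩

theorem mem_of {S : AddSubmonoid M} {m : M} : Mem S (of m) ↔ m ∈ S := by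
  constructor
  · rintro (h | ⟨n, hn, h⟩)
    · exact absurd h (of_ne_zero m)
    · rwa [of_injective h]
  · exact fun h => Or.inr ⟨m, h, rfl⟩

end Pointed

/-- If the stalks of a monoid space are identified with the monoids `(S_x)_*`, the units of the
stalks are the elements of `S_x` whose negatives lie in `S_x`. -/
theorem isUnit_iff_neg_mem {X : MonoidSpace.{u}} {M : Type u} [AddCommGroup M]
    {S : X → AddSubmonoid M} {e : ∀ x : X, X.stalk x →*₀ Pointed M}
    (he : ∀ x, Function.Injective (e x)) (hmem : ∀ x t, Pointed.Mem (S x) t ↔ ∃ a, e x a = t)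
    (x : X) (t : X.stalk x) :
    IsUnit t ↔ ∃ m, e x t = Pointed.of m ∧ -m ∈ S x := by
  constructor
  · intro h
    obtain ⟨b, hb⟩ := isUnit_iff_exists_inv.mp h
    have h1 := congrArg (e x) hb
    rw [map_mul, map_one] at h1
    have hb' := (hmem x _).mpr ⟨b, rfl⟩
    rcases Pointed.eq_zero_or_of (e x t) with h2 | ⟨m, h2⟩
    · rw [h2, zero_mul] at h1
      exact absurd h1 zero_ne_one
    rcases Pointed.eq_zero_or_of (e x b) with h3 | ⟨n, h3⟩
    · rw [h3, mul_zero] at h1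
      exact absurd h1 zero_ne_one
    refine ⟨m, h2, ?_⟩
    rw [h2, h3, ← Pointed.of_add, ← Pointed.of_zero] at h1
    rw [h3, Pointed.mem_of] at hb'
    rwa [neg_eq_of_add_eq_zero_right (Pointed.of_injective h1)]
  · rintro ⟨m, hm, h⟩
    obtain ⟨b, hb⟩ := (hmem x _).mp (Pointed.mem_of.mpr h)
    refine IsUnit.of_mul_eq_one b (he x ?_)
    rw [map_mul, hm, hb, map_one, ← Pointed.of_add, add_neg_cancel, Pointed.of_zero]

/-- A system of submonoids `S_p` of an abelian group `M`, indexed by a poset and order reversing: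
`S_p ⊆ S_q` for `q ≤ p`. -/
structure MonoidSystem (P : Type u) [PartialOrder P] (M : Type u) [AddCommGroup M] where
  S : P → AddSubmonoid M
  anti : ∀ {q p : P}, q ≤ p → S p ≤ S q

namespace MonoidSystem

variable {P : Type u} [PartialOrder P] {M : Type u} [AddCommGroup M] (𝒮 : MonoidSystem P M)

/-- The inclusion `(S_p)_* → (S_q)_*` for `q ≤ p`. -/
def res {q p : P} (h : q ≤ p) :
    WithZero (Multiplicative (𝒮.S p)) →*₀ WithZero (Multiplicative (𝒮.S q)) :=
  WithZero.map' (AddMonoidHom.toMultiplicative (AddSubmonoid.inclusion (𝒮.anti h)))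

theorem incl_res {q p : P} (h : q ≤ p) (a : WithZero (Multiplicative (𝒮.S p))) :
    Pointed.incl _ (𝒮.res h a) = Pointed.incl _ a := by
  rcases Pointed.eq_zero_or_coe a with rfl | ⟨m, hm, rfl⟩
  · simp
  · rfl

/-- The monoid space of a system: the poset with the lower set topology, and the sheaf
`U ↦ lim_{p ∈ U} (S_p)_*`. -/
def space : MonoidSpace.{u} :=
  letI : TopologicalSpace P := Topology.lowerSet P
  MonoidSpace.ofFamily P (fun p => WithZero (Multiplicative (𝒮.S p)))
    (fun U s => ∀ (p q : U) (h : q.1 ≤ p.1), 𝒮.res h (s p) = s q)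
    (fun _ p q h => map_zero _)
    (fun _ p q h => map_one _)
    (fun _ s t hs ht p q h => by
      rw [Pi.mul_apply, Pi.mul_apply, map_mul, hs p q h, ht p q h])
    (fun U V h s hs p q h' => hs ⟨p, h p.2⟩ ⟨q, h q.2⟩ h')
    (fun U s hs p q h => by
      obtain ⟨V, hp, hV, H⟩ := hs p p.2
      have hq : q.1 ∈ V := (show IsLowerSet (V : Set P) from V.2) h hp
      exact H ⟨p, hp⟩ ⟨q, hq⟩ h)

/-- The element of the poset underlying a point. -/
def idx (x : 𝒮.space) : P := x

/-- The point given by an element of the poset. -/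
def pt (p : P) : 𝒮.space := p

theorem isOpen_iff {U : Set 𝒮.space} :
    IsOpen U ↔ ∀ x y : 𝒮.space, 𝒮.idx y ≤ 𝒮.idx x → x ∈ U → y ∈ U :=
  ⟨fun h _ _ hyx hx => (h : @IsLowerSet P _ U) hyx hx,
    fun h => (fun x y hyx hx => h x y hyx hx : @IsLowerSet P _ U)⟩

theorem mem_of_le (U : Opens 𝒮.space) {x y : 𝒮.space} (h : 𝒮.idx y ≤ 𝒮.idx x) (hx : x ∈ U) :
    y ∈ U := 𝒮.isOpen_iff.mp U.isOpen x y h hx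

/-- The smallest open neighbourhood of a point. -/
def below (p : P) : Opens 𝒮.space :=
  ⟨{x | 𝒮.idx x ≤ p}, 𝒮.isOpen_iff.mpr fun _ _ h hx => h.trans hx⟩

@[simp] theorem mem_below {p : P} {x : 𝒮.space} : x ∈ 𝒮.below p ↔ 𝒮.idx x ≤ p := Iff.rfl

theorem specializes_iff {x y : 𝒮.space} : x ⤳ y ↔ 𝒮.idx x ≤ 𝒮.idx y :=
  ⟨fun h => h.mem_open (𝒮.below (𝒮.idx y)).isOpen (𝒮.mem_below.mpr le_rfl),
    fun h => specializes_iff_forall_open.mpr fun _ hU hy => 𝒮.isOpen_iff.mp hU y x h hy⟩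

/-- The value in `(S_p)_*` of a section over a neighbourhood of `p`. -/
def rawValue {U : Opens 𝒮.space} (x : 𝒮.space) (hx : x ∈ U) :
    𝒮.space.sec U →*₀ WithZero (Multiplicative (𝒮.S (𝒮.idx x))) where
  toFun s := s.1 ⟨x, hx⟩
  map_zero' := rfl
  map_one' := rfl
  map_mul' _ _ := rfl

/-- The value in `M_*` of a section over a neighbourhood of `p`. -/
def value {U : Opens 𝒮.space} (x : 𝒮.space) (hx : x ∈ U) : 𝒮.space.sec U →*₀ Pointed M :=
  (Pointed.incl _).comp (𝒮.rawValue x hx)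

theorem value_res {U V : Opens 𝒮.space} (h : V ≤ U) (x : 𝒮.space) (hx : x ∈ V)
    (s : 𝒮.space.sec U) : 𝒮.value x hx (𝒮.space.res h s) = 𝒮.value x (h hx) s := rfl

theorem mem_value {U : Opens 𝒮.space} (x : 𝒮.space) (hx : x ∈ U) (s : 𝒮.space.sec U) :
    Pointed.Mem (𝒮.S (𝒮.idx x)) (𝒮.value x hx s) := Pointed.mem_iff.mpr ⟨_, rfl⟩

theorem value_eq {U : Opens 𝒮.space} (s : 𝒮.space.sec U) {x y : 𝒮.space} (hx : x ∈ U)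
    (hy : y ∈ U) (h : 𝒮.idx y ≤ 𝒮.idx x) : 𝒮.value y hy s = 𝒮.value x hx s := by
  have : 𝒮.rawValue y hy s = 𝒮.res h (𝒮.rawValue x hx s) := (s.2 ⟨x, hx⟩ ⟨y, hy⟩ h).symm
  change Pointed.incl _ (𝒮.rawValue y hy s) = Pointed.incl _ (𝒮.rawValue x hx s)
  rw [this, incl_res]

theorem value_ext {U : Opens 𝒮.space} {s t : 𝒮.space.sec U}
    (h : ∀ x (hx : x ∈ U), 𝒮.value x hx s = 𝒮.value x hx t) : s = t :=
  Subtype.ext (funext fun x => Pointed.incl_injective _ (h x.1 x.2))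

/-- The section given by a compatible family of values. -/
def mkSec (U : Opens 𝒮.space)
    (a : ∀ x : 𝒮.space, x ∈ U → WithZero (Multiplicative (𝒮.S (𝒮.idx x))))
    (ha : ∀ (x y : 𝒮.space) (hx : x ∈ U) (hy : y ∈ U), 𝒮.idx y ≤ 𝒮.idx x →
      Pointed.incl _ (a x hx) = Pointed.incl _ (a y hy)) : 𝒮.space.sec U :=
  ⟨fun x => a x.1 x.2, fun x y h => Pointed.incl_injective _
    ((𝒮.incl_res h _).trans (ha x.1 y.1 x.2 y.2 h))⟩

theorem value_mkSec (U : Opens 𝒮.space)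
    (a : ∀ x : 𝒮.space, x ∈ U → WithZero (Multiplicative (𝒮.S (𝒮.idx x))))
    (ha : ∀ (x y : 𝒮.space) (hx : x ∈ U) (hy : y ∈ U), 𝒮.idx y ≤ 𝒮.idx x →
      Pointed.incl _ (a x hx) = Pointed.incl _ (a y hy)) (x : 𝒮.space) (hx : x ∈ U) :
    𝒮.value x hx (𝒮.mkSec U a ha) = Pointed.incl _ (a x hx) := rfl

/-- The section over the smallest neighbourhood of `p`, or a smaller open set, given by an element
of `(S_p)_*`. -/
def const (U : Opens 𝒮.space) {p : P} (hU : U ≤ 𝒮.below p) :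
    WithZero (Multiplicative (𝒮.S p)) →*₀ 𝒮.space.sec U where
  toFun a := 𝒮.mkSec U (fun _ hx => 𝒮.res (hU hx) a) fun _ _ hx hy _ =>
    (𝒮.incl_res (hU hx) a).trans (𝒮.incl_res (hU hy) a).symm
  map_zero' := 𝒮.value_ext fun x hx => by simp [value_mkSec]
  map_one' := 𝒮.value_ext fun x hx => by simp [value_mkSec]
  map_mul' a b := 𝒮.value_ext fun x hx => by simp [value_mkSec]

theorem value_const (U : Opens 𝒮.space) {p : P} (hU : U ≤ 𝒮.below p)
    (a : WithZero (Multiplicative (𝒮.S p))) (x : 𝒮.space) (hx : x ∈ U) :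
    𝒮.value x hx (𝒮.const U hU a) = Pointed.incl _ a := 𝒮.incl_res (hU hx) a

/-- The canonical map from the stalk at `p` to `M_*`. -/
def ev (x : 𝒮.space) : 𝒮.space.stalk x →*₀ Pointed M :=
  𝒮.space.stalkLift x (fun _ hx => 𝒮.value x hx) (fun _ _ _ _ _ _ => rfl)

theorem ev_germ (x : 𝒮.space) (U : Opens 𝒮.space) (hx : x ∈ U) (s : 𝒮.space.sec U) :
    𝒮.ev x (𝒮.space.germ x U hx s) = 𝒮.value x hx s := rfl

theorem mem_ev (x : 𝒮.space) (t : 𝒮.space.stalk x) :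
    Pointed.Mem (𝒮.S (𝒮.idx x)) (𝒮.ev x t) := by
  obtain ⟨U, hU, s, rfl⟩ := 𝒮.space.germ_exists _ t
  exact 𝒮.mem_value x hU s

theorem ev_injective (x : 𝒮.space) : Function.Injective (𝒮.ev x) := by
  intro s t h
  obtain ⟨U, hU, s, rfl⟩ := 𝒮.space.germ_exists _ s
  obtain ⟨V, hV, t, rfl⟩ := 𝒮.space.germ_exists _ t
  rw [ev_germ, ev_germ] at h
  refine (𝒮.space.germ_eq_iff _ _ _ _ _).mpr ⟨𝒮.below (𝒮.idx x), 𝒮.mem_below.mpr le_rfl,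
    fun y hy => 𝒮.mem_of_le U hy hU, fun y hy => 𝒮.mem_of_le V hy hV,
    𝒮.value_ext fun y hy => ?_⟩
  rw [value_res, value_res, 𝒮.value_eq s hU _ hy, 𝒮.value_eq t hV _ hy, h]

theorem exists_ev (x : 𝒮.space) {t : Pointed M} (ht : Pointed.Mem (𝒮.S (𝒮.idx x)) t) :
    ∃ a, 𝒮.ev x a = t := by
  obtain ⟨a, rfl⟩ := Pointed.mem_iff.mp ht
  exact ⟨𝒮.space.germ x (𝒮.below (𝒮.idx x)) (𝒮.mem_below.mpr le_rfl) (𝒮.const _ le_rfl a),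
    𝒮.value_const _ _ _ _ _⟩

theorem isUnit_iff (x : 𝒮.space) (t : 𝒮.space.stalk x) :
    IsUnit t ↔ ∃ m, 𝒮.ev x t = Pointed.of m ∧ -m ∈ 𝒮.S (𝒮.idx x) :=
  isUnit_iff_neg_mem (S := fun x => 𝒮.S (𝒮.idx x)) 𝒮.ev_injective
    (fun x _ => ⟨𝒮.exists_ev x, fun ⟨a, ha⟩ => ha ▸ 𝒮.mem_ev x a⟩) x t

/-- Conditions on a system under which the smallest neighbourhood of each `p` is the spectrum of
`(S_p)_*`: for `q ≤ p` the monoid `S_q` is a localization of `S_p` at a single element, every face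
of `S_p` consists of the elements that become invertible in some `S_q`, and `q ≤ p` is determined by
`S_q`. -/
structure IsLocalized : Prop where
  exists_denom : ∀ {q p : P}, q ≤ p → ∃ m ∈ 𝒮.S p, -m ∈ 𝒮.S q ∧
    ∀ a ∈ 𝒮.S q, ∃ k : ℕ, a + k • m ∈ 𝒮.S p
  exists_face : ∀ (p : P) (F : AddSubmonoid M), F ≤ 𝒮.S p →
    (∀ a ∈ 𝒮.S p, ∀ b ∈ 𝒮.S p, a + b ∈ F → a ∈ F) → ∃ q ≤ p, ∀ a ∈ 𝒮.S p, a ∈ F ↔ -a ∈ 𝒮.S q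
  le_of_le : ∀ {q q' p : P}, q ≤ p → q' ≤ p → 𝒮.S q' ≤ 𝒮.S q → q ≤ q'

variable {𝒮}

theorem IsLocalized.le_of_neg_mem (h : 𝒮.IsLocalized) {q q' p : P} (hq : q ≤ p) (hq' : q' ≤ p)
    (H : ∀ m ∈ 𝒮.S p, -m ∈ 𝒮.S q' → -m ∈ 𝒮.S q) : q ≤ q' := by
  refine h.le_of_le hq hq' fun a ha => ?_
  obtain ⟨m, hm, hm', hk⟩ := h.exists_denom hq'
  obtain ⟨k, hk⟩ := hk a ha
  have := add_mem (𝒮.anti hq hk) (nsmul_mem (H m hm hm') k)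
  rwa [smul_neg, add_neg_cancel_right] at this

theorem isUnit_germ_const {p : P} (x : 𝒮.space) (hx : x ∈ 𝒮.below p)
    (a : WithZero (Multiplicative (𝒮.S p))) :
    IsUnit (𝒮.space.germ x (𝒮.below p) hx (𝒮.const _ le_rfl a)) ↔
      ∃ m, Pointed.incl _ a = Pointed.of m ∧ -m ∈ 𝒮.S (𝒮.idx x) := by
  rw [isUnit_iff, ev_germ, value_const]

/-- The affine chart of a localized system around a point. -/
def IsLocalized.chart (h : 𝒮.IsLocalized) (p : P) :
    Chart 𝒮.space (𝒮.below p) (WithZero (Multiplicative (𝒮.S p))) where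
  θ := 𝒮.const _ le_rfl
  not_isUnit_zero x hx h := by
    obtain ⟨m, hm, -⟩ := (𝒮.isUnit_iff x 0).mp h
    rw [map_zero] at hm
    exact Pointed.of_ne_zero m hm.symm
  exists_point q := by
    let F : AddSubmonoid M :=
      { carrier := {m | ∃ hm : m ∈ 𝒮.S p,
          ((Multiplicative.ofAdd (⟨m, hm⟩ : 𝒮.S p) : Multiplicative _) : WithZero _) ∉ q.carrier}
        zero_mem' := ⟨zero_mem _, q.one_notMem⟩
        add_mem' := by
          rintro a b ⟨ha, ha'⟩ ⟨hb, hb'⟩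
          exact ⟨add_mem ha hb, q.prime ha' hb'⟩ }
    obtain ⟨r, hr, H⟩ := h.exists_face p F (fun m hm => hm.1) (by
      rintro a ha b hb ⟨hab, hab'⟩
      refine ⟨ha, fun h' => hab' ?_⟩
      have := q.mul_mem
        ((Multiplicative.ofAdd (⟨b, hb⟩ : 𝒮.S p) : Multiplicative _) : WithZero _) h'
      rw [mul_comm] at this
      exact this)
    have hr' : 𝒮.pt r ∈ 𝒮.below p := hr
    refine ⟨𝒮.pt r, hr', fun a => ?_⟩
    rw [isUnit_germ_const]
    rcases Pointed.eq_zero_or_coe a with rfl | ⟨m, hm, rfl⟩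
    · refine iff_of_true q.zero_mem ?_
      rintro ⟨m, hm, -⟩
      rw [map_zero] at hm
      exact Pointed.of_ne_zero m hm.symm
    · rw [← not_iff_not, not_not, Pointed.incl_coe]
      constructor
      · exact fun h' => ⟨m, rfl, (H m hm).mp ⟨hm, h'⟩⟩
      · rintro ⟨n, hn, h'⟩
        obtain rfl := Pointed.of_injective hn
        exact ((H m hm).mpr h').2
  point_unique x y hx hy H := by
    have key : ∀ x y : 𝒮.space, ∀ (hx : x ∈ 𝒮.below p) (hy : y ∈ 𝒮.below p),
        (∀ a, IsUnit (𝒮.space.germ x (𝒮.below p) hx (𝒮.const _ le_rfl a)) →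
          IsUnit (𝒮.space.germ y (𝒮.below p) hy (𝒮.const _ le_rfl a))) → 𝒮.idx y ≤ 𝒮.idx x := by
      intro x y hx hy H
      refine h.le_of_neg_mem hy hx fun m hm hmx => ?_
      have := H ((Multiplicative.ofAdd (⟨m, hm⟩ : 𝒮.S p) : Multiplicative _) : WithZero _)
        ((isUnit_germ_const x hx _).mpr ⟨m, Pointed.incl_coe _ _ _, hmx⟩)
      obtain ⟨n, hn, h'⟩ := (isUnit_germ_const y hy _).mp this
      rw [Pointed.incl_coe] at hn
      rwa [Pointed.of_injective hn]
    exact le_antisymm (α := P) (key y x hy hx fun a => (H a).mpr) (key x y hx hy fun a => (H a).mp)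
  exists_basic V x hx hV := by
    obtain ⟨m, hm, hm', hk⟩ := h.exists_denom (𝒮.mem_below.mp hx)
    refine ⟨((Multiplicative.ofAdd (⟨m, hm⟩ : 𝒮.S p) : Multiplicative _) : WithZero _),
      (isUnit_germ_const x hx _).mpr ⟨m, Pointed.incl_coe _ _ _, hm'⟩, fun y hy hy' => ?_⟩
    obtain ⟨n, hn, h'⟩ := (isUnit_germ_const y hy _).mp hy'
    rw [Pointed.incl_coe] at hn
    obtain rfl := Pointed.of_injective hn
    refine 𝒮.mem_of_le V (h.le_of_le hy hx fun a ha => ?_) hV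
    obtain ⟨k, hk⟩ := hk a ha
    have := add_mem (𝒮.anti hy hk) (nsmul_mem h' k)
    rwa [smul_neg, add_neg_cancel_right] at this
  exists_frac x hx t := by
    rcases 𝒮.mem_ev x t with h0 | ⟨n, hn, h0⟩
    · refine ⟨0, 1, by simp, 𝒮.ev_injective x ?_⟩
      rw [map_mul, h0, zero_mul, map_zero, map_zero, map_zero]
    · obtain ⟨m, hm, hm', hk⟩ := h.exists_denom (𝒮.mem_below.mp hx)
      obtain ⟨k, hk⟩ := hk n hn
      refine ⟨((Multiplicative.ofAdd (⟨_, hk⟩ : 𝒮.S p) : Multiplicative _) : WithZero _),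
        ((Multiplicative.ofAdd (⟨_, nsmul_mem hm k⟩ : 𝒮.S p) : Multiplicative _) : WithZero _),
        (isUnit_germ_const x hx _).mpr ⟨k • m, Pointed.incl_coe _ _ _, ?_⟩, 𝒮.ev_injective x ?_⟩
      · rw [← smul_neg]
        exact nsmul_mem hm' k
      · rw [map_mul, h0, ev_germ, ev_germ, value_const, value_const, Pointed.incl_coe,
          Pointed.incl_coe, Pointed.of_add]
  exists_of_eq x hx a b e := by
    have h1 := congrArg (𝒮.ev x) e
    rw [ev_germ, ev_germ, value_const, value_const] at h1
    exact ⟨1, by simp, by rw [Pointed.incl_injective _ h1]⟩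

theorem IsLocalized.isMonoidScheme (h : 𝒮.IsLocalized) : IsMonoidScheme 𝒮.space := fun x =>
  ⟨𝒮.below (𝒮.idx x), 𝒮.mem_below.mpr le_rfl, isAffineOpen_iff.mpr ⟨_, _, ⟨h.chart _⟩⟩⟩

theorem eq_bot_or_eq_below_of_isAffineOpen {U : Opens 𝒮.space} (hU : IsAffineOpen 𝒮.space U) :
    U = ⊥ ∨ ∃ p, U = 𝒮.below p := by
  obtain ⟨A, _, ⟨c⟩⟩ := isAffineOpen_iff.mp hU
  rcases c.eq_bot_or_exists_top with h | ⟨x, hx, h, -⟩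
  · exact Or.inl h
  · exact Or.inr ⟨𝒮.idx x, Opens.ext (Set.ext fun y =>
      ⟨fun hy => 𝒮.specializes_iff.mp (h y hy), fun hy => 𝒮.mem_of_le U hy hx⟩)⟩

variable (𝒮)

/-- A monoid space in which every point has a smallest neighbourhood, and whose stalks are
identified with the monoids of a system in a way compatible with specialization, is isomorphic to
the space of the system. -/
theorem exists_iso (X : MonoidSpace.{u}) (b : X → P) (hb : Function.Bijective b)
    (hle : ∀ x y : X, x ⤳ y ↔ b x ≤ b y)
    (hnhd : ∀ x : X, ∃ U : Opens X, x ∈ U ∧ ∀ y ∈ U, y ⤳ x)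
    (e : ∀ x : X, X.stalk x →*₀ Pointed M) (he : ∀ x, Function.Injective (e x))
    (hmem : ∀ x t, Pointed.Mem (𝒮.S (b x)) t ↔ ∃ a, e x a = t)
    (hspec : ∀ (y x : X) (h : y ⤳ x) (t : X.stalk x), e y (X.stalkSpec h t) = e x t) :
    ∃ i : X ≅ 𝒮.space, (∀ x, i.hom.base x = 𝒮.pt (b x)) ∧
      ∀ x t, e x (i.hom.stalkMap x t) = 𝒮.ev (i.hom.base x) t := by
  let bc : C(X, 𝒮.space) := ⟨fun x => 𝒮.pt (b x), continuous_def.mpr fun V hV =>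
    isOpen_iff_mem_nhds.mpr fun x hx => by
      obtain ⟨U, hxU, hU⟩ := hnhd x
      exact mem_nhds_iff.mpr ⟨U, fun y hy => 𝒮.isOpen_iff.mp hV (𝒮.pt (b x)) (𝒮.pt (b y))
        ((hle y x).mp (hU y hy)) hx, U.isOpen, hxU⟩⟩
  have hex : ∀ x (t : 𝒮.space.stalk (bc x)), ∃ a, e x a = 𝒮.ev (bc x) t := fun x t =>
    (hmem x _).mp (𝒮.mem_ev (bc x) t)
  choose f hf using hex
  let ψ : ∀ x, 𝒮.space.stalk (bc x) →*₀ X.stalk x := fun x =>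
    { toFun := f x
      map_zero' := he x (by rw [hf, map_zero, map_zero])
      map_one' := he x (by rw [hf, map_one, map_one])
      map_mul' := fun s t => he x (by rw [hf, map_mul, map_mul, hf, hf]) }
  have hψ : ∀ x t, e x (ψ x t) = 𝒮.ev (bc x) t := hf
  have hbij : ∀ x, Function.Bijective (ψ x) := fun x =>
    ⟨fun s t h => 𝒮.ev_injective _ (by rw [← hψ, ← hψ, h]), fun t => by
      obtain ⟨s, hs⟩ := 𝒮.exists_ev (bc x) ((hmem x _).mpr ⟨t, rfl⟩)
      exact ⟨s, he x (by rw [hψ, hs])⟩⟩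
  have hsec : ∀ (V : Opens 𝒮.space) (s : 𝒮.space.sec V) (x : X) (_ : bc x ∈ V),
      ∃ (W : Opens X) (_ : x ∈ W) (hW : W ≤ V.comap bc) (r : X.sec W),
        ∀ y (hy : y ∈ W), X.germ y W hy r = ψ y (𝒮.space.germ (bc y) V (hW hy) s) := by
    intro V s x hx
    obtain ⟨W, hW, r, hr⟩ := X.germ_exists x (ψ x (𝒮.space.germ (bc x) V hx s))
    obtain ⟨U, hxU, hU⟩ := hnhd x
    have hUV : ∀ y ∈ U, bc y ∈ V := fun y hy => 𝒮.mem_of_le V ((hle y x).mp (hU y hy)) hx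
    refine ⟨W ⊓ U, ⟨hW, hxU⟩, fun y hy => hUV y hy.2, X.res inf_le_left r, fun y hy => he y ?_⟩
    have hyU : y ∈ U := hy.2
    have h1 : 𝒮.value (bc y) (hUV y hyU) s = 𝒮.value (bc x) hx s :=
      𝒮.value_eq s hx (hUV y hyU) ((hle y x).mp (hU y hyU))
    rw [X.germ_res, hψ, ev_germ, h1, ← ev_germ, ← hψ, ← hr, ← hspec y x (hU y hyU),
      X.stalkSpec_germ]
  have hloc : ∀ x, IsLocalHom (ψ x) := fun x => ⟨fun t ht => isUnit_of_map_bijective (hbij x) ht⟩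
  have hbc : IsHomeomorph bc := ⟨bc.continuous, fun U hU => 𝒮.isOpen_iff.mpr (by
    rintro _ y hy ⟨x, hx, rfl⟩
    obtain ⟨z, hz⟩ := hb.2 (𝒮.idx y)
    refine ⟨z, ((hle z x).mpr (hz.le.trans hy)).mem_open hU hx, hz⟩), hb⟩
  obtain ⟨i, hi⟩ := (Hom.ofStalk bc ψ hsec hloc).exists_iso hbc fun x => by
    rw [show ⇑((Hom.ofStalk bc ψ hsec hloc).stalkMap x) = ψ x from
      funext (Hom.stalkMap_ofStalk bc ψ hsec hloc x)]
    exact hbij x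
  refine ⟨i, fun x => by rw [hi]; rfl, ?_⟩
  rw [hi]
  intro x t
  exact (congrArg (e x) (Hom.stalkMap_ofStalk bc ψ hsec hloc x t)).trans (hψ x t)

end MonoidSystem

/-! ### The system of a fan -/

namespace Fan

/-- The system of the monoids `σ^∨ ∩ M` of a fan. -/
def system (Δ : Fan.{u}) : MonoidSystem Δ.Pt (Module.Dual ℤ Δ.N) where
  S σ := dualMonoid σ.cone
  anti h _ hm v hv := hm v (h hv)

theorem stalkToLattice_eq (Δ : Fan.{u}) (x : Δ.space) (t : Δ.space.stalk x) :
    Δ.stalkToLattice x t = Δ.system.ev x t := by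
  obtain ⟨U, hU, s, rfl⟩ := Δ.space.germ_exists x t
  rfl

end Fan

end

end MonoidScheme

/-! ### Products of systems and separatedness -/

namespace MonoidScheme

noncomputable section

open MonoidSpace

/-- The pullback of a chart along an isomorphism. -/
def Chart.pullback {X Y : MonoidSpace.{u}} (e : X ≅ Y) {V : Opens Y} {A : Type u}
    [CommMonoidWithZero A] (c : Chart Y V A) : Chart X (V.comap e.hom.base) A :=
  have key : ∀ (x : X) (hx : e.hom.base x ∈ V) (a : A),
      IsUnit (X.germ x (V.comap e.hom.base) hx (e.hom.app V (c.θ a))) ↔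
        IsUnit (Y.germ (e.hom.base x) V hx (c.θ a)) := fun x hx a =>
    ⟨fun h => isUnit_of_map_bijective (stalkMap_bijective_of_iso e x) h,
      fun h => h.map (e.hom.stalkMap x)⟩
  { θ := (e.hom.app V).comp c.θ
    not_isUnit_zero := fun x hx h => c.not_isUnit_zero _ hx
      (isUnit_of_map_bijective (stalkMap_bijective_of_iso e x) (by rwa [map_zero]))
    exists_point := fun p => by
      obtain ⟨y, hy, h⟩ := c.exists_point p
      obtain ⟨x, rfl⟩ := (isHomeomorph_of_iso e).surjective y
      exact ⟨x, hy, fun a => (h a).trans (not_congr (key x hy a).symm)⟩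
    point_unique := fun x y hx hy h => (isHomeomorph_of_iso e).injective
      (c.point_unique _ _ hx hy fun a => ((key x hx a).symm.trans (h a)).trans (key y hy a))
    exists_basic := fun W x hx hW => by
      obtain ⟨W', hW', e'⟩ := (isHomeomorph_of_iso e).isInducing.isOpen_iff.mp W.isOpen
      have hmem : ∀ z, e.hom.base z ∈ W' ↔ z ∈ W := fun z => Set.ext_iff.mp e' z
      obtain ⟨a, ha, h⟩ := c.exists_basic ⟨W', hW'⟩ (e.hom.base x) hx ((hmem x).mpr hW)
      exact ⟨a, (key x hx a).mpr ha, fun y hy hya => (hmem y).mp (h _ hy ((key y hy a).mp hya))⟩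
    exists_frac := fun x hx t => by
      obtain ⟨t, rfl⟩ := (stalkMap_bijective_of_iso e x).2 t
      obtain ⟨a, s, hs, h⟩ := c.exists_frac _ hx t
      exact ⟨a, s, (key x hx s).mpr hs,
        (map_mul (e.hom.stalkMap x) _ _).symm.trans (congrArg (e.hom.stalkMap x) h)⟩
    exists_of_eq := fun x hx a b h => by
      obtain ⟨s, hs, h'⟩ := c.exists_of_eq _ hx a b ((stalkMap_bijective_of_iso e x).1 h)
      exact ⟨s, (key x hx s).mpr hs, h'⟩ }

theorem IsAffineOpen.comap {X Y : MonoidSpace.{u}} (e : X ≅ Y) {V : Opens Y}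
    (h : IsAffineOpen Y V) : IsAffineOpen X (V.comap e.hom.base) := by
  obtain ⟨A, _, ⟨c⟩⟩ := isAffineOpen_iff.mp h
  exact isAffineOpen_iff.mpr ⟨A, _, ⟨c.pullback e⟩⟩

theorem isAffineOpen_of_comap {X Y : MonoidSpace.{u}} (e : X ≅ Y) {V : Opens Y}
    (h : IsAffineOpen X (V.comap e.hom.base)) : IsAffineOpen Y V := by
  have h' := h.comap e.symm
  have hV : (V.comap e.hom.base).comap e.symm.hom.base = V := Opens.ext (Set.ext fun y => by
    have hy : e.hom.base (e.inv.base y) = y :=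
      congrArg (fun f : Y ⟶ Y => f.base y) e.inv_hom_id
    change e.hom.base (e.inv.base y) ∈ V ↔ y ∈ V
    rw [hy])
  rwa [hV] at h'

theorem sec_bot_subsingleton (X : MonoidSpace.{u}) : Subsingleton (X.sec ⊥) :=
  ⟨fun _ _ => X.sec_ext fun _ hx => hx.elim⟩

theorem isAffineOpen_bot (X : MonoidSpace.{u}) : IsAffineOpen X ⊥ := by
  have := sec_bot_subsingleton X
  refine isAffineOpen_iff.mpr ⟨PUnit, inferInstance, ⟨?_⟩⟩
  exact
    { θ :=
        { toFun := fun _ => 0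
          map_zero' := rfl
          map_one' := Subsingleton.elim _ _
          map_mul' := fun _ _ => Subsingleton.elim _ _ }
      not_isUnit_zero := fun x hx => hx.elim
      exists_point := fun p => (p.one_notMem p.zero_mem).elim
      point_unique := fun x _ hx => hx.elim
      exists_basic := fun _ x hx => hx.elim
      exists_frac := fun x hx => hx.elim
      exists_of_eq := fun x hx => hx.elim }

namespace MonoidSystem

variable {P Q : Type u} [PartialOrder P] [PartialOrder Q] {M K : Type u} [AddCommGroup M]
  [AddCommGroup K] (𝒮 : MonoidSystem P M) (𝒯 : MonoidSystem Q K)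

section Hom

variable {𝒮 𝒯} (b : P → Q) (hb : Monotone b) (φ : K →+ M)
  (hφ : ∀ p, ∀ k ∈ 𝒯.S (b p), φ k ∈ 𝒮.S p)
  (hloc : ∀ p, ∀ k ∈ 𝒯.S (b p), -φ k ∈ 𝒮.S p → -k ∈ 𝒯.S (b p))

/-- The morphism of spaces given by a monotone map of posets and a compatible homomorphism of
groups. -/
def hom : 𝒮.space ⟶ 𝒯.space :=
  let pull (p : P) : WithZero (Multiplicative (𝒯.S (b p))) →*₀ WithZero (Multiplicative (𝒮.S p)) :=
    WithZero.map' (AddMonoidHom.toMultiplicative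
      ((φ.comp (𝒯.S (b p)).subtype).codRestrict (𝒮.S p) fun k => hφ p k.1 k.2))
  have hpull (p : P) (a : WithZero (Multiplicative (𝒯.S (b p)))) :
      Pointed.incl _ (pull p a) = Pointed.map φ (Pointed.incl _ a) := by
    rcases Pointed.eq_zero_or_coe a with rfl | ⟨m, hm, rfl⟩
    · simp
    · rfl
  let bc : C(𝒮.space, 𝒯.space) := ⟨fun x => 𝒯.pt (b (𝒮.idx x)), continuous_def.mpr fun V hV =>
    𝒮.isOpen_iff.mpr fun x y h hx => 𝒯.isOpen_iff.mp hV _ _ (hb h) hx⟩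
  have hval (V : Opens 𝒯.space) (s : 𝒯.space.sec V) (x : 𝒮.space) (hx : bc x ∈ V) :
      Pointed.incl _ (pull (𝒮.idx x) (𝒯.rawValue (bc x) hx s)) =
        Pointed.map φ (𝒯.value (bc x) hx s) := hpull _ _
  { base := bc
    app := fun V =>
      { toFun := fun s => 𝒮.mkSec (V.comap bc) (fun x hx => pull (𝒮.idx x) (𝒯.rawValue (bc x) hx s))
          fun x y hx hy h => by
            rw [hval V s x hx, hval V s y hy, 𝒯.value_eq s hx hy (hb h)]
        map_zero' := 𝒮.value_ext fun x hx => (hval V 0 x hx).trans <| by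
          rw [map_zero, map_zero, map_zero]
        map_one' := 𝒮.value_ext fun x hx => (hval V 1 x hx).trans <| by
          rw [map_one, map_one, map_one]
        map_mul' := fun s t => 𝒮.value_ext fun x hx => (hval V (s * t) x hx).trans <| by
          rw [map_mul, map_mul, map_mul]
          exact (congrArg₂ _ (hval V s x hx) (hval V t x hx)).symm }
    naturality := fun _ _ => rfl
    isLocal := fun x => ⟨fun t ht => by
      obtain ⟨V, hV, s, rfl⟩ := 𝒯.space.germ_exists _ t
      obtain ⟨m, hm, hm'⟩ := (𝒮.isUnit_iff x _).mp ht
      have h1 : Pointed.map φ (𝒯.value (bc x) hV s) = Pointed.of m := (hval V s x hV).symm.trans hm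
      refine (𝒯.isUnit_iff _ _).mpr ?_
      rcases 𝒯.mem_value (bc x) hV s with h0 | ⟨k, hk, h0⟩
      · rw [h0, map_zero] at h1
        exact absurd h1.symm (Pointed.of_ne_zero m)
      · rw [h0, Pointed.map_of] at h1
        refine ⟨k, h0, hloc _ k hk ?_⟩
        rw [Pointed.of_injective h1]
        exact hm'⟩ }

theorem value_hom (V : Opens 𝒯.space) (s : 𝒯.space.sec V) (x : 𝒮.space)
    (hx : (hom b hb φ hφ hloc).base x ∈ V) :
    𝒮.value x hx ((hom b hb φ hφ hloc).app V s) =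
      Pointed.map φ (𝒯.value ((hom b hb φ hφ hloc).base x) hx s) := by
  have hpull (p : P) (a : WithZero (Multiplicative (𝒯.S (b p)))) :
      Pointed.incl _ ((WithZero.map' (AddMonoidHom.toMultiplicative
      ((φ.comp (𝒯.S (b p)).subtype).codRestrict (𝒮.S p) fun k => hφ p k.1 k.2)) :
        WithZero (Multiplicative (𝒯.S (b p))) →*₀ WithZero (Multiplicative (𝒮.S p))) a) =
        Pointed.map φ (Pointed.incl _ a) := by
    rcases Pointed.eq_zero_or_coe a with rfl | ⟨m, hm, rfl⟩
    · simp
    · rfl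
  exact hpull _ _

end Hom

/-- The product of two systems. -/
def prod : MonoidSystem (P × Q) (M × K) where
  S x := (𝒮.S x.1).prod (𝒯.S x.2)
  anti h _ hm := ⟨𝒮.anti h.1 hm.1, 𝒯.anti h.2 hm.2⟩

/-- The first projection from the space of a product of systems. -/
def fst : (𝒮.prod 𝒯).space ⟶ 𝒮.space :=
  hom Prod.fst (fun _ _ h => h.1) (AddMonoidHom.inl M K) (fun _ _ hk => ⟨hk, zero_mem _⟩)
    (fun _ _ _ h => h.1)

/-- The second projection from the space of a product of systems. -/
def snd : (𝒮.prod 𝒯).space ⟶ 𝒯.space :=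
  hom Prod.snd (fun _ _ h => h.2) (AddMonoidHom.inr M K) (fun _ _ hk => ⟨zero_mem _, hk⟩)
    (fun _ _ _ h => h.2)

variable {𝒮 𝒯}

theorem IsLocalized.prod (h : 𝒮.IsLocalized) (h' : 𝒯.IsLocalized) : (𝒮.prod 𝒯).IsLocalized where
  exists_denom {q p} hqp := by
    obtain ⟨m, hm, hm', hk⟩ := h.exists_denom hqp.1
    obtain ⟨n, hn, hn', hl⟩ := h'.exists_denom hqp.2
    refine ⟨(m, n), ⟨hm, hn⟩, ⟨hm', hn'⟩, fun a ha => ?_⟩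
    obtain ⟨k, hk⟩ := hk a.1 ha.1
    obtain ⟨l, hl⟩ := hl a.2 ha.2
    refine ⟨k + l, ?_, ?_⟩
    · have := add_mem hk (nsmul_mem hm l)
      rwa [add_assoc, ← add_smul] at this
    · have := add_mem hl (nsmul_mem hn k)
      rwa [add_assoc, ← add_smul, add_comm l k] at this
  exists_face p F hF hface := by
    -- a face of a product is the product of its intersections with the two factors
    have hsplit : ∀ a ∈ (𝒮.prod 𝒯).S p, a ∈ F ↔ (a.1, 0) ∈ F ∧ (0, a.2) ∈ F := fun a ha => by
      have e : (a.1, (0 : K)) + ((0 : M), a.2) = a := by simp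
      have h1 : (a.1, (0 : K)) ∈ (𝒮.prod 𝒯).S p := ⟨ha.1, zero_mem _⟩
      have h2 : ((0 : M), a.2) ∈ (𝒮.prod 𝒯).S p := ⟨zero_mem _, ha.2⟩
      constructor
      · intro haF
        refine ⟨hface _ h1 _ h2 (by rwa [e]), hface _ h2 _ h1 (by rwa [add_comm, e])⟩
      · rintro ⟨h3, h4⟩
        rw [← e]
        exact add_mem h3 h4
    obtain ⟨q, hq, H⟩ := h.exists_face p.1 (F.comap (AddMonoidHom.inl M K))
      (fun a ha => (hF ha).1) (fun a ha b hb hab => hface (a, 0) ⟨ha, zero_mem _⟩ (b, 0)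
        ⟨hb, zero_mem _⟩ (by simpa using hab))
    obtain ⟨r, hr, H'⟩ := h'.exists_face p.2 (F.comap (AddMonoidHom.inr M K))
      (fun a ha => (hF ha).2) (fun a ha b hb hab => hface (0, a) ⟨zero_mem _, ha⟩ (0, b)
        ⟨zero_mem _, hb⟩ (by simpa using hab))
    refine ⟨(q, r), ⟨hq, hr⟩, fun a ha => (hsplit a ha).trans ?_⟩
    exact and_congr (H a.1 ha.1) (H' a.2 ha.2)
  le_of_le {q q' p} hq hq' hle := by
    refine ⟨h.le_of_le hq.1 hq'.1 fun a ha => ?_, h'.le_of_le hq.2 hq'.2 fun a ha => ?_⟩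
    · exact (hle (show (a, (0 : K)) ∈ _ from ⟨ha, zero_mem _⟩)).1
    · exact (hle (show ((0 : M), a) ∈ _ from ⟨zero_mem _, ha⟩)).2

section Lift

variable {T : MonoidSpace.{u}} (f : T ⟶ 𝒮.space) (g : T ⟶ 𝒯.space)

theorem not_isUnit_zero_of_hom (f : T ⟶ 𝒮.space) (x : T) : ¬ IsUnit (0 : T.stalk x) := fun h => by
  rw [← map_zero (f.stalkMap x)] at h
  obtain ⟨m, hm, -⟩ := (𝒮.isUnit_iff _ _).mp ((f.isLocal x).map_nonunit _ h)
  rw [map_zero] at hm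
  exact Pointed.of_ne_zero m hm.symm

/-- A pair of morphisms to the spaces of two systems factors through the space of the product. -/
theorem exists_lift : ∃ h : T ⟶ (𝒮.prod 𝒯).space, h ≫ 𝒮.fst 𝒯 = f ∧ h ≫ 𝒮.snd 𝒯 = g := by
  let ℛ := 𝒮.prod 𝒯
  let bc : C(T, ℛ.space) := ⟨fun x => ℛ.pt (𝒮.idx (f.base x), 𝒯.idx (g.base x)),
    continuous_def.mpr fun V hV => isOpen_iff_mem_nhds.mpr fun x hx => by
      refine mem_nhds_iff.mpr ⟨(𝒮.below (𝒮.idx (f.base x))).comap f.base ⊓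
        (𝒯.below (𝒯.idx (g.base x))).comap g.base, fun y hy => ?_,
        ((Opens.isOpen _).inter (Opens.isOpen _)),
        ⟨𝒮.mem_below.mpr le_rfl, 𝒯.mem_below.mpr le_rfl⟩⟩
      exact ℛ.isOpen_iff.mp hV (ℛ.pt (𝒮.idx (f.base x), 𝒯.idx (g.base x))) _ ⟨hy.1, hy.2⟩ hx⟩
  -- the map on stalks sends `(m, k)` to the product of the images of `m` and `k`
  have hex : ∀ x (w : ℛ.space.stalk (bc x)), ∃ r : T.stalk x, (ℛ.ev _ w = 0 → r = 0) ∧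
      ∀ m k, ℛ.ev _ w = Pointed.of (m, k) → ∀ u v, 𝒮.ev _ u = Pointed.of m →
        𝒯.ev _ v = Pointed.of k → r = f.stalkMap x u * g.stalkMap x v := by
    intro x w
    rcases ℛ.mem_ev _ w with h0 | ⟨⟨m, k⟩, ⟨hm, hk⟩, h0⟩
    · exact ⟨0, fun _ => rfl, fun m k h1 => absurd (h1.symm.trans h0) (Pointed.of_ne_zero _)⟩
    · obtain ⟨u, hu⟩ := 𝒮.exists_ev (f.base x) (Pointed.mem_of.mpr hm)
      obtain ⟨v, hv⟩ := 𝒯.exists_ev (g.base x) (Pointed.mem_of.mpr hk)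
      refine ⟨f.stalkMap x u * g.stalkMap x v,
        fun h1 => absurd (h0.symm.trans h1) (Pointed.of_ne_zero _), fun m' k' h1 u' v' hu' hv' => ?_⟩
      have h2 := Pointed.of_injective (h0.symm.trans h1)
      obtain ⟨rfl, rfl⟩ := Prod.ext_iff.mp h2
      rw [𝒮.ev_injective _ (hu.trans hu'.symm), 𝒯.ev_injective _ (hv.trans hv'.symm)]
  choose F hF0 hF using hex
  have hcases : ∀ x (w : ℛ.space.stalk (bc x)), ℛ.ev _ w = 0 ∨ ∃ m k u v,
      ℛ.ev _ w = Pointed.of (m, k) ∧ 𝒮.ev (f.base x) u = Pointed.of m ∧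
        𝒯.ev (g.base x) v = Pointed.of k := fun x w => by
    rcases ℛ.mem_ev _ w with h0 | ⟨⟨m, k⟩, ⟨hm, hk⟩, h0⟩
    · exact Or.inl h0
    · obtain ⟨u, hu⟩ := 𝒮.exists_ev (f.base x) (Pointed.mem_of.mpr hm)
      obtain ⟨v, hv⟩ := 𝒯.exists_ev (g.base x) (Pointed.mem_of.mpr hk)
      exact Or.inr ⟨m, k, u, v, h0, hu, hv⟩
  let ψ : ∀ x, ℛ.space.stalk (bc x) →*₀ T.stalk x := fun x =>
    { toFun := F x
      map_zero' := hF0 x 0 (map_zero _)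
      map_one' := by
        rw [hF x 1 0 0 (map_one _) 1 1 (map_one _) (map_one _), map_one, map_one, mul_one]
      map_mul' := fun w w' => by
        rcases hcases x w with h0 | ⟨m, k, u, v, h0, hu, hv⟩
        · rw [hF0 x w h0, hF0 x (w * w') (by rw [map_mul, h0, zero_mul]), zero_mul]
        rcases hcases x w' with h0' | ⟨m', k', u', v', h0', hu', hv'⟩
        · rw [hF0 x w' h0', hF0 x (w * w') (by rw [map_mul, h0', mul_zero]), mul_zero]
        rw [hF x w m k h0 u v hu hv, hF x w' m' k' h0' u' v' hu' hv',
          hF x (w * w') (m + m') (k + k') (by rw [map_mul, h0, h0', ← Pointed.of_add]; rfl)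
            (u * u') (v * v') (by rw [map_mul, hu, hu', Pointed.of_add])
            (by rw [map_mul, hv, hv', Pointed.of_add]), map_mul, map_mul, mul_mul_mul_comm] }
  have hψ0 : ∀ x w, ℛ.ev _ w = 0 → ψ x w = 0 := hF0
  have hψ : ∀ x w m k, ℛ.ev _ w = Pointed.of (m, k) → ∀ u v, 𝒮.ev _ u = Pointed.of m →
        𝒯.ev _ v = Pointed.of k → ψ x w = f.stalkMap x u * g.stalkMap x v := hF
  have hloc : ∀ x, IsLocalHom (ψ x) := fun x => ⟨fun w hw => by
    rcases hcases x w with h0 | ⟨m, k, u, v, h0, hu, hv⟩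
    · rw [hψ0 x w h0] at hw
      exact absurd hw (not_isUnit_zero_of_hom f x)
    · rw [hψ x w m k h0 u v hu hv] at hw
      obtain ⟨m', hm', h1⟩ := (𝒮.isUnit_iff _ _).mp
        ((f.isLocal x).map_nonunit _ (isUnit_of_mul_isUnit_left hw))
      obtain ⟨k', hk', h2⟩ := (𝒯.isUnit_iff _ _).mp
        ((g.isLocal x).map_nonunit _ (isUnit_of_mul_isUnit_right hw))
      rw [← Pointed.of_injective (hu.symm.trans hm')] at h1
      rw [← Pointed.of_injective (hv.symm.trans hk')] at h2
      exact (ℛ.isUnit_iff _ _).mpr ⟨(m, k), h0, h1, h2⟩⟩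
  have hsec : ∀ (V : Opens ℛ.space) (s : ℛ.space.sec V) (x : T) (_ : bc x ∈ V),
      ∃ (W : Opens T) (_ : x ∈ W) (hW : W ≤ V.comap bc) (r : T.sec W),
        ∀ y (hy : y ∈ W), T.germ y W hy r = ψ y (ℛ.space.germ (bc y) V (hW hy) s) := by
    intro V s x hx
    let B := 𝒮.below (𝒮.idx (f.base x))
    let C := 𝒯.below (𝒯.idx (g.base x))
    let W : Opens T := B.comap f.base ⊓ C.comap g.base
    have hWb : ∀ y ∈ W, ℛ.idx (bc y) ≤ ℛ.idx (bc x) := fun y hy => ⟨hy.1, hy.2⟩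
    have hWV : W ≤ V.comap bc := fun y hy => ℛ.mem_of_le V (hWb y hy) hx
    have hxW : x ∈ W := ⟨𝒮.mem_below.mpr le_rfl, 𝒯.mem_below.mpr le_rfl⟩
    have hval : ∀ y (hy : y ∈ W), ℛ.ev _ (ℛ.space.germ (bc y) V (hWV hy) s) =
        ℛ.value (bc x) hx s := fun y hy => ℛ.value_eq s hx (hWV hy) (hWb y hy)
    rcases ℛ.mem_value _ hx s with h0 | ⟨⟨m, k⟩, ⟨hm, hk⟩, h0⟩
    · refine ⟨W, hxW, hWV, 0, fun y hy => ?_⟩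
      rw [map_zero, hψ0 y _ ((hval y hy).trans h0)]
    · have hm' : m ∈ 𝒮.S (𝒮.idx (f.base x)) := hm
      have hk' : k ∈ 𝒯.S (𝒯.idx (g.base x)) := hk
      obtain ⟨σ, hσ⟩ : ∃ σ : 𝒮.space.sec B, ∀ z (hz : z ∈ B), 𝒮.value z hz σ = Pointed.of m :=
        ⟨𝒮.const B le_rfl _, fun z hz =>
          (𝒮.value_const _ _ _ _ _).trans (Pointed.incl_coe _ _ hm')⟩
      obtain ⟨τ, hτ⟩ : ∃ τ : 𝒯.space.sec C, ∀ z (hz : z ∈ C), 𝒯.value z hz τ = Pointed.of k :=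
        ⟨𝒯.const C le_rfl _, fun z hz =>
          (𝒯.value_const _ _ _ _ _).trans (Pointed.incl_coe _ _ hk')⟩
      refine ⟨W, hxW, hWV, T.res inf_le_left (f.app B σ) * T.res inf_le_right (g.app C τ),
        fun y hy => ?_⟩
      have hyB : f.base y ∈ B := hy.1
      have hyC : g.base y ∈ C := hy.2
      rw [map_mul, T.germ_res, T.germ_res]
      exact (hψ y _ m k ((hval y hy).trans h0) (𝒮.space.germ _ B hyB σ)
        (𝒯.space.germ _ C hyC τ) (hσ _ hyB) (hτ _ hyC)).symm
  refine ⟨Hom.ofStalk bc ψ hsec hloc, ?_, ?_⟩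
  · refine Hom.ext_germ (fun x => rfl) fun V s x hx hx' => ?_
    have hx1 : f.base x ∈ V := hx'
    have hx2 : bc x ∈ V.comap (𝒮.fst 𝒯).base := hx
    refine (Hom.germ_app_ofStalk bc ψ hsec hloc (V.comap (𝒮.fst 𝒯).base) _ x hx2).trans ?_
    have h1 : ℛ.ev _ (ℛ.space.germ (bc x) (V.comap (𝒮.fst 𝒯).base) hx2 ((𝒮.fst 𝒯).app V s)) =
      Pointed.map (AddMonoidHom.inl M K) (𝒮.value (f.base x) hx1 s) := value_hom _ _ _ _ _ V s _ hx2
    change _ = f.stalkMap x (𝒮.space.germ (f.base x) V hx1 s)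
    rcases Pointed.eq_zero_or_of (𝒮.value (f.base x) hx1 s) with h0 | ⟨m, h0⟩
    · rw [h0, map_zero] at h1
      rw [hψ0 x _ h1, 𝒮.ev_injective _ (a₁ := 𝒮.space.germ (f.base x) V hx1 s) (a₂ := 0)
        (by rw [ev_germ, h0, map_zero]), map_zero]
    · rw [h0, Pointed.map_of] at h1
      rw [hψ x _ m 0 h1 (𝒮.space.germ (f.base x) V hx1 s) 1 h0 (map_one _), map_one, mul_one]
  · refine Hom.ext_germ (fun x => rfl) fun V s x hx hx' => ?_
    have hx1 : g.base x ∈ V := hx'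
    have hx2 : bc x ∈ V.comap (𝒮.snd 𝒯).base := hx
    refine (Hom.germ_app_ofStalk bc ψ hsec hloc (V.comap (𝒮.snd 𝒯).base) _ x hx2).trans ?_
    have h1 : ℛ.ev _ (ℛ.space.germ (bc x) (V.comap (𝒮.snd 𝒯).base) hx2 ((𝒮.snd 𝒯).app V s)) =
      Pointed.map (AddMonoidHom.inr M K) (𝒯.value (g.base x) hx1 s) := value_hom _ _ _ _ _ V s _ hx2
    change _ = g.stalkMap x (𝒯.space.germ (g.base x) V hx1 s)
    rcases Pointed.eq_zero_or_of (𝒯.value (g.base x) hx1 s) with h0 | ⟨m, h0⟩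
    · rw [h0, map_zero] at h1
      rw [hψ0 x _ h1, 𝒯.ev_injective _ (a₁ := 𝒯.space.germ (g.base x) V hx1 s) (a₂ := 0)
        (by rw [ev_germ, h0, map_zero]), map_zero]
    · rw [h0, Pointed.map_of] at h1
      rw [hψ x _ 0 m h1 1 (𝒯.space.germ (g.base x) V hx1 s) (map_one _) h0, map_one, one_mul]

/-- A section over the space of a product of systems is, near each point, zero or a product of
sections pulled back from the factors. -/
theorem germ_app_prod (h : T ⟶ (𝒮.prod 𝒯).space) (V : Opens (𝒮.prod 𝒯).space)
    (s : (𝒮.prod 𝒯).space.sec V) (x : T) (hx : h.base x ∈ V) (p : P) (q : Q)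
    (m : M) (k : K) (hm : m ∈ 𝒮.S p) (hk : k ∈ 𝒯.S q)
    (hs : (𝒮.prod 𝒯).value (h.base x) hx s = Pointed.of (m, k))
    (hp : (h ≫ 𝒮.fst 𝒯).base x ∈ 𝒮.below p) (hq : (h ≫ 𝒮.snd 𝒯).base x ∈ 𝒯.below q) :
    T.germ x (V.comap h.base) hx (h.app V s) =
      T.germ x _ hp ((h ≫ 𝒮.fst 𝒯).app (𝒮.below p) (𝒮.const _ le_rfl
        ((Multiplicative.ofAdd (⟨m, hm⟩ : 𝒮.S _) : Multiplicative _) : WithZero _))) *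
      T.germ x _ hq ((h ≫ 𝒮.snd 𝒯).app (𝒯.below q) (𝒯.const _ le_rfl
        ((Multiplicative.ofAdd (⟨k, hk⟩ : 𝒯.S _) : Multiplicative _) : WithZero _))) := by
  have hp' : h.base x ∈ (𝒮.below p).comap (𝒮.fst 𝒯).base := hp
  have hq' : h.base x ∈ (𝒯.below q).comap (𝒮.snd 𝒯).base := hq
  have key : (𝒮.prod 𝒯).space.germ (h.base x) V hx s =
      (𝒮.prod 𝒯).space.germ (h.base x) _ hp' ((𝒮.fst 𝒯).app (𝒮.below p) (𝒮.const _ le_rfl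
        ((Multiplicative.ofAdd (⟨m, hm⟩ : 𝒮.S _) : Multiplicative _) : WithZero _))) *
      (𝒮.prod 𝒯).space.germ (h.base x) _ hq' ((𝒮.snd 𝒯).app (𝒯.below q) (𝒯.const _ le_rfl
        ((Multiplicative.ofAdd (⟨k, hk⟩ : 𝒯.S _) : Multiplicative _) : WithZero _))) := by
    apply (𝒮.prod 𝒯).ev_injective
    rw [map_mul, ev_germ, ev_germ, ev_germ, hs]
    have h1 := value_hom (𝒮 := 𝒮.prod 𝒯) (𝒯 := 𝒮) Prod.fst (fun _ _ h => h.1)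
      (AddMonoidHom.inl M K) (fun _ _ hk => ⟨hk, zero_mem _⟩) (fun _ _ _ h => h.1) (𝒮.below p)
      (𝒮.const _ le_rfl
        ((Multiplicative.ofAdd (⟨m, hm⟩ : 𝒮.S _) : Multiplicative _) : WithZero _)) (h.base x) hp'
    have h2 := value_hom (𝒮 := 𝒮.prod 𝒯) (𝒯 := 𝒯) Prod.snd (fun _ _ h => h.2)
      (AddMonoidHom.inr M K) (fun _ _ hk => ⟨zero_mem _, hk⟩) (fun _ _ _ h => h.2) (𝒯.below q)
      (𝒯.const _ le_rfl
        ((Multiplicative.ofAdd (⟨k, hk⟩ : 𝒯.S _) : Multiplicative _) : WithZero _)) (h.base x) hq'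
    refine Eq.trans ?_ (congrArg₂ _
      (h1.trans (congrArg _ ((𝒮.value_const _ _ _ _ _).trans (Pointed.incl_coe _ _ _))))
      (h2.trans (congrArg _ ((𝒯.value_const _ _ _ _ _).trans (Pointed.incl_coe _ _ _))))).symm
    rw [Pointed.map_of, Pointed.map_of]
    rw [← Pointed.of_add]
    simp
  exact (congrArg (h.stalkMap x) key).trans (map_mul _ _ _)

theorem lift_unique {h h' : T ⟶ (𝒮.prod 𝒯).space} (h₁ : h ≫ 𝒮.fst 𝒯 = h' ≫ 𝒮.fst 𝒯)
    (h₂ : h ≫ 𝒮.snd 𝒯 = h' ≫ 𝒮.snd 𝒯) : h = h' := by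
  have hb : ∀ x, h.base x = h'.base x := fun x => by
    have e1 : ((𝒮.prod 𝒯).idx (h.base x)).1 = ((𝒮.prod 𝒯).idx (h'.base x)).1 :=
      congrArg (fun f : T ⟶ 𝒮.space => 𝒮.idx (f.base x)) h₁
    have e2 : ((𝒮.prod 𝒯).idx (h.base x)).2 = ((𝒮.prod 𝒯).idx (h'.base x)).2 :=
      congrArg (fun f : T ⟶ 𝒯.space => 𝒯.idx (f.base x)) h₂
    exact Prod.ext e1 e2
  refine Hom.ext_germ hb fun V s x hx hx' => ?_
  have hv : (𝒮.prod 𝒯).value (h'.base x) hx' s = (𝒮.prod 𝒯).value (h.base x) hx s :=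
    (𝒮.prod 𝒯).value_eq s hx hx' (le_of_eq (congrArg (𝒮.prod 𝒯).idx (hb x).symm))
  rcases (𝒮.prod 𝒯).mem_value _ hx s with h0 | ⟨⟨m, k⟩, ⟨hm, hk⟩, h0⟩
  · have key : ∀ f : T ⟶ (𝒮.prod 𝒯).space, ∀ hf : f.base x ∈ V,
        (𝒮.prod 𝒯).value (f.base x) hf s = 0 → T.germ x (V.comap f.base) hf (f.app V s) = 0 := by
      intro f hf h1
      have : (𝒮.prod 𝒯).space.germ (f.base x) V hf s = 0 :=
        (𝒮.prod 𝒯).ev_injective _ (by rw [ev_germ, h1, map_zero])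
      exact (congrArg (f.stalkMap x) this).trans (map_zero _)
    rw [key h hx h0, key h' hx' (hv.trans h0)]
  · have hp : (h ≫ 𝒮.fst 𝒯).base x ∈ 𝒮.below ((𝒮.prod 𝒯).idx (h.base x)).1 :=
      𝒮.mem_below.mpr le_rfl
    have hq : (h ≫ 𝒮.snd 𝒯).base x ∈ 𝒯.below ((𝒮.prod 𝒯).idx (h.base x)).2 :=
      𝒯.mem_below.mpr le_rfl
    have hp' : (h' ≫ 𝒮.fst 𝒯).base x ∈ 𝒮.below ((𝒮.prod 𝒯).idx (h.base x)).1 := h₁ ▸ hp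
    have hq' : (h' ≫ 𝒮.snd 𝒯).base x ∈ 𝒯.below ((𝒮.prod 𝒯).idx (h.base x)).2 := h₂ ▸ hq
    exact (germ_app_prod h V s x hx _ _ m k hm hk h0 hp hq).trans ((congrArg₂ _
      (Hom.germ_app_congr h₁ _ _ x hp hp') (Hom.germ_app_congr h₂ _ _ x hq hq')).trans
      (germ_app_prod h' V s x hx' _ _ m k hm hk (hv.trans h0) hp' hq').symm)

end Lift

theorem IsLocalized.isProduct (h : 𝒮.IsLocalized) (h' : 𝒯.IsLocalized) :
    IsProduct (𝒮.fst 𝒯) (𝒮.snd 𝒯) := by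
  refine ⟨(h.prod h').isMonoidScheme, fun T _ f g => ?_⟩
  obtain ⟨l, hl, hl'⟩ := exists_lift f g
  exact ⟨l, ⟨hl, hl'⟩, fun l' h' => lift_unique (h'.1.trans hl.symm) (h'.2.trans hl'.symm)⟩

variable (𝒮)

/-- The diagonal of the space of a system. -/
def diag : 𝒮.space ⟶ (𝒮.prod 𝒮).space :=
  hom (fun p => (p, p)) (fun _ _ h => ⟨h, h⟩)
    (AddMonoidHom.coprod (AddMonoidHom.id M) (AddMonoidHom.id M))
    (fun _ k hk => by simpa using add_mem hk.1 hk.2)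
    (fun _ k hk h => by
      simp only [AddMonoidHom.coprod_apply, AddMonoidHom.id_apply] at h
      refine ⟨?_, ?_⟩
      · have := add_mem h hk.2
        simpa using this
      · have := add_mem h hk.1
        simpa using this)

theorem value_diag (V : Opens (𝒮.prod 𝒮).space) (s : (𝒮.prod 𝒮).space.sec V) (x : 𝒮.space)
    (hx : 𝒮.diag.base x ∈ V) : 𝒮.value x hx (𝒮.diag.app V s) =
      Pointed.map (AddMonoidHom.coprod (AddMonoidHom.id M) (AddMonoidHom.id M))
        ((𝒮.prod 𝒮).value (𝒮.diag.base x) hx s) := value_hom _ _ _ _ _ V s x hx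

theorem diag_fst : 𝒮.diag ≫ 𝒮.fst 𝒮 = 𝟙 𝒮.space := by
  refine Hom.ext_germ (fun x => rfl) fun V s x hx hx' => 𝒮.ev_injective x ?_
  have hx1 : 𝒮.diag.base x ∈ V.comap (𝒮.fst 𝒮).base := hx
  refine (𝒮.value_diag (V.comap (𝒮.fst 𝒮).base) ((𝒮.fst 𝒮).app V s) x hx1).trans ?_
  refine (congrArg _ (value_hom (𝒮 := 𝒮.prod 𝒮) _ _ _ _ _ V s _ hx1)).trans ?_
  change _ = 𝒮.value x hx' s
  change Pointed.map _ (Pointed.map _ (𝒮.value x hx' s)) = _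
  rcases Pointed.eq_zero_or_of (𝒮.value x hx' s) with h0 | ⟨m, h0⟩ <;> rw [h0] <;> simp

theorem diag_snd : 𝒮.diag ≫ 𝒮.snd 𝒮 = 𝟙 𝒮.space := by
  refine Hom.ext_germ (fun x => rfl) fun V s x hx hx' => 𝒮.ev_injective x ?_
  have hx1 : 𝒮.diag.base x ∈ V.comap (𝒮.snd 𝒮).base := hx
  refine (𝒮.value_diag (V.comap (𝒮.snd 𝒮).base) ((𝒮.snd 𝒮).app V s) x hx1).trans ?_
  refine (congrArg _ (value_hom (𝒮 := 𝒮.prod 𝒮) _ _ _ _ _ V s _ hx1)).trans ?_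
  change _ = 𝒮.value x hx' s
  change Pointed.map _ (Pointed.map _ (𝒮.value x hx' s)) = _
  rcases Pointed.eq_zero_or_of (𝒮.value x hx' s) with h0 | ⟨m, h0⟩ <;> rw [h0] <;> simp

/-- Any two elements have an infimum `r`, and `S_r = S_p + S_q`. For a localized system this means
that the space is separated. -/
def HasInfSum : Prop :=
  ∀ p q : P, ∃ r : P, r ≤ p ∧ r ≤ q ∧ (∀ z, z ≤ p → z ≤ q → z ≤ r) ∧
    ∀ c ∈ 𝒮.S r, ∃ a ∈ 𝒮.S p, ∃ b ∈ 𝒮.S q, a + b = c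

variable {𝒮}

theorem IsLocalized.isSeparated (h : 𝒮.IsLocalized) (h' : 𝒮.HasInfSum) :
    IsSeparated 𝒮.space := by
  refine ⟨_, 𝒮.fst 𝒮, 𝒮.snd 𝒮, h.isProduct h, 𝒮.diag, 𝒮.diag_fst, 𝒮.diag_snd, ?_, fun U hU => ?_⟩
  · exact Topology.IsEmbedding.of_leftInverse (f := (𝒮.fst 𝒮).base) (fun x => rfl)
      (𝒮.fst 𝒮).base.continuous 𝒮.diag.base.continuous
  · rcases eq_bot_or_eq_below_of_isAffineOpen hU with rfl | ⟨⟨p, q⟩, rfl⟩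
    · exact ⟨isAffineOpen_bot _, fun t => ⟨0, (sec_bot_subsingleton 𝒮.space).elim _ _⟩⟩
    · obtain ⟨r, hrp, hrq, hr, hc⟩ := h' p q
      have e : ((𝒮.prod 𝒮).below (p, q)).comap 𝒮.diag.base = 𝒮.below r :=
        Opens.ext (Set.ext fun z => ⟨fun hz => hr _ hz.1 hz.2,
          fun hz => ⟨le_trans (𝒮.mem_below.mp hz) hrp, le_trans (𝒮.mem_below.mp hz) hrq⟩⟩)
      refine ⟨?_, fun t => ?_⟩
      · rw [e]
        exact isAffineOpen_iff.mpr ⟨_, _, ⟨h.chart _⟩⟩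
      · have hmem : ∀ z, z ∈ ((𝒮.prod 𝒮).below (p, q)).comap 𝒮.diag.base → 𝒮.idx z ≤ r :=
          fun z hz => by
            rw [e] at hz
            exact hz
        have hr' : 𝒮.pt r ∈ ((𝒮.prod 𝒮).below (p, q)).comap 𝒮.diag.base := ⟨hrp, hrq⟩
        rcases 𝒮.mem_value _ hr' t with h0 | ⟨c, hcr, h0⟩
        · refine ⟨0, 𝒮.value_ext fun z hz => ?_⟩
          rw [map_zero, map_zero, 𝒮.value_eq t hr' hz (hmem z hz), h0]
        · obtain ⟨a, ha, b, hb, rfl⟩ := hc c hcr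
          have hab : (a, b) ∈ (𝒮.prod 𝒮).S (p, q) := ⟨ha, hb⟩
          refine ⟨(𝒮.prod 𝒮).const _ le_rfl
            ((Multiplicative.ofAdd (⟨(a, b), hab⟩ : (𝒮.prod 𝒮).S (p, q)) : Multiplicative _) :
              WithZero _), 𝒮.value_ext fun z hz => ?_⟩
          have hz' : 𝒮.diag.base z ∈ (𝒮.prod 𝒮).below (p, q) := hz
          refine (𝒮.value_diag _ _ z hz').trans (Eq.trans ?_
            ((𝒮.value_eq t hr' hz (hmem z hz)).trans h0).symm)
          refine (congrArg _ (((𝒮.prod 𝒮).value_const _ _ _ _ _).trans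
            (Pointed.incl_coe _ _ _))).trans ?_
          rw [Pointed.map_of]
          simp

/-- If the space of a localized system is separated and any two elements of the poset have a lower
bound, any two elements have an infimum `r`, and `S_r = S_p + S_q`. -/
theorem IsLocalized.hasInfSum (h : 𝒮.IsLocalized) (hinf : ∀ p q : P, ∃ z, z ≤ p ∧ z ≤ q)
    {Y : MonoidSpace.{u}} (i : Y ≅ 𝒮.space) (hY : IsSeparated Y) : 𝒮.HasInfSum := by
  obtain ⟨R, p₁, p₂, ⟨hR, hRu⟩, d, hd₁, hd₂, -, hd⟩ := hY
  -- the product of `Y` with itself is the space of the product system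
  obtain ⟨v, ⟨hv₁, hv₂⟩, -⟩ := hRu _ (h.prod h).isMonoidScheme (𝒮.fst 𝒮 ≫ i.inv) (𝒮.snd 𝒮 ≫ i.inv)
  obtain ⟨w, hw₁, hw₂⟩ := exists_lift (p₁ ≫ i.hom) (p₂ ≫ i.hom)
  have hwv : w ≫ v = 𝟙 R := by
    refine (hRu R hR p₁ p₂).unique ⟨?_, ?_⟩ ⟨Category.id_comp _, Category.id_comp _⟩
    · rw [Category.assoc, hv₁, ← Category.assoc, hw₁, Category.assoc, i.hom_inv_id,
        Category.comp_id]
    · rw [Category.assoc, hv₂, ← Category.assoc, hw₂, Category.assoc, i.hom_inv_id,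
        Category.comp_id]
  have hvw : v ≫ w = 𝟙 _ := by
    refine lift_unique ?_ ?_
    · rw [Category.assoc, hw₁, ← Category.assoc, hv₁, Category.assoc, i.inv_hom_id,
        Category.comp_id, Category.id_comp]
    · rw [Category.assoc, hw₂, ← Category.assoc, hv₂, Category.assoc, i.inv_hom_id,
        Category.comp_id, Category.id_comp]
  let W : R ≅ (𝒮.prod 𝒮).space := ⟨w, v, hwv, hvw⟩
  have hdw : d ≫ w = i.hom ≫ 𝒮.diag := by
    refine lift_unique ?_ ?_
    · rw [Category.assoc, hw₁, ← Category.assoc, hd₁, Category.assoc, diag_fst, Category.comp_id,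
        Category.id_comp]
    · rw [Category.assoc, hw₂, ← Category.assoc, hd₂, Category.assoc, diag_snd, Category.comp_id,
        Category.id_comp]
  have h1 : ∀ U : Opens (𝒮.prod 𝒮).space, IsAffineOpen _ U →
      IsAffineOpen Y (U.comap (d ≫ w).base) ∧ Function.Surjective ((d ≫ w).app U) := fun U hU => by
    obtain ⟨h2, h3⟩ := hd _ (hU.comap W)
    exact ⟨h2, h3.comp (app_bijective_of_iso W U).2⟩
  rw [hdw] at h1
  intro p q
  obtain ⟨h2, h3⟩ := h1 _ (isAffineOpen_iff.mpr ⟨_, _, ⟨(h.prod h).chart (p, q)⟩⟩)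
  have h4 : IsAffineOpen 𝒮.space (((𝒮.prod 𝒮).below (p, q)).comap 𝒮.diag.base) :=
    isAffineOpen_of_comap i h2
  have hmem : ∀ z : 𝒮.space, z ∈ ((𝒮.prod 𝒮).below (p, q)).comap 𝒮.diag.base ↔
      𝒮.idx z ≤ p ∧ 𝒮.idx z ≤ q := fun z => Iff.rfl
  obtain ⟨z, hz⟩ := hinf p q
  rcases eq_bot_or_eq_below_of_isAffineOpen h4 with h5 | ⟨r, h5⟩
  · have : 𝒮.pt z ∈ (⊥ : Opens 𝒮.space) := h5 ▸ (hmem (𝒮.pt z)).mpr hz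
    exact this.elim
  have hr : 𝒮.pt r ∈ ((𝒮.prod 𝒮).below (p, q)).comap 𝒮.diag.base := by
    rw [h5]
    exact 𝒮.mem_below.mpr le_rfl
  refine ⟨r, ((hmem _).mp hr).1, ((hmem _).mp hr).2, fun z hzp hzq => ?_, fun c hc => ?_⟩
  · have : 𝒮.pt z ∈ 𝒮.below r := by
      rw [← h5]
      exact (hmem (𝒮.pt z)).mpr ⟨hzp, hzq⟩
    exact this
  · obtain ⟨s, hs⟩ := h3 (i.hom.app _ (𝒮.const _ h5.le
      ((Multiplicative.ofAdd (⟨c, hc⟩ : 𝒮.S r) : Multiplicative _) : WithZero _)))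
    have h6 := (app_bijective_of_iso i _).1 hs
    have h7 := congrArg (𝒮.value _ hr) h6
    have h8 : (𝒮.prod 𝒮).pt (p, q) ∈ (𝒮.prod 𝒮).below (p, q) := (𝒮.prod 𝒮).mem_below.mpr le_rfl
    have hr' : 𝒮.diag.base (𝒮.pt r) ∈ (𝒮.prod 𝒮).below (p, q) := hr
    have hle : (𝒮.prod 𝒮).idx (𝒮.diag.base (𝒮.pt r)) ≤ (𝒮.prod 𝒮).idx ((𝒮.prod 𝒮).pt (p, q)) := hr
    replace h7 := (congrArg _ ((𝒮.prod 𝒮).value_eq s h8 hr' hle).symm).trans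
      ((𝒮.value_diag _ s _ hr').symm.trans
        (h7.trans ((𝒮.value_const _ _ _ _ _).trans (Pointed.incl_coe _ _ _))))
    rcases (𝒮.prod 𝒮).mem_value _ h8 s with h0 | ⟨⟨a, b⟩, ⟨ha, hb⟩, h0⟩
    · rw [h0, map_zero] at h7
      exact absurd h7.symm (Pointed.of_ne_zero c)
    · rw [h0, Pointed.map_of] at h7
      exact ⟨a, ha, b, hb, by simpa using Pointed.of_injective h7⟩

end MonoidSystem

end

end MonoidScheme

/-! ### Rational cones -/

namespace MonoidScheme

noncomputable section

/-- Farkas' lemma over an ordered ring. The proof is by induction on the number of generators: if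
the functional obtained for all generators but one is negative on the last one, the generators are
projected along it. -/
theorem exists_dual_neg {R M : Type*} [CommRing R] [LinearOrder R] [IsStrictOrderedRing R]
    [AddCommGroup M] [Module R M] (hM : ∀ v : M, (∀ f : Module.Dual R M, f v = 0) → v = 0) :
    ∀ (n : ℕ) (s : Fin n → M) (v : M),
      (∀ c : R, 0 < c → ∀ d : Fin n → R, (∀ i, 0 ≤ d i) → c • v ≠ ∑ i, d i • s i) →
      ∃ f : Module.Dual R M, (∀ i, 0 ≤ f (s i)) ∧ f v < 0 := by
  intro n
  induction n with
  | zero =>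
    intro s v hv
    have hv0 : v ≠ 0 := fun h => hv 1 one_pos 0 (fun i => i.elim0) (by simp [h])
    obtain ⟨f, hf⟩ : ∃ f : Module.Dual R M, f v ≠ 0 := by
      by_contra! h
      exact hv0 (hM v h)
    rcases lt_or_gt_of_ne hf with h | h
    · exact ⟨f, fun i => i.elim0, h⟩
    · exact ⟨-f, fun i => i.elim0, by simpa using h⟩
  | succ n ih =>
    intro s v hv
    obtain ⟨f, hf, hfv⟩ := ih (fun i => s i.succ) v fun c hc d hd h => by
      refine hv c hc (Fin.cons 0 d) (Fin.cases le_rfl hd) ?_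
      rw [h, Fin.sum_univ_succ]
      simp
    rcases le_or_gt 0 (f (s 0)) with h0 | h0
    · exact ⟨f, Fin.cases h0 hf, hfv⟩
    · -- the projection onto the kernel of `f` along `s 0`, multiplied by `- f (s 0)`
      let π : M →ₗ[R] M := (-f (s 0)) • LinearMap.id + f.smulRight (s 0)
      have hπ : ∀ x, π x = (-f (s 0)) • x + f x • s 0 := fun x => rfl
      obtain ⟨g, hg, hgv⟩ := ih (fun i => π (s i.succ)) (π v) fun c hc d hd h => by
        refine hv (c * (-f (s 0))) (mul_pos hc (neg_pos.mpr h0))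
          (Fin.cons (-(c * f v) + ∑ i, d i * f (s i.succ)) fun i => d i * (-f (s 0)))
          (Fin.cases ?_ fun i => mul_nonneg (hd i) (neg_pos.mpr h0).le) ?_
        · simp only [hπ, smul_add, Finset.sum_add_distrib, smul_smul] at h
          rw [Fin.sum_univ_succ]
          simp only [Fin.cons_zero, Fin.cons_succ, add_smul, Finset.sum_smul]
          rw [eq_comm, ← sub_eq_zero] at h ⊢
          rw [← h]
          module
        · exact add_nonneg (neg_nonneg.mpr (mul_nonpos_of_nonneg_of_nonpos hc.le hfv.le))
            (Finset.sum_nonneg fun i _ => mul_nonneg (hd i) (hf i))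
      refine ⟨g ∘ₗ π, Fin.cases ?_ hg, hgv⟩
      have : π (s 0) = 0 := by
        rw [hπ, neg_smul, neg_add_cancel]
      rw [LinearMap.comp_apply, this, map_zero]

/-- A vector outside a finitely generated cone is separated from it by a functional. -/
theorem exists_dual_neg_of_notMem_hull {V : Type*} [AddCommGroup V] [Module ℝ V] {S : Set V}
    (hS : S.Finite) {v : V} (hv : v ∉ PointedCone.hull ℝ S) :
    ∃ f : V →ₗ[ℝ] ℝ, (∀ s ∈ S, 0 ≤ f s) ∧ f v < 0 := by
  obtain ⟨n, s, hs⟩ := hS.fin_param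
  obtain ⟨s, -, hs⟩ : ∃ s : Fin n → V, Function.Injective s ∧ Set.range s = S := ⟨s, hs⟩
  obtain ⟨f, hf, hfv⟩ := exists_dual_neg (R := ℝ)
    (fun v h => (Module.forall_dual_apply_eq_zero_iff ℝ v).mp h) n s v fun c hc d hd h => hv (by
      have h1 : v = ∑ i, (c⁻¹ * d i) • s i := by
        simp only [mul_smul]
        rw [← Finset.smul_sum, ← h, smul_smul, inv_mul_cancel₀ hc.ne', one_smul]
      rw [h1]
      refine sum_mem fun i _ => PointedCone.smul_mem _ (mul_nonneg (inv_nonneg.mpr hc.le) (hd i)) ?_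
      exact PointedCone.subset_hull (hs ▸ Set.mem_range_self i))
  refine ⟨f, fun x hx => ?_, hfv⟩
  rw [← hs] at hx
  obtain ⟨i, rfl⟩ := hx
  exact hf i

/-- Farkas' lemma for lattices: an element on which every functional is nonnegative that is
nonnegative on a finite set has a multiple in the monoid generated by the set. -/
theorem exists_nsmul_mem_closure {M : Type*} [AddCommGroup M] [Module.Free ℤ M] {T : Set M}
    (hT : T.Finite) {m : M} (h : ∀ n : Module.Dual ℤ M, (∀ t ∈ T, 0 ≤ n t) → 0 ≤ n m) :
    ∃ k : ℕ, 1 ≤ k ∧ k • m ∈ AddSubmonoid.closure T := by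
  obtain ⟨n, s, -, hs⟩ : ∃ (n : ℕ) (s : Fin n → M), Function.Injective s ∧ Set.range s = T :=
    hT.fin_param
  by_contra! hm
  obtain ⟨f, hf, hfm⟩ := exists_dual_neg (R := ℤ)
    (fun v h => (Module.forall_dual_apply_eq_zero_iff ℤ v).mp h) n s m fun c hc d hd h' => by
      refine hm c.toNat (by omega) ?_
      have h1 : c.toNat • m = c • m := by
        rw [← natCast_zsmul, Int.toNat_of_nonneg hc.le]
      rw [h1, h']
      refine sum_mem fun i _ => ?_
      have h2 : d i • s i = (d i).toNat • s i := by
        rw [← natCast_zsmul, Int.toNat_of_nonneg (hd i)]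
      rw [h2]
      exact nsmul_mem (AddSubmonoid.subset_closure (hs ▸ Set.mem_range_self i)) _
  refine absurd (h f fun t ht => ?_) (not_le.mpr hfm)
  rw [← hs] at ht
  obtain ⟨i, rfl⟩ := ht
  exact hf i

section Integral

variable {N : Type u} [AddCommGroup N] [Module.Finite ℤ N]

/-- A real functional on `N_ℝ` can be replaced by an integral one that vanishes at all lattice
points where the real functional does, and is positive at finitely many given points where the real
functional is positive. The coefficients of the real functional in terms of a basis of its group of
values on `N` are approximated by rational numbers. -/
theorem exists_integral_functional (ℓ : (ℝ ⊗[ℤ] N) →ₗ[ℝ] ℝ) {F : Set (ℝ ⊗[ℤ] N)}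
    (hF : F.Finite) : ∃ m : Module.Dual ℤ N, (∀ n : N, ℓ (1 ⊗ₜ n) = 0 → m n = 0) ∧
      ∀ v ∈ F, 0 < ℓ v → 0 < realFunctional m v := by
  let φ : N →ₗ[ℤ] ℝ := (ℓ.restrictScalars ℤ) ∘ₗ (TensorProduct.mk ℤ ℝ N 1)
  have hφ : ∀ n, φ n = ℓ (1 ⊗ₜ n) := fun n => rfl
  let b := Module.Free.chooseBasis ℤ (LinearMap.range φ)
  let c : Module.Free.ChooseBasisIndex ℤ (LinearMap.range φ) → Module.Dual ℤ N := fun j =>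
    b.coord j ∘ₗ φ.rangeRestrict
  have hsum : ∀ n : N, ∑ j, (b j : ℝ) * (c j n : ℝ) = φ n := fun n => by
    have := congrArg Subtype.val (b.sum_repr (φ.rangeRestrict n))
    rw [AddSubmonoidClass.coe_finsetSum] at this
    refine Eq.trans (Finset.sum_congr rfl fun j _ => ?_) this
    rw [mul_comm, ← zsmul_eq_mul]
    rfl
  have hℓ : ∀ v, ∑ j, (b j : ℝ) * realFunctional (c j) v = ℓ v := by
    have : ∑ j, (b j : ℝ) • realFunctional (c j) = ℓ := by
      ext n
      simpa [hφ] using hsum n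
    intro v
    rw [← this]
    simp
  have hopen : IsOpen {q : Module.Free.ChooseBasisIndex ℤ (LinearMap.range φ) → ℝ |
      ∀ v ∈ F, 0 < ℓ v → 0 < ∑ j, q j * realFunctional (c j) v} := by
    simp only [Set.ofPred_forall]
    refine hF.isOpen_biInter fun v _ => isOpen_iInter_of_finite fun _ => ?_
    exact isOpen_lt continuous_const (by fun_prop)
  obtain ⟨q, hq⟩ := (DenseRange.piMap fun _ => Rat.denseRange_cast (𝕜 := ℝ)).exists_mem_open hopen
    ⟨fun j => (b j : ℝ), fun v _ hv => by rwa [hℓ]⟩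
  obtain ⟨D, hD⟩ : ∃ D : ℕ, D = ∏ j, (q j).den := ⟨_, rfl⟩
  have hD0 : 0 < D := hD ▸ Finset.prod_pos fun j _ => (q j).den_pos
  have hz : ∀ j, ∃ z : ℤ, (z : ℝ) = D * (q j : ℝ) := fun j => by
    obtain ⟨k, hk⟩ : (q j).den ∣ D := hD ▸ Finset.dvd_prod_of_mem _ (Finset.mem_univ j)
    refine ⟨k * (q j).num, ?_⟩
    have : (q j : ℝ) * (q j).den = (q j).num := by exact_mod_cast Rat.mul_den_eq_num (q j)
    rw [hk]
    push_cast
    rw [← this]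
    ring
  choose z hz using hz
  refine ⟨∑ j, z j • c j, fun n hn => ?_, fun v hv hℓv => ?_⟩
  · have : φ.rangeRestrict n = 0 := Subtype.ext hn
    simp [c, this]
  · have h1 : realFunctional (∑ j, z j • c j) v = D * ∑ j, (q j : ℝ) * realFunctional (c j) v := by
      rw [map_sum, LinearMap.sum_apply, Finset.mul_sum]
      refine Finset.sum_congr rfl fun j _ => ?_
      rw [map_zsmul, LinearMap.smul_apply, zsmul_eq_mul, hz, mul_assoc]
    rw [h1]
    exact mul_pos (by exact_mod_cast hD0) (hq v hv hℓv)

end Integral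

section Rational

variable {N : Type u} [AddCommGroup N]

/-- The cone generated by a set of lattice points. -/
abbrev latticeHull (S : Set N) : PointedCone ℝ (ℝ ⊗[ℤ] N) :=
  PointedCone.hull ℝ ((fun n : N => (1 : ℝ) ⊗ₜ[ℤ] n) '' S)

/-- A rational polyhedral cone: a cone generated by finitely many lattice points. -/
def IsRational (σ : PointedCone ℝ (ℝ ⊗[ℤ] N)) : Prop := ∃ S : Finset N, σ = latticeHull (S : Set N)

theorem hull_induction {V : Type*} [AddCommGroup V] [Module ℝ V] {S : Set V} {p : V → Prop}
    (mem : ∀ s ∈ S, p s) (zero : p 0) (add : ∀ v w, p v → p w → p (v + w))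
    (smul : ∀ (r : ℝ) v, 0 < r → p v → p (r • v)) {v : V} (hv : v ∈ PointedCone.hull ℝ S) : p v := by
  induction hv using Submodule.span_induction with
  | mem s hs => exact mem s hs
  | zero => exact zero
  | add v w _ _ h h' => exact add v w h h'
  | smul r v _ h =>
    rcases eq_or_lt_of_le r.2 with h0 | h0
    · have : r • v = 0 := by
        change (r : ℝ) • v = 0
        rw [← h0, zero_smul]
      rwa [this]
    · exact smul r v h0 h

theorem nonneg_of_mem_hull {V : Type*} [AddCommGroup V] [Module ℝ V] {S : Set V}
    {f : V →ₗ[ℝ] ℝ} (hf : ∀ s ∈ S, 0 ≤ f s) {v : V} (hv : v ∈ PointedCone.hull ℝ S) : 0 ≤ f v := by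
  refine hull_induction hf (by simp) (fun v w h h' => ?_) (fun r v hr h => ?_) hv
  · rw [map_add]
    exact add_nonneg h h'
  · rw [map_smul]
    exact mul_nonneg hr.le h

/-- On a cone, the zeros of a nonnegative functional are determined by its zeros among the
generators. -/
theorem eq_zero_of_mem_hull {V : Type*} [AddCommGroup V] [Module ℝ V] {S : Set V}
    {f g : V →ₗ[ℝ] ℝ} (hf : ∀ s ∈ S, 0 ≤ f s) (h : ∀ s ∈ S, f s = 0 → g s = 0) {v : V}
    (hv : v ∈ PointedCone.hull ℝ S) (hfv : f v = 0) : g v = 0 := by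
  have : 0 ≤ f v ∧ (f v = 0 → g v = 0) := by
    refine hull_induction (p := fun v => 0 ≤ f v ∧ (f v = 0 → g v = 0))
      (fun s hs => ⟨hf s hs, h s hs⟩) (by simp) (fun v w h h' => ?_)
      (fun r v hr h => ?_) hv
    · rw [map_add, map_add]
      refine ⟨add_nonneg h.1 h'.1, fun e => ?_⟩
      obtain ⟨h1, h2⟩ := (add_eq_zero_iff_of_nonneg h.1 h'.1).mp e
      rw [h.2 h1, h'.2 h2, add_zero]
    · rw [map_smul, map_smul, smul_eq_mul, smul_eq_mul]
      refine ⟨mul_nonneg hr.le h.1, fun e => ?_⟩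
      rw [h.2 ((mul_eq_zero.mp e).resolve_left hr.ne'), mul_zero]
  exact this.2 hfv

theorem realFunctional_one_tmul (m : Module.Dual ℤ N) (n : N) :
    realFunctional m (1 ⊗ₜ n) = (m n : ℝ) := by simp

theorem one_tmul_mem_latticeHull {S : Set N} {n : N} (h : n ∈ S) :
    (1 : ℝ) ⊗ₜ[ℤ] n ∈ latticeHull S := PointedCone.subset_hull ⟨n, h, rfl⟩

theorem mem_dualMonoid_latticeHull {S : Set N} {m : Module.Dual ℤ N} :
    m ∈ dualMonoid (latticeHull S) ↔ ∀ s ∈ S, 0 ≤ m s := by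
  constructor
  · intro h s hs
    have := h _ (one_tmul_mem_latticeHull hs)
    rw [realFunctional_one_tmul] at this
    exact_mod_cast this
  · intro h v hv
    refine nonneg_of_mem_hull ?_ hv
    rintro _ ⟨s, hs, rfl⟩
    rw [realFunctional_one_tmul]
    exact_mod_cast h s hs

theorem dualMonoid_anti {σ τ : PointedCone ℝ (ℝ ⊗[ℤ] N)} (h : τ ≤ σ) :
    dualMonoid σ ≤ dualMonoid τ := fun _ hm v hv => hm v (h hv)

theorem neg_mem_dualMonoid_iff {σ τ : PointedCone ℝ (ℝ ⊗[ℤ] N)} (h : τ ≤ σ) {m : Module.Dual ℤ N}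
    (hm : m ∈ dualMonoid σ) : -m ∈ dualMonoid τ ↔ ∀ v ∈ τ, realFunctional m v = 0 := by
  refine forall₂_congr fun v hv => ?_
  rw [map_neg, LinearMap.neg_apply, Left.nonneg_neg_iff]
  exact ⟨fun h' => le_antisymm h' (hm v (h hv)), fun h' => h'.le⟩

/-- The monoid `σ^∨ ∩ M` is saturated. -/
theorem mem_dualMonoid_of_nsmul {σ : PointedCone ℝ (ℝ ⊗[ℤ] N)} {m : Module.Dual ℤ N} {k : ℕ}
    (hk : 1 ≤ k) (h : k • m ∈ dualMonoid σ) : m ∈ dualMonoid σ := fun v hv => by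
  have h1 := h v hv
  rw [map_nsmul, LinearMap.smul_apply, nsmul_eq_mul] at h1
  exact nonneg_of_mul_nonneg_right h1 (by exact_mod_cast hk)

/-- If a functional in `σ^∨` vanishes only on a subset of `ρ`, every functional in `ρ^∨` is
moved into `σ^∨` by a multiple of it. -/
theorem IsRational.exists_add_nsmul_mem {σ ρ : PointedCone ℝ (ℝ ⊗[ℤ] N)} (hσ : IsRational σ)
    {m : Module.Dual ℤ N} (hm : m ∈ dualMonoid σ)
    (hρ : ∀ v ∈ σ, realFunctional m v = 0 → v ∈ ρ) {a : Module.Dual ℤ N} (ha : a ∈ dualMonoid ρ) :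
    ∃ k : ℕ, a + k • m ∈ dualMonoid σ := by
  obtain ⟨S, rfl⟩ := hσ
  refine ⟨∑ s ∈ S, (a s).natAbs, mem_dualMonoid_latticeHull.mpr fun s hs => ?_⟩
  have hms := mem_dualMonoid_latticeHull.mp hm s hs
  have h1 : (a s).natAbs ≤ ∑ s ∈ S, (a s).natAbs :=
    Finset.single_le_sum (f := fun s => (a s).natAbs) (fun _ _ => Nat.zero_le _) hs
  rw [LinearMap.add_apply, LinearMap.smul_apply, nsmul_eq_mul]
  rcases eq_or_lt_of_le hms with h0 | h0
  · have h2 := ha _ (hρ _ (one_tmul_mem_latticeHull hs) (by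
      rw [realFunctional_one_tmul, ← h0, Int.cast_zero]))
    rw [realFunctional_one_tmul] at h2
    rw [← h0, mul_zero, add_zero]
    exact_mod_cast h2
  · have h2 : ((a s).natAbs : ℤ) ≤ ((∑ s ∈ S, (a s).natAbs : ℕ) : ℤ) := by exact_mod_cast h1
    have h3 : ((∑ s ∈ S, (a s).natAbs : ℕ) : ℤ) ≤ ((∑ s ∈ S, (a s).natAbs : ℕ) : ℤ) * m s :=
      le_mul_of_one_le_right (Int.natCast_nonneg _) h0
    have h4 : -((a s).natAbs : ℤ) ≤ a s := by omega
    linarith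

variable [Module.Finite ℤ N]

/-- A point outside a rational cone is separated from it by an integral functional. -/
theorem IsRational.exists_neg {σ : PointedCone ℝ (ℝ ⊗[ℤ] N)} (hσ : IsRational σ)
    {v : ℝ ⊗[ℤ] N} (hv : v ∉ σ) : ∃ m ∈ dualMonoid σ, realFunctional m v < 0 := by
  obtain ⟨S, rfl⟩ := hσ
  have hfin : ((fun n : N => (1 : ℝ) ⊗ₜ[ℤ] n) '' (S : Set N)).Finite := S.finite_toSet.image _
  obtain ⟨f, hf, hfv⟩ := exists_dual_neg_of_notMem_hull hfin hv
  obtain ⟨m, hm, hm'⟩ := exists_integral_functional f (hfin.insert (-v))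
  refine ⟨m, mem_dualMonoid_latticeHull.mpr fun s hs => ?_, ?_⟩
  · rcases eq_or_lt_of_le (hf _ ⟨s, hs, rfl⟩) with h | h
    · exact (hm s h.symm).ge
    · have := hm' _ (Or.inr ⟨s, hs, rfl⟩) h
      rw [realFunctional_one_tmul] at this
      exact_mod_cast this.le
  · have := hm' (-v) (Or.inl rfl) (by rw [map_neg]; exact neg_pos.mpr hfv)
    rw [map_neg] at this
    exact neg_pos.mp this

theorem IsRational.mem_iff {σ : PointedCone ℝ (ℝ ⊗[ℤ] N)} (hσ : IsRational σ) {v : ℝ ⊗[ℤ] N} :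
    v ∈ σ ↔ ∀ m ∈ dualMonoid σ, 0 ≤ realFunctional m v := by
  refine ⟨fun hv m hm => hm v hv, fun h => ?_⟩
  by_contra hv
  obtain ⟨m, hm, hmv⟩ := hσ.exists_neg hv
  exact (h m hm).not_gt hmv

theorem IsRational.le_of_dualMonoid_le {σ τ : PointedCone ℝ (ℝ ⊗[ℤ] N)} (hσ : IsRational σ)
    (h : dualMonoid σ ≤ dualMonoid τ) : τ ≤ σ := fun v hv =>
  hσ.mem_iff.mpr fun _ hm => h hm v hv

theorem eq_zero_of_forall_realFunctional {v : ℝ ⊗[ℤ] N}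
    (h : ∀ m : Module.Dual ℤ N, realFunctional m v = 0) : v = 0 := by
  have hr : IsRational (⊥ : PointedCone ℝ (ℝ ⊗[ℤ] N)) := ⟨∅, by
    rw [latticeHull, Finset.coe_empty, Set.image_empty]
    exact Submodule.span_empty.symm⟩
  exact (Submodule.mem_bot _).mp (hr.mem_iff.mpr fun m _ => (h m).ge)

/-- The faces of a rational cone are cut out by integral functionals. -/
theorem IsRational.exists_dualMonoid_of_face {σ : PointedCone ℝ (ℝ ⊗[ℤ] N)} (hσ : IsRational σ)
    {ℓ : (ℝ ⊗[ℤ] N) →ₗ[ℝ] ℝ} (hℓ : ∀ v ∈ σ, 0 ≤ ℓ v) :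
    ∃ m ∈ dualMonoid σ, ∀ v ∈ σ, realFunctional m v = 0 ↔ ℓ v = 0 := by
  obtain ⟨S, rfl⟩ := hσ
  have hfin : ((fun n : N => (1 : ℝ) ⊗ₜ[ℤ] n) '' (S : Set N)).Finite := S.finite_toSet.image _
  obtain ⟨m, hm, hm'⟩ := exists_integral_functional ℓ hfin
  have hℓ' : ∀ w ∈ (fun n : N => (1 : ℝ) ⊗ₜ[ℤ] n) '' (S : Set N), 0 ≤ ℓ w := fun w hw =>
    hℓ w (PointedCone.subset_hull hw)
  have h0 : ∀ w ∈ (fun n : N => (1 : ℝ) ⊗ₜ[ℤ] n) '' (S : Set N), ℓ w = 0 →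
      realFunctional m w = 0 := by
    rintro _ ⟨s, hs, rfl⟩ h
    rw [realFunctional_one_tmul, hm s h, Int.cast_zero]
  have h1 : ∀ w ∈ (fun n : N => (1 : ℝ) ⊗ₜ[ℤ] n) '' (S : Set N), 0 ≤ realFunctional m w := by
    intro w hw
    rcases eq_or_lt_of_le (hℓ' w hw) with h | h
    · exact (h0 w hw h.symm).ge
    · exact (hm' w hw h).le
  have h2 : ∀ w ∈ (fun n : N => (1 : ℝ) ⊗ₜ[ℤ] n) '' (S : Set N), realFunctional m w = 0 →
      ℓ w = 0 := by
    intro w hw h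
    by_contra hne
    exact (hm' w hw (lt_of_le_of_ne (hℓ' w hw) (Ne.symm hne))).ne' h
  exact ⟨m, fun v hv => nonneg_of_mem_hull h1 hv, fun v hv =>
    ⟨eq_zero_of_mem_hull h1 h2 hv, eq_zero_of_mem_hull hℓ' h0 hv⟩⟩

/-- Some functional in `σ^∨` vanishes, on `σ`, only on the lineality space of `σ`. -/
theorem IsRational.exists_lineal {σ : PointedCone ℝ (ℝ ⊗[ℤ] N)} (hσ : IsRational σ) :
    ∃ m ∈ dualMonoid σ, ∀ v ∈ σ, realFunctional m v = 0 → -v ∈ σ := by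
  have hex : ∀ n : N, ∃ m ∈ dualMonoid σ, -((1 : ℝ) ⊗ₜ[ℤ] n) ∉ σ → 0 < realFunctional m (1 ⊗ₜ n) :=
    fun n => by
      by_cases h : -((1 : ℝ) ⊗ₜ[ℤ] n) ∈ σ
      · exact ⟨0, zero_mem _, fun h' => absurd h h'⟩
      · obtain ⟨m, hm, hm'⟩ := hσ.exists_neg h
        rw [map_neg] at hm'
        exact ⟨m, hm, fun _ => neg_neg_iff_pos.mp hm'⟩
  choose f hf hf' using hex
  obtain ⟨S, hS⟩ := hσ
  have hsum : ∑ n ∈ S, f n ∈ dualMonoid σ := sum_mem fun n _ => hf n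
  refine ⟨_, hsum, fun v hv => ?_⟩
  have : (0 ≤ realFunctional (∑ n ∈ S, f n) v) ∧
      (realFunctional (∑ n ∈ S, f n) v = 0 → -v ∈ σ) := by
    rw [hS] at hv
    refine hull_induction (p := fun v => 0 ≤ realFunctional (∑ n ∈ S, f n) v ∧
      (realFunctional (∑ n ∈ S, f n) v = 0 → -v ∈ σ)) ?_ (by simp) (fun v w h h' => ?_)
      (fun r v hr h => ?_) hv
    · rintro _ ⟨s, hs, rfl⟩
      have hsσ : (1 : ℝ) ⊗ₜ[ℤ] s ∈ σ := hS ▸ one_tmul_mem_latticeHull hs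
      refine ⟨hsum _ hsσ, fun h => ?_⟩
      by_contra hneg
      rw [map_sum, LinearMap.sum_apply] at h
      exact (hf' s hneg).ne'
        ((Finset.sum_eq_zero_iff_of_nonneg fun n _ => hf n _ hsσ).mp h s hs)
    · rw [map_add]
      refine ⟨add_nonneg h.1 h'.1, fun e => ?_⟩
      obtain ⟨h1, h2⟩ := (add_eq_zero_iff_of_nonneg h.1 h'.1).mp e
      rw [neg_add]
      exact add_mem (h.2 h1) (h'.2 h2)
    · rw [map_smul, smul_eq_mul]
      refine ⟨mul_nonneg hr.le h.1, fun e => ?_⟩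
      rw [← smul_neg]
      exact PointedCone.smul_mem _ hr.le (h.2 ((mul_eq_zero.mp e).resolve_left hr.ne'))
  exact this.2

end Rational

/-- Gordan's lemma: the elements of a finitely generated abelian group on which finitely many
functionals are nonnegative form a finitely generated monoid. -/
theorem exists_finset_closure_eq {M : Type*} [AddCommGroup M] [Module.Finite ℤ M] {ι : Type*}
    [Finite ι] (f : ι → M →+ ℤ) :
    ∃ G : Finset M, ∀ m, m ∈ AddSubmonoid.closure (G : Set M) ↔ ∀ i, 0 ≤ f i m := by
  classical
  let Q : AddSubmonoid (ι → ℕ) :=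
    { carrier := {x | ∃ m, ∀ i, f i m = x i}
      zero_mem' := ⟨0, by simp⟩
      add_mem' := by
        rintro x y ⟨m, hm⟩ ⟨n, hn⟩
        exact ⟨m + n, fun i => by simp [hm, hn]⟩ }
  obtain ⟨B, hB⟩ : Q.FG := AddSubmonoid.fg_of_subtractive (by
    rintro x ⟨m, hm⟩ y ⟨n, hn⟩
    exact ⟨n - m, fun i => by rw [map_sub, hm, hn]; simp⟩)
  have hlift : ∀ x ∈ Q, ∃ m, ∀ i, f i m = x i := fun x hx => hx
  choose! g hg using hlift
  let K : AddSubgroup M := ⨅ i, (f i).ker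
  have hK : ∀ m, m ∈ K ↔ ∀ i, f i m = 0 := fun m => by simp [K, AddSubgroup.mem_iInf]
  obtain ⟨C, hC⟩ : K.toAddSubmonoid.FG := by
    rw [← AddSubgroup.fg_iff_addSubmonoid_fg]
    have : (AddSubgroup.toIntSubmodule K).FG := IsNoetherian.noetherian _
    exact (Submodule.fg_iff_addSubgroup_fg _).mp this
  have hBQ : ∀ x ∈ B, x ∈ Q := fun x hx => hB ▸ AddSubmonoid.subset_closure hx
  have hCK : ∀ x ∈ C, x ∈ K := fun x hx => by
    have : x ∈ K.toAddSubmonoid := hC ▸ AddSubmonoid.subset_closure hx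
    exact this
  refine ⟨B.image g ∪ C, fun m => ⟨fun hm => ?_, fun hm => ?_⟩⟩
  · induction hm using AddSubmonoid.closure_induction with
    | mem x hx =>
      intro i
      rcases Finset.mem_union.mp hx with h | h
      · obtain ⟨y, hy, rfl⟩ := Finset.mem_image.mp h
        rw [hg y (hBQ y hy)]
        exact Int.natCast_nonneg _
      · rw [(hK x).mp (hCK x h)]
    | zero => simp
    | add x y _ _ hx hy =>
      intro i
      rw [map_add]
      exact add_nonneg (hx i) (hy i)
  · have h1 : (fun i => (f i m).toNat) ∈ AddSubmonoid.closure (B : Set (ι → ℕ)) := by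
      rw [hB]
      exact ⟨m, fun i => (Int.toNat_of_nonneg (hm i)).symm⟩
    have h2 : ∀ x ∈ AddSubmonoid.closure (B : Set (ι → ℕ)),
        ∃ n ∈ AddSubmonoid.closure ((B.image g ∪ C : Finset M) : Set M), ∀ i, f i n = x i := by
      intro x hx
      induction hx using AddSubmonoid.closure_induction with
      | mem x hx =>
        exact ⟨g x, AddSubmonoid.subset_closure
          (Finset.mem_union_left _ (Finset.mem_image_of_mem _ hx)), hg x (hBQ x hx)⟩
      | zero => exact ⟨0, zero_mem _, by simp⟩
      | add x y _ _ hx hy =>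
        obtain ⟨n, hn, hn'⟩ := hx
        obtain ⟨k, hk, hk'⟩ := hy
        exact ⟨n + k, add_mem hn hk, fun i => by simp [hn', hk']⟩
    obtain ⟨n, hn, hn'⟩ := h2 _ h1
    have h3 : m - n ∈ K := (hK _).mpr fun i => by
      rw [map_sub, hn', Int.toNat_of_nonneg (hm i), sub_self]
    have h4 : m - n ∈ AddSubmonoid.closure ((B.image g ∪ C : Finset M) : Set M) := by
      have h5 : m - n ∈ AddSubmonoid.closure (C : Set M) := by
        rw [hC]
        exact h3
      exact AddSubmonoid.closure_mono (by simp) h5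
    have := add_mem hn h4
    rwa [add_sub_cancel] at this

theorem IsRational.dualMonoid_fg {N : Type u} [AddCommGroup N] [Module.Finite ℤ N]
    [Module.Free ℤ N] {σ : PointedCone ℝ (ℝ ⊗[ℤ] N)} (hσ : IsRational σ) : (dualMonoid σ).FG := by
  obtain ⟨S, rfl⟩ := hσ
  obtain ⟨G, hG⟩ := exists_finset_closure_eq (M := Module.Dual ℤ N) (ι := S)
    fun s => (Module.Dual.eval ℤ N s.1).toAddMonoidHom
  exact ⟨G, AddSubmonoid.ext fun m => (hG m).trans
    (Subtype.forall.trans mem_dualMonoid_latticeHull.symm)⟩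

/-! ### The dual cone of a submonoid of a lattice -/

section DualCone

variable {M : Type u} [AddCommGroup M]

/-- The cone in `N_ℝ`, where `N` is the dual of `M`, that is dual to a submonoid of `M`. -/
def dualCone (S : AddSubmonoid M) : PointedCone ℝ (ℝ ⊗[ℤ] Module.Dual ℤ M) :=
  PointedCone.dual (realPairing M) (convexHull ℝ ((fun m : M => (1 : ℝ) ⊗ₜ[ℤ] m) '' (S : Set M)))

theorem realPairing_one_tmul (m : M) (v : ℝ ⊗[ℤ] Module.Dual ℤ M) :
    realPairing M (1 ⊗ₜ m) v = realFunctional (Module.Dual.eval ℤ M m) v := by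
  have : realPairing M (1 ⊗ₜ m) = realFunctional (Module.Dual.eval ℤ M m) := by
    ext n
    simp [realPairing]
  rw [this]

theorem mem_dualCone {S : AddSubmonoid M} {v : ℝ ⊗[ℤ] Module.Dual ℤ M} :
    v ∈ dualCone S ↔ ∀ m ∈ S, 0 ≤ realFunctional (Module.Dual.eval ℤ M m) v := by
  constructor
  · intro h m hm
    rw [← realPairing_one_tmul]
    exact h (subset_convexHull ℝ _ ⟨m, hm, rfl⟩)
  · intro h
    have hconv : Convex ℝ {x : ℝ ⊗[ℤ] M | 0 ≤ realPairing M x v} :=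
      convex_halfSpace_ge ((realPairing M).flip v).isLinear 0
    refine fun x hx => convexHull_min (?_ : _ ⊆ {x : ℝ ⊗[ℤ] M | 0 ≤ realPairing M x v}) hconv hx
    rintro _ ⟨m, hm, rfl⟩
    change 0 ≤ realPairing M (1 ⊗ₜ m) v
    rw [realPairing_one_tmul]
    exact h m hm

theorem dualCone_anti {S T : AddSubmonoid M} (h : S ≤ T) : dualCone T ≤ dualCone S :=
  fun _ hv => mem_dualCone.mpr fun m hm => mem_dualCone.mp hv m (h hm)

theorem one_tmul_mem_dualCone {S : AddSubmonoid M} {n : Module.Dual ℤ M} :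
    (1 : ℝ) ⊗ₜ[ℤ] n ∈ dualCone S ↔ ∀ m ∈ S, 0 ≤ n m := by
  rw [mem_dualCone]
  refine forall₂_congr fun m _ => ?_
  rw [realFunctional_one_tmul]
  exact Int.cast_nonneg_iff

theorem nonneg_of_mem_closure {T : Set M} {n : M →+ ℤ} (h : ∀ t ∈ T, 0 ≤ n t) {m : M}
    (hm : m ∈ AddSubmonoid.closure T) : 0 ≤ n m := by
  induction hm using AddSubmonoid.closure_induction with
  | mem x hx => exact h x hx
  | zero => simp
  | add x y _ _ hx hy =>
    rw [map_add]
    exact add_nonneg hx hy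

variable [Module.Free ℤ M]

theorem eval_mem_dualMonoid_dualCone {S : AddSubmonoid M} (hS : S.FG)
    (hsat : ∀ (m : M) (k : ℕ), 1 ≤ k → k • m ∈ S → m ∈ S) {m : M} :
    Module.Dual.eval ℤ M m ∈ dualMonoid (dualCone S) ↔ m ∈ S := by
  refine ⟨fun h => ?_, fun h v hv => mem_dualCone.mp hv m h⟩
  obtain ⟨T, rfl⟩ := hS
  obtain ⟨k, hk, hkm⟩ := exists_nsmul_mem_closure T.finite_toSet (m := m) fun n hn => by
    have h1 := h _ (one_tmul_mem_dualCone.mpr fun m hm =>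
      nonneg_of_mem_closure (n := n.toAddMonoidHom) hn hm)
    rw [realFunctional_one_tmul] at h1
    exact_mod_cast h1
  exact hsat m k hk hkm

variable [Module.Finite ℤ M]

theorem isRational_dualCone {S : AddSubmonoid M} (hS : S.FG) : IsRational (dualCone S) := by
  obtain ⟨T, rfl⟩ := hS
  obtain ⟨G, hG⟩ := exists_finset_closure_eq (M := Module.Dual ℤ M) (ι := T)
    fun t => (Module.Dual.eval ℤ M t.1).toAddMonoidHom
  have hG' : ∀ n : Module.Dual ℤ M, n ∈ AddSubmonoid.closure (G : Set (Module.Dual ℤ M)) ↔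
      ∀ t ∈ T, 0 ≤ n t := fun n => (hG n).trans Subtype.forall
  refine ⟨G, le_antisymm ?_ ?_⟩
  · have hr : IsRational (latticeHull (G : Set (Module.Dual ℤ M))) := ⟨G, rfl⟩
    refine hr.le_of_dualMonoid_le fun μ hμ v hv => ?_
    obtain ⟨m, rfl⟩ := (Module.evalEquiv ℤ M).surjective μ
    rw [mem_dualMonoid_latticeHull] at hμ
    obtain ⟨k, hk, hkm⟩ := exists_nsmul_mem_closure T.finite_toSet (m := m) fun n hn =>
      nonneg_of_mem_closure (n := (Module.Dual.eval ℤ M m).toAddMonoidHom) hμ ((hG' n).mpr hn)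
    have h1 := mem_dualCone.mp hv _ hkm
    rw [map_nsmul, map_nsmul, LinearMap.smul_apply, nsmul_eq_mul] at h1
    exact nonneg_of_mul_nonneg_right h1 (by exact_mod_cast hk)
  · refine Submodule.span_le.mpr ?_
    rintro _ ⟨n, hn, rfl⟩
    exact one_tmul_mem_dualCone.mpr fun m hm => nonneg_of_mem_closure (n := n.toAddMonoidHom)
      ((hG' n).mp (AddSubmonoid.subset_closure hn)) hm

theorem isCone_dualCone {S : AddSubmonoid M} (hS : S.FG)
    (hgen : ∀ m : M, ∃ a ∈ S, ∃ b ∈ S, m = a - b) : IsCone (dualCone S) := by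
  refine ⟨isRational_dualCone hS, fun v hv hv' => eq_zero_of_forall_realFunctional fun μ => ?_⟩
  obtain ⟨m, rfl⟩ := (Module.evalEquiv ℤ M).surjective μ
  have h0 : ∀ a ∈ S, realFunctional (Module.Dual.eval ℤ M a) v = 0 := fun a ha => by
    have h1 := mem_dualCone.mp hv a ha
    have h2 := mem_dualCone.mp hv' a ha
    rw [map_neg] at h2
    linarith
  obtain ⟨a, ha, b, hb, rfl⟩ := hgen m
  change realFunctional (Module.Dual.eval ℤ M (a - b)) v = 0
  rw [map_sub, map_sub, LinearMap.sub_apply, h0 a ha, h0 b hb, sub_zero]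

end DualCone

end

end MonoidScheme

/-! ### Toric systems -/

namespace MonoidScheme

noncomputable section

open MonoidSpace

theorem Pointed.pow_injective {M : Type u} [AddCommGroup M] [IsAddTorsionFree M] {n : ℕ}
    (hn : n ≠ 0) {s t : Pointed M} (h : s ^ n = t ^ n) : s = t := by
  rcases eq_zero_or_of s with rfl | ⟨a, rfl⟩ <;> rcases eq_zero_or_of t with rfl | ⟨b, rfl⟩
  · rfl
  · rw [zero_pow hn] at h
    exact absurd (pow_eq_zero_iff hn |>.mp h.symm) (of_ne_zero b)
  · rw [zero_pow hn] at h
    exact absurd (pow_eq_zero_iff hn |>.mp h) (of_ne_zero a)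
  · have h1 : of (n • a) = of (n • b) := h
    exact congrArg of (nsmul_right_injective hn (of_injective h1))

theorem Pointed.of_nsmul {M : Type u} [AddCommGroup M] (n : ℕ) (m : M) :
    of (n • m) = of m ^ n := rfl

theorem Pointed.fg_withZero {M : Type u} [AddCommGroup M] {S : AddSubmonoid M} (hS : S.FG) :
    Monoid.FG (WithZero (Multiplicative S)) := by
  obtain ⟨T, rfl⟩ := hS
  classical
  let G : Set (WithZero (Multiplicative (AddSubmonoid.closure (T : Set M)))) :=
    insert 0 (Set.range fun t : T => ((Multiplicative.ofAdd
      (⟨t.1, AddSubmonoid.subset_closure t.2⟩ : AddSubmonoid.closure (T : Set M)) :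
        Multiplicative _) : WithZero _))
  have hG : G.Finite := (Set.finite_range _).insert 0
  have key : ∀ (m : M) (hm : m ∈ AddSubmonoid.closure (T : Set M)), ((Multiplicative.ofAdd
      (⟨m, hm⟩ : AddSubmonoid.closure (T : Set M)) : Multiplicative _) : WithZero _) ∈
        Submonoid.closure G := fun m hm => by
    induction hm using AddSubmonoid.closure_induction with
    | mem x hx => exact Submonoid.subset_closure (Or.inr ⟨⟨x, hx⟩, rfl⟩)
    | zero => exact one_mem _
    | add x y _ _ hx hy => exact mul_mem hx hy
  refine ⟨⟨hG.toFinset, eq_top_iff.mpr fun a _ => ?_⟩⟩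
  rw [hG.coe_toFinset]
  rcases eq_zero_or_coe a with rfl | ⟨m, hm, rfl⟩
  · exact Submonoid.subset_closure (Or.inl rfl)
  · exact key m hm

/-- A pointed monoid that is the monoid `S_*` of a saturated submonoid of a group is normal. -/
theorem isNormal_of_saturated {M : Type u} [AddCommGroup M] {A : Type u} [CommMonoidWithZero A]
    (e : A →*₀ Pointed M) (he : Function.Injective e) {S : AddSubmonoid M}
    (hmem : ∀ t, Pointed.Mem S t ↔ ∃ a, e a = t)
    (hsat : ∀ (m : M) (k : ℕ), 1 ≤ k → k • m ∈ S → m ∈ S) : IsNormal A := by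
  have hcancel : IsCancelMulZero A := he.isCancelMulZero e (map_zero e) (map_mul e)
  have hnt : Nontrivial A := ⟨0, 1, fun h => zero_ne_one (α := Pointed M) (by
    rw [← map_zero e, ← map_one e, h])⟩
  refine ⟨hcancel, fun α ⟨n, hn, b, hα⟩ => ?_⟩
  induction α using Localization.induction_on with | _ as => ?_
  obtain ⟨a, s⟩ := as
  dsimp only at hα ⊢
  have hs : e s.1 ≠ 0 := fun h => nonZeroDivisors.ne_zero s.2 (he (h.trans (map_zero e).symm))
  have h1 : a ^ n = s.1 ^ n * b := by
    rw [Localization.mk_pow, Localization.mk_eq_mk_iff, Localization.r_iff_exists] at hα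
    obtain ⟨c, hc⟩ := hα
    have := mul_left_cancel₀ (nonZeroDivisors.ne_zero c.2) hc
    simpa using this
  rcases Pointed.eq_zero_or_of (e s.1) with h0 | ⟨y, hy⟩
  · exact absurd h0 hs
  rcases Pointed.eq_zero_or_of (e a) with h0 | ⟨x, hx⟩
  · obtain rfl : a = 0 := he (h0.trans (map_zero e).symm)
    exact ⟨0, by rw [Localization.mk_zero, Localization.mk_zero]⟩
  have h2 : Pointed.of (n • x) = Pointed.of (n • y) * e b := by
    rw [Pointed.of_nsmul, Pointed.of_nsmul, ← hx, ← hy, ← map_pow, ← map_pow, ← map_mul, h1]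
  have h3 : x - y ∈ S := by
    refine hsat _ n hn ?_
    rcases (hmem (e b)).mpr ⟨b, rfl⟩ with h0 | ⟨z, hz, h0⟩
    · rw [h0, mul_zero] at h2
      exact absurd h2 (Pointed.of_ne_zero _)
    · rw [h0, ← Pointed.of_add] at h2
      rwa [smul_sub, Pointed.of_injective h2, add_sub_cancel_left]
  obtain ⟨w, hw⟩ := (hmem _).mp (Pointed.mem_of.mpr h3)
  refine ⟨w, ?_⟩
  rw [Localization.mk_eq_mk_iff, Localization.r_iff_exists]
  refine ⟨1, ?_⟩
  have h4 : a = s.1 * w := he (by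
    rw [map_mul, hx, hy, hw, ← Pointed.of_add, add_sub_cancel])
  simp [h4]

namespace MonoidSystem

variable {P : Type u} [PartialOrder P] {M : Type u} [AddCommGroup M] {𝒮 : MonoidSystem P M}

theorem IsLocalized.isToric [Finite P] [IsAddTorsionFree M] (h : 𝒮.IsLocalized)
    (h' : 𝒮.HasInfSum) (hbot : ∃ o : P, ∀ p, o ≤ p) (hfg : ∀ p, (𝒮.S p).FG)
    (hsat : ∀ p (m : M) (k : ℕ), 1 ≤ k → k • m ∈ 𝒮.S p → m ∈ 𝒮.S p) : IsToric 𝒮.space where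
  isMonoidScheme := h.isMonoidScheme
  isSeparated := h.isSeparated h'
  connected := by
    obtain ⟨o, ho⟩ := hbot
    have hcl : closure {𝒮.pt o} = Set.univ := Set.eq_univ_of_forall fun x =>
      specializes_iff_mem_closure.mp (𝒮.specializes_iff.mpr (ho _))
    have : PreconnectedSpace 𝒮.space := ⟨hcl ▸ isPreconnected_singleton.closure⟩
    exact { toNonempty := ⟨𝒮.pt o⟩ }
  torsionfree x := ⟨fun n hn s t hst => 𝒮.ev_injective x (Pointed.pow_injective hn (by
    have := congrArg (𝒮.ev x) hst
    simpa using this))⟩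
  normal x := isNormal_of_saturated (𝒮.ev x) (𝒮.ev_injective x)
    (fun t => ⟨𝒮.exists_ev x, by rintro ⟨a, rfl⟩; exact 𝒮.mem_ev x a⟩) (hsat _)
  finiteType := by
    refine ⟨Set.range 𝒮.below, Set.finite_range _, ?_, ?_⟩
    · refine eq_top_iff.mpr fun x _ => ?_
      exact Opens.mem_sSup.mpr ⟨_, ⟨𝒮.idx x, rfl⟩, 𝒮.mem_below.mpr le_rfl⟩
    · rintro _ ⟨p, rfl⟩
      exact ⟨_, _, Pointed.fg_withZero (hfg p), (h.chart p).nonempty_iso⟩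

end MonoidSystem

namespace MonoidSystem

variable {P Q : Type u} [PartialOrder P] [PartialOrder Q] {M K : Type u} [AddCommGroup M]
  [AddCommGroup K] {𝒮 : MonoidSystem P M} {𝒯 : MonoidSystem Q K}

theorem monotone_base (f : 𝒮.space ⟶ 𝒯.space) {x y : 𝒮.space} (h : 𝒮.idx x ≤ 𝒮.idx y) :
    𝒯.idx (f.base x) ≤ 𝒯.idx (f.base y) :=
  𝒯.specializes_iff.mp ((𝒮.specializes_iff.mpr h).map f.base.continuous)

/-- If the least point `o` is mapped to a point whose monoid is the whole group, the morphism
induces a homomorphism of groups that describes all values of pullbacks of sections. -/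
theorem exists_pullback (f : 𝒮.space ⟶ 𝒯.space) {o : 𝒮.space} (ho : ∀ x, 𝒮.idx o ≤ 𝒮.idx x)
    (htop : ∀ k, k ∈ 𝒯.S (𝒯.idx (f.base o))) :
    ∃ g : K →+ M, ∀ (V : Opens 𝒯.space) (s : 𝒯.space.sec V) (x : 𝒮.space) (hx : f.base x ∈ V),
      𝒮.value x hx (f.app V s) = Pointed.map g (𝒯.value (f.base x) hx s) := by
  have hlift : ∀ m : K, ∃ t, 𝒯.ev (f.base o) t = Pointed.of m := fun m =>
    𝒯.exists_ev (f.base o) (Pointed.mem_of.mpr (htop m))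
  have hex : ∀ m : K, ∃ k : M, ∀ t, 𝒯.ev (f.base o) t = Pointed.of m →
      𝒮.ev o (f.stalkMap o t) = Pointed.of k := fun m => by
    obtain ⟨t, ht⟩ := hlift m
    have hu : IsUnit t := (𝒯.isUnit_iff _ _).mpr ⟨m, ht, htop (-m)⟩
    obtain ⟨k, hk, -⟩ := (𝒮.isUnit_iff _ _).mp (hu.map (f.stalkMap o))
    refine ⟨k, fun t' ht' => ?_⟩
    rw [𝒯.ev_injective _ (ht'.trans ht.symm), hk]
  choose g hg using hex
  refine ⟨⟨⟨g, ?_⟩, fun m n => ?_⟩, fun V s x hx => ?_⟩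
  · have h1 := hg 0 1 (map_one _)
    rw [map_one, map_one] at h1
    exact (Pointed.of_injective h1).symm
  · obtain ⟨t, ht⟩ := hlift m
    obtain ⟨t', ht'⟩ := hlift n
    have h1 := hg (m + n) (t * t') (by rw [map_mul, ht, ht', Pointed.of_add])
    rw [map_mul, map_mul, hg m t ht, hg n t' ht', ← Pointed.of_add] at h1
    exact (Pointed.of_injective h1).symm
  · have hoV : f.base o ∈ V := 𝒯.mem_of_le V (monotone_base f (ho x)) hx
    rw [← 𝒮.value_eq (f.app V s) hx hoV (ho x), ← 𝒯.value_eq s hx hoV (monotone_base f (ho x))]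
    have h0 : 𝒮.value o hoV (f.app V s) =
        𝒮.ev o (f.stalkMap o (𝒯.space.germ (f.base o) V hoV s)) := rfl
    rw [h0]
    rcases Pointed.eq_zero_or_of (𝒯.value (f.base o) hoV s) with h1 | ⟨m, h1⟩
    · have h2 : 𝒯.space.germ (f.base o) V hoV s = 0 :=
        𝒯.ev_injective _ (by rw [map_zero]; exact h1)
      rw [h1, h2, map_zero, map_zero, map_zero]
    · rw [h1, Pointed.map_of]
      exact hg m _ h1

theorem ev_stalkMap {f : 𝒮.space ⟶ 𝒯.space} {g : K →+ M}
    (hg : ∀ (V : Opens 𝒯.space) (s : 𝒯.space.sec V) (x : 𝒮.space) (hx : f.base x ∈ V),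
      𝒮.value x hx (f.app V s) = Pointed.map g (𝒯.value (f.base x) hx s)) (x : 𝒮.space)
    (t : 𝒯.space.stalk (f.base x)) :
    𝒮.ev x (f.stalkMap x t) = Pointed.map g (𝒯.ev (f.base x) t) := by
  obtain ⟨V, hV, s, rfl⟩ := 𝒯.space.germ_exists _ t
  exact hg V s x hV

theorem mem_of_pullback {f : 𝒮.space ⟶ 𝒯.space} {g : K →+ M}
    (hg : ∀ (V : Opens 𝒯.space) (s : 𝒯.space.sec V) (x : 𝒮.space) (hx : f.base x ∈ V),
      𝒮.value x hx (f.app V s) = Pointed.map g (𝒯.value (f.base x) hx s)) (x : 𝒮.space) {m : K}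
    (hm : m ∈ 𝒯.S (𝒯.idx (f.base x))) : g m ∈ 𝒮.S (𝒮.idx x) := by
  obtain ⟨t, ht⟩ := 𝒯.exists_ev (f.base x) (Pointed.mem_of.mpr hm)
  have h1 := 𝒮.mem_ev x (f.stalkMap x t)
  rwa [ev_stalkMap hg, ht, Pointed.map_of, Pointed.mem_of] at h1

theorem neg_mem_of_pullback {f : 𝒮.space ⟶ 𝒯.space} {g : K →+ M}
    (hg : ∀ (V : Opens 𝒯.space) (s : 𝒯.space.sec V) (x : 𝒮.space) (hx : f.base x ∈ V),
      𝒮.value x hx (f.app V s) = Pointed.map g (𝒯.value (f.base x) hx s)) (x : 𝒮.space) {m : K}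
    (hm : m ∈ 𝒯.S (𝒯.idx (f.base x))) (hm' : -g m ∈ 𝒮.S (𝒮.idx x)) :
    -m ∈ 𝒯.S (𝒯.idx (f.base x)) := by
  obtain ⟨t, ht⟩ := 𝒯.exists_ev (f.base x) (Pointed.mem_of.mpr hm)
  have hu : IsUnit (f.stalkMap x t) := (𝒮.isUnit_iff _ _).mpr
    ⟨g m, by rw [ev_stalkMap hg, ht, Pointed.map_of], hm'⟩
  obtain ⟨n, hn, hn'⟩ := (𝒯.isUnit_iff _ _).mp ((f.isLocal x).map_nonunit _ hu)
  rwa [Pointed.of_injective (ht.symm.trans hn)]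

end MonoidSystem

/-! ### Fans give toric monoid schemes -/

namespace Fan

variable (Δ : Fan.{u})

theorem isRational (σ : Δ.Pt) : IsRational σ.cone := (Δ.toFanIn.isCone _ σ.2).1

variable {Δ} in
theorem isFace_of_le {τ σ : Δ.Pt} (h : τ ≤ σ) : IsFace τ.cone σ.cone := by
  have h1 := (Δ.toFanIn.inter_face _ σ.2 _ τ.2).1
  have h2 : σ.cone ⊓ τ.cone = τ.cone := inf_eq_right.mpr h
  rwa [h2] at h1

variable {Δ} in
/-- A face of a cone of a fan is cut out by an integral functional. -/
theorem exists_dualMonoid_of_le {τ σ : Δ.Pt} (h : τ ≤ σ) :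
    ∃ m ∈ dualMonoid σ.cone, ∀ v, v ∈ τ.cone ↔ v ∈ σ.cone ∧ realFunctional m v = 0 := by
  obtain ⟨ℓ, hℓ, hτ⟩ := isFace_of_le h
  obtain ⟨m, hm, hm'⟩ := (Δ.isRational σ).exists_dualMonoid_of_face hℓ
  exact ⟨m, hm, fun v => (hτ v).trans (and_congr_right fun hv => (hm' v hv).symm)⟩

/-- Every face of the monoid `σ^∨ ∩ M` is the face of the functionals that vanish on a face of
`σ`. -/
theorem exists_pt_of_face (σ : Δ.Pt) (F : AddSubmonoid (Module.Dual ℤ Δ.N))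
    (hF : F ≤ dualMonoid σ.cone)
    (hface : ∀ a ∈ dualMonoid σ.cone, ∀ b ∈ dualMonoid σ.cone, a + b ∈ F → a ∈ F) :
    ∃ τ ≤ σ, ∀ a ∈ dualMonoid σ.cone, a ∈ F ↔ -a ∈ dualMonoid τ.cone := by
  obtain ⟨S, hS⟩ := Δ.isRational σ
  have hSσ : ∀ s ∈ S, (1 : ℝ) ⊗ₜ[ℤ] s ∈ σ.cone := fun s hs => hS ▸ one_tmul_mem_latticeHull hs
  have hpos : ∀ a ∈ F, ∀ s ∈ S, 0 ≤ a s := fun a ha s hs => by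
    have := hF ha _ (hSσ s hs)
    rw [realFunctional_one_tmul] at this
    exact_mod_cast this
  -- an element of `F` that is positive on all generators on which some element of `F` is
  have hex : ∀ s : Δ.N, ∃ m ∈ F, (∃ a ∈ F, 0 < a s) → 0 < m s := fun s => by
    by_cases h : ∃ a ∈ F, 0 < a s
    · obtain ⟨a, ha, h⟩ := h
      exact ⟨a, ha, fun _ => h⟩
    · exact ⟨0, zero_mem _, fun h' => absurd h' h⟩
  choose f hf hf' using hex
  have hm : ∑ s ∈ S, f s ∈ F := sum_mem fun s _ => hf s
  obtain ⟨m, hm, hzero⟩ : ∃ m ∈ F, ∀ a ∈ F, ∀ s ∈ S, m s = 0 → a s = 0 := by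
    refine ⟨_, hm, fun a ha s hs h => ?_⟩
    by_contra hne
    rw [LinearMap.sum_apply, Finset.sum_eq_zero_iff_of_nonneg fun t _ => hpos _ (hf t) s hs] at h
    exact (hf' s ⟨a, ha, lt_of_le_of_ne (hpos a ha s hs) (Ne.symm hne)⟩).ne' (h s hs)
  let τ : PointedCone ℝ (ℝ ⊗[ℤ] Δ.N) :=
    σ.cone ⊓ PointedCone.ofSubmodule (LinearMap.ker (realFunctional m))
  have hτ : ∀ v, v ∈ τ ↔ v ∈ σ.cone ∧ realFunctional m v = 0 := fun v => Iff.rfl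
  have hle : τ ≤ σ.cone := inf_le_left
  refine ⟨⟨τ, Δ.toFanIn.face_mem _ σ.2 _ ⟨_, hF hm, hτ⟩⟩, hle, fun a ha => ⟨fun haF => ?_,
    fun h => ?_⟩⟩
  · refine (neg_mem_dualMonoid_iff hle ha).mpr fun v hv => ?_
    obtain ⟨hvσ, hv0⟩ := (hτ v).mp hv
    rw [hS] at hvσ
    refine eq_zero_of_mem_hull (f := realFunctional m) ?_ ?_ hvσ hv0
    · rintro _ ⟨s, hs, rfl⟩
      rw [realFunctional_one_tmul]
      exact_mod_cast hpos m hm s hs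
    · rintro _ ⟨s, hs, rfl⟩ h
      rw [realFunctional_one_tmul] at h ⊢
      rw [hzero a haF s hs (by exact_mod_cast h), Int.cast_zero]
  · obtain ⟨k, hk⟩ := (Δ.isRational σ).exists_add_nsmul_mem (hF hm)
      (fun v hv h0 => (hτ v).mpr ⟨hv, h0⟩) h
    exact hface a ha _ hk (by rw [add_neg_cancel_left]; exact nsmul_mem hm k)

theorem system_isLocalized : Δ.system.IsLocalized where
  exists_denom {τ σ} h := by
    obtain ⟨m, hm, hτ⟩ := exists_dualMonoid_of_le h
    refine ⟨m, hm, (neg_mem_dualMonoid_iff h hm).mpr fun v hv => ((hτ v).mp hv).2, fun a ha => ?_⟩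
    exact (Δ.isRational σ).exists_add_nsmul_mem hm (fun v hv h0 => (hτ v).mpr ⟨hv, h0⟩) ha
  exists_face := Δ.exists_pt_of_face
  le_of_le {τ τ' _} _ _ h := (Δ.isRational τ').le_of_dualMonoid_le h

/-- The separation lemma: a functional that vanishes only on the lineality space of `σ - τ` is
nonnegative on `σ`, nonpositive on `τ`, and its zeros in `σ` lie in `τ`. -/
theorem exists_separating (σ τ : Δ.Pt) : ∃ m ∈ dualMonoid σ.cone, -m ∈ dualMonoid τ.cone ∧
    ∀ v ∈ σ.cone, realFunctional m v = 0 → v ∈ τ.cone := by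
  classical
  obtain ⟨S, hS⟩ := Δ.isRational σ
  obtain ⟨T, hT⟩ := Δ.isRational τ
  let ω : PointedCone ℝ (ℝ ⊗[ℤ] Δ.N) := latticeHull ((S ∪ T.image Neg.neg : Finset Δ.N) : Set Δ.N)
  have hω : IsRational ω := ⟨_, rfl⟩
  have h1 : σ.cone ≤ ω := by
    rw [hS]
    exact Submodule.span_mono (Set.image_mono (by simp))
  have h2 : ∀ v ∈ τ.cone, -v ∈ ω := fun v hv => by
    rw [hT] at hv
    refine hull_induction (p := fun v => -v ∈ ω) ?_ (by simp) (fun v w h h' => ?_)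
      (fun r v hr h => ?_) hv
    · rintro _ ⟨t, ht, rfl⟩
      have h3 : (1 : ℝ) ⊗ₜ[ℤ] (-t) ∈ ω := one_tmul_mem_latticeHull (by
        rw [Finset.mem_coe]
        exact Finset.mem_union_right _ (Finset.mem_image_of_mem _ ht))
      rwa [TensorProduct.tmul_neg] at h3
    · rw [neg_add]
      exact add_mem h h'
    · rw [← smul_neg]
      exact PointedCone.smul_mem _ hr.le h
  have h3 : ∀ v ∈ ω, ∃ p ∈ σ.cone, ∃ q ∈ τ.cone, v = p - q := fun v hv => by
    refine hull_induction (p := fun v => ∃ p ∈ σ.cone, ∃ q ∈ τ.cone, v = p - q) ?_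
      ⟨0, zero_mem _, 0, zero_mem _, by simp⟩ ?_ ?_ hv
    · rintro _ ⟨s, hs, rfl⟩
      rcases Finset.mem_union.mp hs with h | h
      · exact ⟨1 ⊗ₜ s, hS ▸ one_tmul_mem_latticeHull h, 0, zero_mem _, by simp⟩
      · obtain ⟨t, ht, rfl⟩ := Finset.mem_image.mp h
        exact ⟨0, zero_mem _, 1 ⊗ₜ t, hT ▸ one_tmul_mem_latticeHull ht, by
          simp [TensorProduct.tmul_neg]⟩
    · rintro _ _ ⟨p, hp, q, hq, rfl⟩ ⟨p', hp', q', hq', rfl⟩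
      exact ⟨p + p', add_mem hp hp', q + q', add_mem hq hq', by abel⟩
    · rintro r _ hr ⟨p, hp, q, hq, rfl⟩
      exact ⟨r • p, PointedCone.smul_mem _ hr.le hp, r • q, PointedCone.smul_mem _ hr.le hq,
        smul_sub r p q⟩
  obtain ⟨m, hm, hm'⟩ := hω.exists_lineal
  refine ⟨m, fun v hv => hm v (h1 hv), fun v hv => ?_, fun v hv hv0 => ?_⟩
  · have := hm _ (h2 v hv)
    rw [map_neg] at this ⊢
    exact this
  · obtain ⟨p, hp, q, hq, e⟩ := h3 _ (hm' v (h1 hv) hv0)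
    -- `v + p = q` lies in the face `σ ∩ τ` of `σ`, hence so does `v`
    obtain ⟨ℓ, hℓ, hface⟩ := (Δ.toFanIn.inter_face _ σ.2 _ τ.2).1
    have hqe : q = v + p := by
      rw [← sub_eq_zero, ← neg_sub, ← neg_zero, neg_inj]
      have := sub_eq_zero.mpr e
      rw [← neg_inj, neg_zero] at this
      rw [← this]
      abel
    have hq' : v + p ∈ σ.cone ⊓ τ.cone := ⟨add_mem hv hp, hqe ▸ hq⟩
    have h4 := ((hface _).mp hq').2
    rw [map_add] at h4
    exact ((hface v).mpr ⟨hv, ((add_eq_zero_iff_of_nonneg (hℓ v hv) (hℓ p hp)).mp h4).1⟩).2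

theorem system_hasInfSum : Δ.system.HasInfSum := fun σ τ => by
  refine ⟨⟨σ.cone ⊓ τ.cone, Δ.inter_mem σ.2 τ.2⟩,
    inf_le_left (α := PointedCone ℝ (ℝ ⊗[ℤ] Δ.N)), inf_le_right (α := PointedCone ℝ (ℝ ⊗[ℤ] Δ.N)),
    fun ρ h h' => le_inf (α := PointedCone ℝ (ℝ ⊗[ℤ] Δ.N)) h h', fun c hc => ?_⟩
  obtain ⟨m, hm, hm', h⟩ := Δ.exists_separating σ τ
  obtain ⟨k, hk⟩ := (Δ.isRational σ).exists_add_nsmul_mem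
    (ρ := σ.cone ⊓ τ.cone) hm (fun v hv h0 => ⟨hv, h v hv h0⟩) hc
  refine ⟨_, hk, _, nsmul_mem hm' k, ?_⟩
  rw [smul_neg, add_neg_cancel_right]

theorem exists_bot : ∃ o : Δ.Pt, o.cone = ⊥ := by
  obtain ⟨σ, hσ⟩ := Δ.toFanIn.nonempty
  obtain ⟨m, hm, h⟩ := (Δ.isRational ⟨σ, hσ⟩).exists_lineal
  refine ⟨⟨⊥, Δ.toFanIn.face_mem σ hσ _ ⟨realFunctional m, hm, fun v => ?_⟩⟩, rfl⟩
  constructor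
  · intro hv
    rw [(Submodule.mem_bot _).mp hv]
    exact ⟨zero_mem _, map_zero _⟩
  · rintro ⟨hv, h0⟩
    exact (Submodule.mem_bot _).mpr ((Δ.toFanIn.isCone σ hσ).2 v hv (h v hv h0))

instance isAddTorsionFree_dual (N : Type u) [AddCommGroup N] :
    IsAddTorsionFree (Module.Dual ℤ N) :=
  ⟨fun n hn f g h => LinearMap.ext fun v => by
    have := LinearMap.congr_fun h v
    simpa [hn] using this⟩

theorem isToric_space : IsToric Δ.space := by
  have : Finite Δ.Pt := Δ.toFanIn.finite.to_subtype
  obtain ⟨o, ho⟩ := Δ.exists_bot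
  refine Δ.system_isLocalized.isToric Δ.system_hasInfSum ⟨o, fun p => ?_⟩
    (fun p => (Δ.isRational p).dualMonoid_fg) fun p m k hk h => mem_dualMonoid_of_nsmul hk h
  change o.cone ≤ p.cone
  rw [ho]
  exact bot_le

/-! ### Morphisms of spaces of fans -/

variable {Δ}

theorem coneOf_eq_bot {η : Δ.space} (h : IsMinimalPoint Δ.space η) : Δ.coneOf η = ⊥ := by
  obtain ⟨o, ho⟩ := Δ.exists_bot
  have h1 : Δ.system.pt o ⤳ η := Δ.system.specializes_iff.mpr (by
    change o.cone ≤ _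
    rw [ho]
    exact bot_le)
  rw [← h _ h1]
  exact ho

theorem coneOf_le_of_isMinimalPoint {η : Δ.space} (h : IsMinimalPoint Δ.space η) (x : Δ.space) :
    Δ.system.idx η ≤ Δ.system.idx x := by
  change Δ.coneOf η ≤ Δ.coneOf x
  rw [coneOf_eq_bot h]
  exact bot_le

theorem mem_system_of_isMinimalPoint {η : Δ.space} (h : IsMinimalPoint Δ.space η)
    (m : Module.Dual ℤ Δ.N) : m ∈ Δ.system.S (Δ.system.idx η) := by
  intro v hv
  have hv' : v ∈ Δ.coneOf η := hv
  rw [coneOf_eq_bot h, Submodule.mem_bot] at hv'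
  rw [hv', map_zero]

theorem stalkToLattice_bijective {η : Δ.space} (h : IsMinimalPoint Δ.space η) :
    Function.Bijective (Δ.stalkToLattice η) := by
  have e : ⇑(Δ.stalkToLattice η) = Δ.system.ev η := funext fun t => Δ.stalkToLattice_eq η t
  rw [e]
  refine ⟨Δ.system.ev_injective η, fun t => Δ.system.exists_ev η ?_⟩
  rcases Pointed.eq_zero_or_of t with rfl | ⟨m, rfl⟩
  · exact Or.inl rfl
  · exact Pointed.mem_of.mpr (mem_system_of_isMinimalPoint h m)

theorem incl_conePull {N N' : Type u} [AddCommGroup N] [AddCommGroup N'] (φ : N →ₗ[ℤ] N')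
    {σ : PointedCone ℝ (ℝ ⊗[ℤ] N)} {σ' : PointedCone ℝ (ℝ ⊗[ℤ] N')}
    (h : σ.map (φ.baseChange ℝ) ≤ σ') (a : coneMonoid σ') :
    Pointed.incl _ (conePull φ h a) = Pointed.map (φ.dualMap : _ →+ _) (Pointed.incl _ a) := by
  rcases Pointed.eq_zero_or_coe a with rfl | ⟨m, hm, rfl⟩
  · simp
  · rfl

variable {Δ' : Fan.{u}}

theorem system_value_mapSpace (φ : Δ ⟶ Δ') (V : Opens Δ'.space) (s : Δ'.space.sec V)
    (x : Δ.space) (hx : mapBase φ x ∈ V) :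
    Δ.system.value x hx ((mapSpace φ).app V s) =
      Pointed.map (φ.map.dualMap : _ →+ _) (Δ'.system.value (mapBase φ x) hx s) :=
  incl_conePull φ.map (map_coneOf φ x) _

theorem stalkToLattice_mapSpace (φ : Δ ⟶ Δ') (x : Δ.space) (t : Δ'.space.stalk (mapBase φ x)) :
    Δ.stalkToLattice x ((mapSpace φ).stalkMap x t) =
      latticePull φ.map (Δ'.stalkToLattice (mapBase φ x) t) := by
  obtain ⟨V, hV, s, rfl⟩ := Δ'.space.germ_exists _ t
  exact system_value_mapSpace φ V s x hV

theorem mapBase_of_isMinimalPoint (φ : Δ ⟶ Δ') {η : Δ.space} {η' : Δ'.space}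
    (h : IsMinimalPoint Δ.space η) (h' : IsMinimalPoint Δ'.space η') : mapBase φ η = η' := by
  refine h' _ (Δ'.system.specializes_iff.mpr ?_)
  refine smallest_le φ η η' ?_
  change (Δ.coneOf η).map _ ≤ _
  rw [coneOf_eq_bot h]
  rintro _ ⟨v, hv, rfl⟩
  have hv0 : v = 0 := (Submodule.mem_bot _).mp hv
  rw [hv0, map_zero]
  exact zero_mem _

/-- A morphism of fans is determined by its values on functionals, hence by the map that it induces
on generic stalks. -/
theorem mapSpace_injective {φ ψ : Δ ⟶ Δ'} (h : mapSpace φ = mapSpace ψ) : φ = ψ := by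
  obtain ⟨o, ho⟩ := Δ.exists_bot
  obtain ⟨o', ho'⟩ := Δ'.exists_bot
  have hmin : ∀ {Δ : Fan.{u}} {o : Δ.Pt}, o.cone = ⊥ → IsMinimalPoint Δ.space (Δ.system.pt o) :=
    fun {Δ o} ho y hy => le_antisymm (α := Δ.Pt) (Δ.system.specializes_iff.mp hy) (by
      change o.cone ≤ _
      rw [ho]
      exact bot_le)
  have hη := hmin ho
  have hb := mapBase_of_isMinimalPoint φ hη (hmin ho')
  refine Hom.ext (LinearMap.ext fun n => ?_)
  rw [← sub_eq_zero]
  refine (Module.forall_dual_apply_eq_zero_iff ℤ _).mp fun m => ?_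
  have hm : m ∈ Δ'.system.S (Δ'.system.idx (mapBase φ (Δ.system.pt o))) := by
    rw [hb]
    exact mem_system_of_isMinimalPoint (hmin ho') m
  obtain ⟨t, ht⟩ := Δ'.system.exists_ev (mapBase φ (Δ.system.pt o)) (Pointed.mem_of.mpr hm)
  obtain ⟨V, hV, s, rfl⟩ := Δ'.space.germ_exists _ t
  have hV' : mapBase ψ (Δ.system.pt o) ∈ V := by
    have : mapBase φ = mapBase ψ := congrArg (fun f : Δ.space ⟶ Δ'.space => f.base) h
    rwa [← this]
  have h1 := system_value_mapSpace φ V s (Δ.system.pt o) hV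
  have h2 := system_value_mapSpace ψ V s (Δ.system.pt o) hV'
  have h3 : Δ.system.value (Δ.system.pt o) hV ((mapSpace φ).app V s) =
      Δ.system.value (Δ.system.pt o) hV' ((mapSpace ψ).app V s) :=
    congrArg (Δ.system.ev (Δ.system.pt o)) (Hom.germ_app_congr h V s (Δ.system.pt o) hV hV')
  have hs : Δ'.system.value (mapBase φ (Δ.system.pt o)) hV s = Pointed.of m := ht
  have hs' : Δ'.system.value (mapBase ψ (Δ.system.pt o)) hV' s = Pointed.of m := by
    rw [← hs]
    refine Δ'.system.value_eq s hV hV' (le_of_eq ?_)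
    exact congrArg (fun f : Δ.space ⟶ Δ'.space => Δ'.system.idx (f.base (Δ.system.pt o))) h.symm
  rw [hs, Pointed.map_of] at h1
  rw [hs', Pointed.map_of] at h2
  have h4 := LinearMap.congr_fun (Pointed.of_injective (h1.symm.trans (h3.trans h2))) n
  have h5 : m (φ.map n) = m (ψ.map n) := h4
  rw [map_sub, h5, sub_self]

section Fullness

variable (f : Δ.space ⟶ Δ'.space) {η : Δ.space}

/-- A morphism that preserves the generic points comes from a morphism of fans, the dual of the map
on generic stalks. -/
theorem exists_mapSpace_eq (hη : IsMinimalPoint Δ.space η)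
    (hη' : IsMinimalPoint Δ'.space (f.base η)) : ∃ φ : Δ ⟶ Δ', mapSpace φ = f := by
  obtain ⟨g, hg⟩ := MonoidSystem.exists_pullback (𝒮 := Δ.system) (𝒯 := Δ'.system) f
    (coneOf_le_of_isMinimalPoint hη) (mem_system_of_isMinimalPoint hη')
  obtain ⟨φ, hφ⟩ : ∃ φ : Δ.N →ₗ[ℤ] Δ'.N, ∀ m, g m = m ∘ₗ φ := by
    refine ⟨(Module.evalEquiv ℤ Δ'.N).symm.toLinearMap ∘ₗ g.toIntLinearMap.dualMap ∘ₗ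
      Module.Dual.eval ℤ Δ.N, fun m => LinearMap.ext fun n => ?_⟩
    simp
  have hcone : ∀ x : Δ.space,
      (Δ.coneOf x).map (φ.baseChange ℝ) ≤ Δ'.coneOf (f.base x) := fun x => by
    rintro _ ⟨v, hv, rfl⟩
    refine (Δ'.isRational (Δ'.system.idx (f.base x))).mem_iff.mpr fun m hm => ?_
    have h1 := MonoidSystem.mem_of_pullback hg x hm v hv
    rw [hφ, realFunctional_comp] at h1
    exact h1
  let Φ : Δ ⟶ Δ' := ⟨φ, fun σ hσ => ⟨_, (Δ'.system.idx (f.base (Δ.system.pt ⟨σ, hσ⟩))).2,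
    hcone (Δ.system.pt ⟨σ, hσ⟩)⟩⟩
  have hb : ∀ x : Δ.space, mapBase Φ x = f.base x := fun x => by
    have hle : Δ'.system.idx (mapBase Φ x) ≤ Δ'.system.idx (f.base x) :=
      smallest_le Φ x (f.base x) (hcone x)
    refine le_antisymm (α := Δ'.Pt) hle ?_
    -- an equation of the face `mapBase Φ x` of `f x` pulls back to a unit at `x`
    obtain ⟨d, hd, hd', hk⟩ := Δ'.system_isLocalized.exists_denom hle
    have hneg := MonoidSystem.neg_mem_of_pullback hg x hd fun v hv => by
      have h1 := hd' _ (map_coneOf Φ x ⟨v, hv, rfl⟩)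
      rw [map_neg, LinearMap.neg_apply] at h1
      rw [hφ, map_neg, LinearMap.neg_apply, realFunctional_comp]
      exact h1
    refine (Δ'.isRational (Δ'.system.idx (mapBase Φ x))).le_of_dualMonoid_le fun a ha => ?_
    obtain ⟨k, hk⟩ := hk a ha
    have h2 := add_mem hk (nsmul_mem hneg k)
    rwa [smul_neg, add_neg_cancel_right] at h2
  refine ⟨Φ, MonoidSpace.Hom.ext_germ hb fun V s x hx hx' => Δ.system.ev_injective x ?_⟩
  have hx1 : mapBase Φ x ∈ V := hx
  refine (system_value_mapSpace Φ V s x hx1).trans (Eq.trans ?_ (hg V s x hx').symm)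
  have h1 : Δ'.system.value (mapBase Φ x) hx1 s = Δ'.system.value (f.base x) hx' s :=
    Δ'.system.value_eq s hx' hx1 (le_of_eq (congrArg Δ'.system.idx (hb x)))
  have hgφ : (Φ.map.dualMap : _ →+ _) = g := AddMonoidHom.ext fun m => (hφ m).symm
  exact (congrArg _ h1).trans (DFunLike.congr_fun (congrArg Pointed.map hgφ) _)

end Fullness

end Fan

end

end MonoidScheme

/-! ### The fan of a toric system -/

namespace MonoidScheme

noncomputable section

open MonoidSpace

namespace MonoidSystem

variable {P : Type u} [PartialOrder P] {M : Type u} [AddCommGroup M] {𝒮 : MonoidSystem P M}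

theorem IsLocalized.mem_dualCone_iff (h : 𝒮.IsLocalized) {q p : P} (hqp : q ≤ p) :
    ∃ d ∈ 𝒮.S p, -d ∈ 𝒮.S q ∧ ∀ v, v ∈ dualCone (𝒮.S q) ↔
      v ∈ dualCone (𝒮.S p) ∧ realFunctional (Module.Dual.eval ℤ M d) v = 0 := by
  obtain ⟨d, hd, hd', hk⟩ := h.exists_denom hqp
  refine ⟨d, hd, hd', fun v => ⟨fun hv => ?_, fun ⟨hv, h0⟩ => mem_dualCone.mpr fun a ha => ?_⟩⟩
  · have hvp := dualCone_anti (𝒮.anti hqp) hv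
    refine ⟨hvp, le_antisymm ?_ (mem_dualCone.mp hvp d hd)⟩
    have h1 := mem_dualCone.mp hv _ hd'
    rw [map_neg, map_neg, LinearMap.neg_apply] at h1
    linarith
  · obtain ⟨k, hk⟩ := hk a ha
    have h1 := mem_dualCone.mp hv _ hk
    rwa [map_add, map_add, LinearMap.add_apply, map_nsmul, map_nsmul, LinearMap.smul_apply, h0,
      smul_zero, add_zero] at h1

theorem IsLocalized.isFace_dualCone (h : 𝒮.IsLocalized) {q p : P} (hqp : q ≤ p) :
    IsFace (dualCone (𝒮.S q)) (dualCone (𝒮.S p)) := by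
  obtain ⟨d, hd, -, hv⟩ := h.mem_dualCone_iff hqp
  exact ⟨_, fun v hv => mem_dualCone.mp hv d hd, hv⟩

theorem inf_dualCone {p q r : P} (hrp : r ≤ p) (hrq : r ≤ q)
    (hr : ∀ c ∈ 𝒮.S r, ∃ a ∈ 𝒮.S p, ∃ b ∈ 𝒮.S q, a + b = c) :
    dualCone (𝒮.S p) ⊓ dualCone (𝒮.S q) = dualCone (𝒮.S r) := by
  refine le_antisymm (fun v hv => mem_dualCone.mpr fun c hc => ?_)
    (le_inf (dualCone_anti (𝒮.anti hrp)) (dualCone_anti (𝒮.anti hrq)))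
  obtain ⟨a, ha, b, hb, rfl⟩ := hr c hc
  rw [map_add, map_add, LinearMap.add_apply]
  exact add_nonneg (mem_dualCone.mp hv.1 a ha) (mem_dualCone.mp hv.2 b hb)

variable [Module.Free ℤ M]

theorem IsLocalized.dualCone_le_iff (h : 𝒮.IsLocalized) (h' : 𝒮.HasInfSum)
    (hfg : ∀ p, (𝒮.S p).FG) (hsat : ∀ p (m : M) (k : ℕ), 1 ≤ k → k • m ∈ 𝒮.S p → m ∈ 𝒮.S p)
    {p q : P} : dualCone (𝒮.S p) ≤ dualCone (𝒮.S q) ↔ p ≤ q := by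
  refine ⟨fun hle => ?_, fun hle => dualCone_anti (𝒮.anti hle)⟩
  have hS : 𝒮.S q ≤ 𝒮.S p := fun m hm =>
    (eval_mem_dualMonoid_dualCone (hfg p) (hsat p)).mp (dualMonoid_anti hle
      ((eval_mem_dualMonoid_dualCone (hfg q) (hsat q)).mpr hm))
  obtain ⟨r, hrp, hrq, -, hr⟩ := h' p q
  refine (h.le_of_le le_rfl hrp fun c hc => ?_).trans hrq
  obtain ⟨a, ha, b, hb, rfl⟩ := hr c hc
  exact add_mem ha (hS hb)

variable [Module.Finite ℤ M]

/-- A face of a cone of the system is the zero set of an element of `S_p`, and the elements of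
`S_p` that vanish on it form a face of `S_p`. -/
theorem IsLocalized.exists_dualCone_eq (h : 𝒮.IsLocalized) {p : P} (hfg : (𝒮.S p).FG)
    (hsat : ∀ (m : M) (k : ℕ), 1 ≤ k → k • m ∈ 𝒮.S p → m ∈ 𝒮.S p)
    {τ : PointedCone ℝ (ℝ ⊗[ℤ] Module.Dual ℤ M)} (hτ : IsFace τ (dualCone (𝒮.S p))) :
    ∃ q, dualCone (𝒮.S q) = τ := by
  obtain ⟨ℓ, hℓ, hface⟩ := hτ
  obtain ⟨μ, hμ, hμ0⟩ := (isRational_dualCone hfg).exists_dualMonoid_of_face hℓ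
  obtain ⟨m, rfl⟩ := (Module.evalEquiv ℤ M).surjective μ
  have hm : m ∈ 𝒮.S p := (eval_mem_dualMonoid_dualCone hfg hsat).mp hμ
  have hτ' : ∀ v, v ∈ τ ↔ v ∈ dualCone (𝒮.S p) ∧
      realFunctional (Module.Dual.eval ℤ M m) v = 0 := fun v =>
    (hface v).trans (and_congr_right fun hv => (hμ0 v hv).symm)
  let F : AddSubmonoid M :=
    { carrier := {a | a ∈ 𝒮.S p ∧ ∀ v ∈ τ, realFunctional (Module.Dual.eval ℤ M a) v = 0}
      zero_mem' := ⟨zero_mem _, fun v _ => by simp⟩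
      add_mem' := by
        rintro a b ⟨ha, ha'⟩ ⟨hb, hb'⟩
        refine ⟨add_mem ha hb, fun v hv => ?_⟩
        rw [map_add, map_add, LinearMap.add_apply, ha' v hv, hb' v hv, add_zero] }
  obtain ⟨q, hqp, hq⟩ := h.exists_face p F (fun a ha => ha.1) fun a ha b hb hab => by
    refine ⟨ha, fun v hv => ?_⟩
    have hvp := ((hτ' v).mp hv).1
    have h1 := hab.2 v hv
    rw [map_add, map_add, LinearMap.add_apply] at h1
    exact ((add_eq_zero_iff_of_nonneg (mem_dualCone.mp hvp a ha)
      (mem_dualCone.mp hvp b hb)).mp h1).1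
  obtain ⟨d, hd, hd', hdv⟩ := h.mem_dualCone_iff hqp
  have hdF : d ∈ F := (hq d hd).mpr hd'
  have hmF : m ∈ F := ⟨hm, fun v hv => ((hτ' v).mp hv).2⟩
  refine ⟨q, le_antisymm (fun v hv => ?_) fun v hv =>
    (hdv v).mpr ⟨((hτ' v).mp hv).1, hdF.2 v hv⟩⟩
  have hvp := ((hdv v).mp hv).1
  refine (hτ' v).mpr ⟨hvp, le_antisymm ?_ (mem_dualCone.mp hvp m hm)⟩
  have h1 := mem_dualCone.mp hv _ ((hq m hm).mp hmF)
  rw [map_neg, map_neg, LinearMap.neg_apply] at h1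
  linarith

/-- The fan of the dual cones of a localized system of saturated submonoids of full rank. -/
def IsLocalized.fan [Finite P] [Nonempty P] (h : 𝒮.IsLocalized) (h' : 𝒮.HasInfSum)
    (hfg : ∀ p, (𝒮.S p).FG) (hsat : ∀ p (m : M) (k : ℕ), 1 ≤ k → k • m ∈ 𝒮.S p → m ∈ 𝒮.S p)
    (hgen : ∀ p, ∀ m : M, ∃ a ∈ 𝒮.S p, ∃ b ∈ 𝒮.S p, m = a - b) : FanIn (Module.Dual ℤ M) where
  cones := Set.range fun p => dualCone (𝒮.S p)
  finite := Set.finite_range _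
  nonempty := Set.range_nonempty _
  isCone := by
    rintro _ ⟨p, rfl⟩
    exact isCone_dualCone (hfg p) (hgen p)
  face_mem := by
    rintro _ ⟨p, rfl⟩ τ hτ
    exact h.exists_dualCone_eq (hfg p) (hsat p) hτ
  inter_face := by
    rintro _ ⟨p, rfl⟩ _ ⟨q, rfl⟩
    obtain ⟨r, hrp, hrq, -, hr⟩ := h' p q
    have e : dualCone (𝒮.S p) ⊓ dualCone (𝒮.S q) = dualCone (𝒮.S r) := inf_dualCone hrp hrq hr
    change IsFace (dualCone (𝒮.S p) ⊓ dualCone (𝒮.S q)) (dualCone (𝒮.S p)) ∧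
      IsFace (dualCone (𝒮.S p) ⊓ dualCone (𝒮.S q)) (dualCone (𝒮.S q))
    rw [e]
    exact ⟨h.isFace_dualCone hrp, h.isFace_dualCone hrq⟩

end MonoidSystem

/-! ### The generic point of a toric monoid scheme -/

namespace Chart

variable {X : MonoidSpace.{u}} {U : Opens X} {A : Type u} [CommMonoidWithZero A] (c : Chart X U A)

include c in
theorem isCancelMulZero (hX : ∀ x : X, IsCancelMulZero (X.stalk x)) (hU : U ≠ ⊥) :
    IsCancelMulZero A := by
  obtain ⟨x, hx, -, hunit⟩ := c.eq_bot_or_exists_top.resolve_left hU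
  have := hX x
  refine Function.Injective.isCancelMulZero (fun a => X.germ x U hx (c.θ a)) (fun a b h => ?_)
    (by simp) (by simp)
  obtain ⟨s, hs, h'⟩ := c.exists_of_eq x hx a b h
  exact ((hunit s).mp hs).mul_left_cancel h'

include c in
theorem nontrivial {x : X} (hx : x ∈ U) : Nontrivial A :=
  ⟨0, 1, fun h => c.not_isUnit_zero x hx (by
    have : X.germ x U hx (c.θ 0) = X.germ x U hx (c.θ 1) := by rw [h]
    rw [map_zero, map_zero, map_one, map_one] at this
    rw [this]
    exact isUnit_one)⟩

theorem ne_zero_of_isUnit {x : X} (hx : x ∈ U) {a : A} (ha : IsUnit (X.germ x U hx (c.θ a))) :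
    a ≠ 0 := by
  rintro rfl
  rw [map_zero, map_zero] at ha
  exact c.not_isUnit_zero x hx ha

/-- The generic point of an affine chart, given by the prime ideal `0`. -/
theorem exists_generic (hX : ∀ x : X, IsCancelMulZero (X.stalk x)) {x : X} (hx : x ∈ U) :
    ∃ ξ ∈ U, (∀ y ∈ U, ξ ⤳ y) ∧
      ∀ (hξ : ξ ∈ U) (a : A), a ≠ 0 → IsUnit (X.germ ξ U hξ (c.θ a)) := by
  have := c.isCancelMulZero hX (fun h => by rw [h] at hx; exact hx.elim)
  have := c.nontrivial hx
  obtain ⟨ξ, hξ, h⟩ := c.exists_point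
    { carrier := {0}
      zero_mem := rfl
      mul_mem := fun a b hb => by
        rw [Set.mem_singleton_iff] at hb ⊢
        rw [hb, mul_zero]
      one_notMem := one_ne_zero
      prime := fun {a b} ha hb => mul_ne_zero ha hb }
  have h1 : ∀ a, a ≠ 0 → IsUnit (X.germ ξ U hξ (c.θ a)) := fun a ha => by
    by_contra hn
    exact ha ((h a).mpr hn)
  exact ⟨ξ, hξ, fun y hy => (c.specializes_iff hξ hy).mpr fun a ha =>
    h1 a (c.ne_zero_of_isUnit hy ha), fun _ => h1⟩

include c in
/-- Specialization maps between stalks are injective on an integral monoid scheme. -/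
theorem stalkSpec_injective (hX : ∀ x : X, IsCancelMulZero (X.stalk x)) {y x : X} (h : y ⤳ x)
    (hx : x ∈ U) : Function.Injective (X.stalkSpec h) := by
  intro s t e
  have := c.isCancelMulZero hX (fun h => by rw [h] at hx; exact hx.elim)
  have hy : y ∈ U := h.mem_open U.isOpen hx
  obtain ⟨a, u, hu, ha⟩ := c.exists_frac x hx s
  obtain ⟨b, v, hv, hb⟩ := c.exists_frac x hx t
  have h1 : X.germ y U hy (c.θ (a * v)) = X.germ y U hy (c.θ (b * u)) := by
    have h2 := congrArg (X.stalkSpec h) ha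
    have h3 := congrArg (X.stalkSpec h) hb
    rw [map_mul, X.stalkSpec_germ, X.stalkSpec_germ] at h2 h3
    rw [map_mul, map_mul, map_mul, map_mul, ← h2, ← h3, e, mul_right_comm]
  obtain ⟨w, hw, h2⟩ := c.exists_of_eq y hy _ _ h1
  have h3 := mul_left_cancel₀ (c.ne_zero_of_isUnit hy hw) h2
  have h4 := congrArg (fun a => X.germ x U hx (c.θ a)) h3
  simp only [map_mul] at h4
  rw [← ha, ← hb, mul_right_comm] at h4
  exact hv.mul_right_cancel (hu.mul_right_cancel h4)

end Chart

theorem IsFiniteType.exists_chart {X : MonoidSpace.{u}} (h : IsFiniteType X) (x : X) :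
    ∃ (U : Opens X) (_ : x ∈ U) (A : Type u) (_ : CommMonoidWithZero A),
      Monoid.FG A ∧ Nonempty (Chart X U A) := by
  obtain ⟨𝒰, -, hsup, h𝒰⟩ := h
  obtain ⟨U, hU, hxU⟩ := Opens.mem_sSup.mp (hsup ▸ Opens.mem_top x)
  obtain ⟨A, _, hA, ⟨i⟩⟩ := h𝒰 U hU
  exact ⟨U, hxU, A, _, hA, ⟨Chart.ofIso i⟩⟩

namespace IsToric

variable {X : MonoidSpace.{u}} (hX : IsToric X)

include hX

theorem isCancelMulZero (x : X) : IsCancelMulZero (X.stalk x) := (hX.normal x).1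

theorem eq_of_specializes {x y : X} (h : x ⤳ y) (h' : y ⤳ x) : x = y := by
  obtain ⟨U, hU, A, _, -, ⟨c⟩⟩ := hX.finiteType.exists_chart y
  have hx : x ∈ U := h.mem_open U.isOpen hU
  exact c.point_unique x y hx hU fun a =>
    ⟨(c.specializes_iff hU hx).mp h' a, (c.specializes_iff hx hU).mp h a⟩

/-- The generic points of the affine charts coincide, since their closures are open and closed. -/
theorem exists_generic : ∃ η : X, ∀ x, η ⤳ x := by
  have := hX.connected
  obtain ⟨x₀⟩ : Nonempty X := inferInstance
  obtain ⟨U, hU, A, _, -, ⟨c⟩⟩ := hX.finiteType.exists_chart x₀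
  obtain ⟨η, hηU, hη, -⟩ := c.exists_generic hX.isCancelMulZero hU
  have hopen : IsOpen (closure {η}) := isOpen_iff_mem_nhds.mpr fun x hx => by
    rw [← specializes_iff_mem_closure] at hx
    obtain ⟨V, hV, B, _, -, ⟨d⟩⟩ := hX.finiteType.exists_chart x
    obtain ⟨ξ, hξV, hξ, -⟩ := d.exists_generic hX.isCancelMulZero hV
    have h1 : ξ ⤳ η := hξ η (hx.mem_open V.isOpen hV)
    have h2 : η ⤳ ξ := hη ξ (h1.mem_open U.isOpen hηU)
    exact mem_nhds_iff.mpr ⟨V, fun y hy => specializes_iff_mem_closure.mp (h2.trans (hξ y hy)),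
      V.isOpen, hV⟩
  have huniv : closure {η} = Set.univ :=
    IsClopen.eq_univ ⟨isClosed_closure, hopen⟩ ⟨η, subset_closure rfl⟩
  exact ⟨η, fun x => specializes_iff_mem_closure.mpr (huniv ▸ Set.mem_univ x)⟩

theorem specializes_of_isMinimalPoint {η : X} (hη : X.IsMinimalPoint η) (x : X) : η ⤳ x := by
  obtain ⟨ξ, hξ⟩ := hX.exists_generic
  rw [← hη ξ (hξ η)]
  exact hξ x

theorem existsUnique_isMinimalPoint : ∃! η : X, X.IsMinimalPoint η := by
  obtain ⟨η, hη⟩ := hX.exists_generic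
  exact ⟨η, fun y hy => hX.eq_of_specializes hy (hη y), fun ξ hξ => (hξ η (hη ξ)).symm⟩

theorem stalkSpec_injective {y x : X} (h : y ⤳ x) : Function.Injective (X.stalkSpec h) := by
  obtain ⟨U, hU, A, _, -, ⟨c⟩⟩ := hX.finiteType.exists_chart x
  exact c.stalkSpec_injective hX.isCancelMulZero h hU

theorem not_isUnit_zero (x : X) : ¬ IsUnit (0 : X.stalk x) := by
  obtain ⟨U, hU, A, _, -, ⟨c⟩⟩ := hX.finiteType.exists_chart x
  exact c.not_isUnit_zero x hU

theorem ne_zero_iff_isUnit {η : X} (hη : ∀ x, η ⤳ x) (a : X.stalk η) : a ≠ 0 ↔ IsUnit a := by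
  refine ⟨fun ha => ?_, ?_⟩
  · obtain ⟨U, hU, A, _, -, ⟨c⟩⟩ := hX.finiteType.exists_chart η
    obtain ⟨ξ, hξU, hξ, hunit⟩ := c.exists_generic hX.isCancelMulZero hU
    obtain rfl : ξ = η := hX.eq_of_specializes (hξ η hU) (hη ξ)
    obtain ⟨b, s, hs, h⟩ := c.exists_frac _ hU a
    have hb : b ≠ 0 := by
      rintro rfl
      rw [map_zero, map_zero] at h
      exact ha (hs.mul_left_eq_zero.mp h)
    have h1 := hunit hU b hb
    rw [← h] at h1
    exact isUnit_of_mul_isUnit_left h1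
  · rintro h rfl
    exact hX.not_isUnit_zero η h

end IsToric

/-! ### The system of a toric monoid scheme -/

/-- The submonoid of `M_η` of the images of the nonzero elements of the stalk at `x`. Elements whose
image is a unit of the generic stalk are nonzero on a toric monoid scheme. -/
def stalkMonoid (X : MonoidSpace.{u}) {η : X} (hη : ∀ x : X, η ⤳ x) (x : X) :
    AddSubmonoid (GenericGroup X η) where
  carrier := {m | ∃ a : X.stalk x, X.stalkSpec (hη x) a = (m.toMul : X.stalk η)}
  zero_mem' := ⟨1, map_one _⟩
  add_mem' := by
    rintro m n ⟨a, ha⟩ ⟨b, hb⟩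
    exact ⟨a * b, by rw [map_mul, ha, hb]; rfl⟩

theorem stalkMonoid_anti (X : MonoidSpace.{u}) {η : X} (hη : ∀ x : X, η ⤳ x) {y x : X}
    (h : y ⤳ x) : stalkMonoid X hη x ≤ stalkMonoid X hη y := by
  rintro m ⟨a, ha⟩
  exact ⟨X.stalkSpec h a, by rw [X.stalkSpec_stalkSpec, ha]⟩

/-- The submonoids `S_y` of a group, for `y` in an open set, are described by a finite set `B` as
on the spectrum of the monoid generated by `B`: each `S_y` is a localization of this monoid, its
faces are given by points, and specialization is the inclusion of faces. -/
structure IsModel {X : MonoidSpace.{u}} {M : Type u} [AddCommGroup M] (S : X → AddSubmonoid M)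
    (U : Opens X) (B : Set M) : Prop where
  finite : B.Finite
  subset : ∀ y ∈ U, B ⊆ S y
  exists_sub : ∀ y ∈ U, ∀ a ∈ S y, ∃ b ∈ AddSubmonoid.closure B, ∃ s ∈ AddSubmonoid.closure B,
    -s ∈ S y ∧ a = b - s
  exists_face : ∀ F : AddSubmonoid M, F ≤ AddSubmonoid.closure B →
    (∀ a ∈ AddSubmonoid.closure B, ∀ b ∈ AddSubmonoid.closure B, a + b ∈ F → a ∈ F) →
    ∃ q ∈ U, ∀ a ∈ AddSubmonoid.closure B, a ∈ F ↔ -a ∈ S q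
  specializes_iff : ∀ y ∈ U, ∀ z ∈ U,
    y ⤳ z ↔ ∀ a ∈ AddSubmonoid.closure B, -a ∈ S z → -a ∈ S y

namespace IsModel

variable {X : MonoidSpace.{u}} {M : Type u} [AddCommGroup M] {S : X → AddSubmonoid M}
  {U : Opens X} {B : Set M} (h : IsModel S U B)

include h

theorem closure_le {y : X} (hy : y ∈ U) : AddSubmonoid.closure B ≤ S y :=
  AddSubmonoid.closure_le.mpr (h.subset y hy)

theorem fg {y : X} (hy : y ∈ U) : (S y).FG := by
  classical
  obtain ⟨T, hT⟩ : ∃ T : Finset M, (T : Set M) = B ∪ Neg.neg '' {b ∈ B | -b ∈ S y} := by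
    have : (B ∪ Neg.neg '' {b ∈ B | -b ∈ S y}).Finite :=
      h.finite.union ((h.finite.subset fun b hb => hb.1).image _)
    exact ⟨this.toFinset, this.coe_toFinset⟩
  refine ⟨T, le_antisymm (AddSubmonoid.closure_le.mpr ?_) fun a ha => ?_⟩
  · rw [hT]
    rintro b (hb | ⟨b, hb, rfl⟩)
    · exact h.subset y hy hb
    · exact hb.2
  · obtain ⟨b, hb, s, hs, hs', rfl⟩ := h.exists_sub y hy a ha
    have h1 : b ∈ AddSubmonoid.closure (T : Set M) :=
      AddSubmonoid.closure_mono (hT ▸ Set.subset_union_left) hb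
    have h2 : ∀ s ∈ AddSubmonoid.closure B, -s ∈ S y →
        -s ∈ AddSubmonoid.closure (T : Set M) := by
      intro s hs
      induction hs using AddSubmonoid.closure_induction with
      | mem x hx =>
        intro hx'
        exact AddSubmonoid.subset_closure (hT ▸ Or.inr ⟨x, ⟨hx, hx'⟩, rfl⟩)
      | zero => simp
      | add x z hx hz ihx ihz =>
        intro hxz
        rw [neg_add] at hxz ⊢
        refine add_mem (ihx ?_) (ihz ?_)
        · have := add_mem hxz (h.closure_le hy hz)
          rwa [neg_add_cancel_right] at this
        · have := add_mem (h.closure_le hy hx) hxz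
          rwa [add_neg_cancel_left] at this
    rw [sub_eq_add_neg]
    exact add_mem h1 (h2 s hs hs')

theorem exists_denom {q p : X} (hq : q ∈ U) (hp : p ∈ U) :
    ∃ m ∈ S p, -m ∈ S q ∧ ∀ a ∈ S q, ∃ k : ℕ, a + k • m ∈ S p := by
  classical
  obtain ⟨T, hT⟩ : ∃ T : Finset M, (T : Set M) = {b ∈ B | -b ∈ S q} :=
    ⟨_, (h.finite.subset fun b hb => hb.1).coe_toFinset⟩
  have hTB : ∀ b ∈ T, b ∈ B ∧ -b ∈ S q := fun b hb => by
    have : b ∈ (T : Set M) := hb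
    rwa [hT] at this
  have hd : ∑ b ∈ T, b ∈ AddSubmonoid.closure B :=
    sum_mem fun b hb => AddSubmonoid.subset_closure (hTB b hb).1
  refine ⟨∑ b ∈ T, b, h.closure_le hp hd, ?_, fun a ha => ?_⟩
  · rw [← Finset.sum_neg_distrib]
    exact sum_mem fun b hb => (hTB b hb).2
  · obtain ⟨b, hb, s, hs, hs', rfl⟩ := h.exists_sub q hq a ha
    have h2 : ∀ s ∈ AddSubmonoid.closure B, -s ∈ S q →
        ∃ k : ℕ, k • (∑ b ∈ T, b) - s ∈ AddSubmonoid.closure B := by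
      intro s hs
      induction hs using AddSubmonoid.closure_induction with
      | mem x hx =>
        intro hx'
        have hxT : x ∈ T := by
          rw [← Finset.mem_coe, hT]
          exact ⟨hx, hx'⟩
        refine ⟨1, ?_⟩
        rw [one_smul, ← Finset.add_sum_erase T _ hxT, add_sub_cancel_left]
        exact sum_mem fun b hb => AddSubmonoid.subset_closure (hTB b (Finset.mem_of_mem_erase hb)).1
      | zero => exact fun _ => ⟨0, by simp⟩
      | add x z hx hz ihx ihz =>
        intro hxz
        rw [neg_add] at hxz
        obtain ⟨k, hk⟩ := ihx (by
          have := add_mem hxz (h.closure_le hq hz)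
          rwa [neg_add_cancel_right] at this)
        obtain ⟨l, hl⟩ := ihz (by
          have := add_mem (h.closure_le hq hx) hxz
          rwa [add_neg_cancel_left] at this)
        refine ⟨k + l, ?_⟩
        have := add_mem hk hl
        rwa [sub_add_sub_comm, ← add_smul] at this
    obtain ⟨k, hk⟩ := h2 s hs hs'
    refine ⟨k, h.closure_le hp ?_⟩
    have := add_mem hb hk
    rwa [← add_sub_assoc, add_sub_right_comm] at this

theorem exists_point_of_face {p : X} (hp : p ∈ U) (hanti : ∀ y z : X, y ⤳ z → S z ≤ S y)
    (F : AddSubmonoid M) (hface : ∀ a ∈ S p, ∀ b ∈ S p, a + b ∈ F → a ∈ F) :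
    ∃ q, q ⤳ p ∧ ∀ a ∈ S p, a ∈ F ↔ -a ∈ S q := by
  obtain ⟨q, hqU, hq⟩ := h.exists_face (F ⊓ AddSubmonoid.closure B) inf_le_right
    fun a ha b hb hab => ⟨hface a (h.closure_le hp ha) b (h.closure_le hp hb) hab.1, ha⟩
  have hinv : ∀ a ∈ S p, -a ∈ S p → a ∈ F := fun a ha ha' =>
    hface a ha _ ha' (by rw [add_neg_cancel]; exact zero_mem _)
  have hqp : q ⤳ p := (h.specializes_iff q hqU p hp).mpr fun a ha ha' =>
    (hq a ha).mp ⟨hinv a (h.closure_le hp ha) ha', ha⟩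
  refine ⟨q, hqp, fun a ha => ?_⟩
  obtain ⟨b, hb, s, hs, hs', rfl⟩ := h.exists_sub p hp a ha
  have hsp := h.closure_le hp hs
  have hsF : s ∈ F := hinv s hsp hs'
  have hsF' : -s ∈ F := hinv (-s) hs' (by rwa [neg_neg])
  have h1 : b - s ∈ F ↔ b ∈ F := by
    constructor
    · intro h2
      have := add_mem h2 hsF
      rwa [sub_add_cancel] at this
    · intro h2
      rw [sub_eq_add_neg]
      exact add_mem h2 hsF'
  have h2 : -(b - s) ∈ S q ↔ -b ∈ S q := by
    constructor
    · intro h2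
      have := add_mem h2 (hanti q p hqp hs')
      rwa [neg_sub, sub_eq_add_neg, add_assoc, add_comm s, add_assoc, neg_add_cancel,
        add_zero] at this
    · intro h2
      have := add_mem h2 (hanti q p hqp hsp)
      rwa [neg_sub, sub_eq_add_neg, add_comm]
  rw [h1, h2, ← hq b hb]
  exact ⟨fun h => ⟨h, hb⟩, fun h => h.1⟩

theorem finite_points (hT0 : ∀ x y : X, x ⤳ y → y ⤳ x → x = y) : (U : Set X).Finite := by
  have key : ∀ y ∈ U, ∀ z ∈ U, {b ∈ B | -b ∈ S z} ⊆ {b ∈ B | -b ∈ S y} → y ⤳ z := by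
    intro y hy z hz hsub
    refine (h.specializes_iff y hy z hz).mpr fun a ha => ?_
    induction ha using AddSubmonoid.closure_induction with
    | mem x hx => exact fun hx' => (hsub ⟨hx, hx'⟩).2
    | zero => simp
    | add a b ha hb iha ihb =>
      intro hab
      rw [neg_add] at hab ⊢
      refine add_mem (iha ?_) (ihb ?_)
      · have := add_mem hab (h.closure_le hz hb)
        rwa [neg_add_cancel_right] at this
      · have := add_mem (h.closure_le hz ha) hab
        rwa [add_neg_cancel_left] at this
  refine Set.Finite.of_injOn (f := fun y => {b ∈ B | -b ∈ S y}) (t := 𝒫 B)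
    (fun y _ b hb => hb.1) (fun y hy z hz e => ?_) h.finite.powerset
  exact hT0 y z (key y hy z hz e.symm.subset) (key z hz y hy e.subset)

end IsModel

section Model

variable {X : MonoidSpace.{u}} {M : Type u} [AddCommGroup M] {S : X → AddSubmonoid M}
  {e : ∀ x : X, X.stalk x →*₀ Pointed M} (he : ∀ x, Function.Injective (e x))
  (hmem : ∀ x t, Pointed.Mem (S x) t ↔ ∃ a, e x a = t)

include he hmem

/-- An affine chart with a finitely generated monoid of sections is a model for the stalks. -/
theorem Chart.exists_isModel {U : Opens X} {A : Type u} [CommMonoidWithZero A] (c : Chart X U A)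
    (hA : Monoid.FG A) {η : X} (hη : ∀ x, η ⤳ x) (hηU : η ∈ U)
    (hspec : ∀ x (t : X.stalk x), e η (X.stalkSpec (hη x) t) = e x t) :
    ∃ B : Set M, IsModel S U B := by
  obtain ⟨T, hT⟩ := hA.fg_top
  let α : A →*₀ Pointed M := (e η).comp ((X.germ η U hηU).comp c.θ)
  have hα : ∀ y (hy : y ∈ U) a, e y (X.germ y U hy (c.θ a)) = α a := fun y hy a => by
    rw [← hspec, X.stalkSpec_germ]
    rfl
  have hαS : ∀ y ∈ U, ∀ a m, α a = Pointed.of m → m ∈ S y := fun y hy a m h =>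
    Pointed.mem_of.mp ((hmem y _).mpr ⟨_, (hα y hy a).trans h⟩)
  have hunit : ∀ y (hy : y ∈ U) a, IsUnit (X.germ y U hy (c.θ a)) ↔
      ∃ m, α a = Pointed.of m ∧ -m ∈ S y := fun y hy a => by
    rw [isUnit_iff_neg_mem he hmem, hα]
  obtain ⟨B, hB⟩ : ∃ B : Set M, B = {m | ∃ t ∈ T, α t = Pointed.of m} := ⟨_, rfl⟩
  -- the monoid generated by `B` consists of the images of the nonzero elements of `A`
  have hcl : ∀ m, m ∈ AddSubmonoid.closure B ↔ ∃ a, α a = Pointed.of m := fun m => by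
    constructor
    · intro hm
      induction hm using AddSubmonoid.closure_induction with
      | mem x hx =>
        rw [hB] at hx
        obtain ⟨t, -, ht⟩ := hx
        exact ⟨t, ht⟩
      | zero => exact ⟨1, map_one _⟩
      | add x y _ _ hx hy =>
        obtain ⟨a, ha⟩ := hx
        obtain ⟨b, hb⟩ := hy
        exact ⟨a * b, by rw [map_mul, ha, hb, Pointed.of_add]⟩
    · rintro ⟨a, ha⟩
      have h1 : ∀ a ∈ Submonoid.closure (T : Set A), ∀ m, α a = Pointed.of m →
          m ∈ AddSubmonoid.closure B := fun a ha => by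
        induction ha using Submonoid.closure_induction with
        | mem x hx =>
          intro m hm
          exact AddSubmonoid.subset_closure (hB ▸ ⟨x, hx, hm⟩)
        | one =>
          intro m hm
          rw [map_one, ← Pointed.of_zero] at hm
          rw [← Pointed.of_injective hm]
          exact zero_mem _
        | mul x y _ _ hx hy =>
          intro m hm
          rw [map_mul] at hm
          rcases Pointed.eq_zero_or_of (α x) with h2 | ⟨k, h2⟩
          · rw [h2, zero_mul] at hm
            exact absurd hm.symm (Pointed.of_ne_zero m)
          rcases Pointed.eq_zero_or_of (α y) with h3 | ⟨l, h3⟩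
          · rw [h3, mul_zero] at hm
            exact absurd hm.symm (Pointed.of_ne_zero m)
          rw [h2, h3, ← Pointed.of_add] at hm
          rw [← Pointed.of_injective hm]
          exact add_mem (hx k h2) (hy l h3)
      exact h1 a (hT ▸ Submonoid.mem_top a) m ha
  refine ⟨B, ?_, fun y hy m hm => ?_, fun y hy a ha => ?_, fun F hF hface => ?_,
    fun y hy z hz => ?_⟩
  · rw [hB]
    refine ((T.finite_toSet.image α).preimage Pointed.of_injective.injOn).subset ?_
    rintro m ⟨t, ht, h⟩
    exact ⟨t, ht, h⟩
  · rw [hB] at hm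
    obtain ⟨t, -, h⟩ := hm
    exact hαS y hy t m h
  · obtain ⟨x, hx⟩ := (hmem y _).mp (Pointed.mem_of.mpr ha)
    obtain ⟨b, s, hs, h⟩ := c.exists_frac y hy x
    obtain ⟨n, hn, hn'⟩ := (hunit y hy s).mp hs
    have h1 := congrArg (e y) h
    rw [map_mul, hx, hα, hα, hn, ← Pointed.of_add] at h1
    exact ⟨a + n, (hcl _).mpr ⟨b, h1.symm⟩, n, (hcl _).mpr ⟨s, hn⟩, hn', by simp⟩
  · obtain ⟨q, hq, H⟩ := c.exists_point
      { carrier := {a | ¬ ∃ m ∈ F, α a = Pointed.of m}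
        zero_mem := by
          rintro ⟨m, -, h⟩
          rw [map_zero] at h
          exact Pointed.of_ne_zero m h.symm
        mul_mem := by
          rintro a b hb ⟨m, hm, h⟩
          refine hb ?_
          rw [map_mul] at h
          rcases Pointed.eq_zero_or_of (α a) with h2 | ⟨k, h2⟩
          · rw [h2, zero_mul] at h
            exact absurd h.symm (Pointed.of_ne_zero m)
          rcases Pointed.eq_zero_or_of (α b) with h3 | ⟨l, h3⟩
          · rw [h3, mul_zero] at h
            exact absurd h.symm (Pointed.of_ne_zero m)
          rw [h2, h3, ← Pointed.of_add] at h
          refine ⟨l, hface l ((hcl l).mpr ⟨b, h3⟩) k ((hcl k).mpr ⟨a, h2⟩) ?_, h3⟩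
          rwa [add_comm, Pointed.of_injective h]
        one_notMem := fun h => h ⟨0, zero_mem _, map_one _⟩
        prime := by
          intro a b ha hb h
          obtain ⟨m, hm, h1⟩ := not_not.mp ha
          obtain ⟨n, hn, h2⟩ := not_not.mp hb
          exact h ⟨m + n, add_mem hm hn, by rw [map_mul, h1, h2, Pointed.of_add]⟩ }
    refine ⟨q, hq, fun m hm => ?_⟩
    obtain ⟨a, ha⟩ := (hcl m).mp hm
    have h1 : (∃ m ∈ F, α a = Pointed.of m) ↔ IsUnit (X.germ q U hq (c.θ a)) :=
      not_iff_not.mp (H a)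
    rw [hunit, ha] at h1
    constructor
    · intro h2
      obtain ⟨n, hn, hn'⟩ := h1.mp ⟨m, h2, rfl⟩
      rwa [Pointed.of_injective hn]
    · intro h2
      obtain ⟨n, hn, hn'⟩ := h1.mpr ⟨m, rfl, h2⟩
      rwa [Pointed.of_injective hn']
  · rw [c.specializes_iff hy hz]
    constructor
    · intro H m hm hm'
      obtain ⟨a, ha⟩ := (hcl m).mp hm
      obtain ⟨n, hn, hn'⟩ := (hunit y hy a).mp (H a ((hunit z hz a).mpr ⟨m, ha, hm'⟩))
      rwa [Pointed.of_injective (ha.symm.trans hn)]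
    · intro H a ha
      obtain ⟨m, hm, hm'⟩ := (hunit z hz a).mp ha
      exact (hunit y hy a).mpr ⟨m, hm, H m ((hcl m).mpr ⟨a, hm⟩) hm'⟩

end Model

end

end MonoidScheme

/-! ### The fan of a toric monoid scheme -/

namespace MonoidScheme

noncomputable section

open MonoidSpace

/-- The cone `σ_x` is the dual cone of the submonoid of `M_η` given by the stalk at `x`. -/
theorem stalkCone_eq (X : MonoidSpace.{u}) {η : X} (hη : ∀ x : X, η ⤳ x)
    (h0 : ∀ x (a : X.stalk x), IsUnit (X.stalkSpec (hη x) a) → a ≠ 0) (x : X) :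
    stalkCone X hη x = dualCone (stalkMonoid X hη x) := by
  have : stalkSet X hη x =
      (fun m : GenericGroup X η => (1 : ℝ) ⊗ₜ[ℤ] m) '' (stalkMonoid X hη x : Set _) := by
    ext v
    constructor
    · rintro ⟨m, ⟨a, -, ha⟩, rfl⟩
      exact ⟨m, ⟨a, ha⟩, rfl⟩
    · rintro ⟨m, ⟨a, ha⟩, rfl⟩
      exact ⟨m, ⟨a, h0 x a (ha ▸ Units.isUnit _), ha⟩, rfl⟩
  rw [stalkCone, this]
  rfl

/-- A pointed monoid `A` in which the nonzero elements are the units is identified with the pointed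
monoid of its group of units. -/
theorem exists_units_eval {A : Type u} [CommMonoidWithZero A] (hA : ∀ a : A, a ≠ 0 ↔ IsUnit a) :
    ∃ ε : A →*₀ Pointed (Additive Aˣ), Function.Injective ε ∧
      ∀ m : Additive Aˣ, ε (m.toMul : A) = Pointed.of m := by
  classical
  let f : A → Pointed (Additive Aˣ) := fun a =>
    if h : IsUnit a then Pointed.of (Additive.ofMul h.unit) else 0
  have hf : ∀ u : Aˣ, f u = Pointed.of (Additive.ofMul u) := fun u => by
    have h : IsUnit (u : A) := u.isUnit
    simp [f]
  have hf0 : f 0 = 0 := dif_neg fun h => (hA 0).mpr h rfl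
  have hcases : ∀ a : A, a = 0 ∨ ∃ u : Aˣ, (u : A) = a := fun a =>
    or_iff_not_imp_left.mpr fun h => (hA a).mp h
  refine ⟨⟨⟨f, hf0⟩, ?_, fun a b => ?_⟩, fun a b h => ?_, fun m => hf m.toMul⟩
  · exact (congrArg f Units.val_one.symm).trans (hf 1)
  · change f (a * b) = f a * f b
    rcases hcases a with rfl | ⟨u, rfl⟩
    · rw [zero_mul, hf0, zero_mul]
    rcases hcases b with rfl | ⟨v, rfl⟩
    · rw [mul_zero, hf0, mul_zero]
    rw [← Units.val_mul, hf, hf, hf, ofMul_mul, Pointed.of_add]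
  · change f a = f b at h
    rcases hcases a with rfl | ⟨u, rfl⟩ <;> rcases hcases b with rfl | ⟨v, rfl⟩
    · rfl
    · rw [hf0, hf] at h
      exact absurd h.symm (Pointed.of_ne_zero _)
    · rw [hf0, hf] at h
      exact absurd h (Pointed.of_ne_zero _)
    · rw [hf, hf] at h
      rw [Additive.ofMul.injective (Pointed.of_injective h)]

namespace IsToric

variable {X : MonoidSpace.{u}} (hX : IsToric X)

/-- The points of a toric monoid scheme, ordered by specialization. -/
@[nolint unusedArguments]
def Points (_ : IsToric X) : Type u := X

instance : PartialOrder hX.Points where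
  le x y := (show X from x) ⤳ (show X from y)
  le_refl _ := specializes_rfl
  le_trans _ _ _ h h' := h.trans h'
  le_antisymm _ _ h h' := hX.eq_of_specializes h h'

variable {η : X} (hη : ∀ x, η ⤳ x)

/-- The system of the submonoids of `M_η` given by the stalks. -/
def system : MonoidSystem hX.Points (GenericGroup X η) where
  S x := stalkMonoid X hη x
  anti h := stalkMonoid_anti X hη h

include hX

/-- All stalks embed compatibly into the pointed monoid of `M_η`. -/
theorem exists_eval : ∃ e : ∀ x : X, X.stalk x →*₀ Pointed (GenericGroup X η),
    (∀ x, Function.Injective (e x)) ∧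
    (∀ x t, Pointed.Mem (stalkMonoid X hη x) t ↔ ∃ a, e x a = t) ∧
    (∀ (y x : X) (h : y ⤳ x) (t : X.stalk x), e y (X.stalkSpec h t) = e x t) ∧
    ∀ m : GenericGroup X η, e η (m.toMul : X.stalk η) = Pointed.of m := by
  obtain ⟨ε, hε, hε'⟩ := exists_units_eval (hX.ne_zero_iff_isUnit hη)
  refine ⟨fun x => ε.comp (X.stalkSpec (hη x)),
    fun x => hε.comp (hX.stalkSpec_injective (hη x)), fun x t => ⟨?_, ?_⟩, fun y x h t => ?_,
    fun m => ?_⟩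
  · rintro (rfl | ⟨m, ⟨a, ha⟩, rfl⟩)
    · exact ⟨0, map_zero _⟩
    · refine ⟨a, ?_⟩
      rw [MonoidWithZeroHom.comp_apply, ha, hε']
  · rintro ⟨a, rfl⟩
    rw [MonoidWithZeroHom.comp_apply]
    by_cases h0 : X.stalkSpec (hη x) a = 0
    · exact Or.inl (by rw [h0, map_zero])
    · obtain ⟨u, hu⟩ := (hX.ne_zero_iff_isUnit hη _).mp h0
      refine Or.inr ⟨Additive.ofMul u, ⟨a, hu.symm⟩, ?_⟩
      rw [← hu]
      exact hε' (Additive.ofMul u)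
  · rw [MonoidWithZeroHom.comp_apply, MonoidWithZeroHom.comp_apply, X.stalkSpec_stalkSpec]
  · rw [MonoidWithZeroHom.comp_apply, X.stalkSpec_refl, hε']

theorem exists_isModel (x : X) :
    ∃ U : Opens X, x ∈ U ∧ ∃ B, IsModel (stalkMonoid X hη) U B := by
  obtain ⟨e, he, hmem, hspec, -⟩ := hX.exists_eval hη
  obtain ⟨U, hU, A, _, hA, ⟨c⟩⟩ := hX.finiteType.exists_chart x
  exact ⟨U, hU, c.exists_isModel he hmem hA hη ((hη x).mem_open U.isOpen hU)
    fun y t => hspec η y (hη y) t⟩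

theorem finite : Finite X := by
  obtain ⟨η, hη⟩ := hX.exists_generic
  obtain ⟨e, he, hmem, hspec, -⟩ := hX.exists_eval hη
  obtain ⟨𝒰, hfin, hsup, h𝒰⟩ := hX.finiteType
  have hcover : (Set.univ : Set X) ⊆ ⋃ U ∈ 𝒰, (U : Set X) := fun x _ => by
    obtain ⟨U, hU, hxU⟩ := Opens.mem_sSup.mp (hsup ▸ Opens.mem_top x)
    exact Set.mem_biUnion hU hxU
  refine Set.finite_univ_iff.mp ((hfin.biUnion fun U hU => ?_).subset hcover)
  rcases (U : Set X).eq_empty_or_nonempty with h | ⟨x, hx⟩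
  · rw [h]
    exact Set.finite_empty
  · obtain ⟨A, _, hA, ⟨i⟩⟩ := h𝒰 U hU
    obtain ⟨B, hB⟩ := (Chart.ofIso i).exists_isModel he hmem hA hη
      ((hη x).mem_open U.isOpen hx) fun y t => hspec η y (hη y) t
    exact hB.finite_points fun x y => hX.eq_of_specializes

theorem fg_stalkMonoid (x : X) : (stalkMonoid X hη x).FG := by
  obtain ⟨U, hU, B, hB⟩ := hX.exists_isModel hη x
  exact hB.fg hU

omit hX in
theorem mem_stalkMonoid_generic (m : GenericGroup X η) : m ∈ stalkMonoid X hη η :=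
  ⟨m.toMul, X.stalkSpec_refl _ _⟩

theorem exists_sub (x : X) (m : GenericGroup X η) :
    ∃ a ∈ stalkMonoid X hη x, ∃ b ∈ stalkMonoid X hη x, m = a - b := by
  obtain ⟨U, hU, B, hB⟩ := hX.exists_isModel hη x
  obtain ⟨a, ha, b, hb, -, h⟩ := hB.exists_sub η ((hη x).mem_open U.isOpen hU) m
    (mem_stalkMonoid_generic hη m)
  exact ⟨a, hB.closure_le hU ha, b, hB.closure_le hU hb, h⟩

/-- The submonoids of `M_η` given by the stalks are saturated, by normality. -/
theorem mem_stalkMonoid_of_nsmul (x : X) (m : GenericGroup X η) (k : ℕ) (hk : 1 ≤ k)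
    (h : k • m ∈ stalkMonoid X hη x) : m ∈ stalkMonoid X hη x := by
  have := hX.isCancelMulZero x
  obtain ⟨e, he, hmem, -, -⟩ := hX.exists_eval hη
  obtain ⟨p, hp, q, hq, rfl⟩ := hX.exists_sub hη x m
  obtain ⟨a, ha⟩ := (hmem x _).mp (Pointed.mem_of.mpr hp)
  obtain ⟨s, hs⟩ := (hmem x _).mp (Pointed.mem_of.mpr hq)
  obtain ⟨c, hc⟩ := (hmem x _).mp (Pointed.mem_of.mpr h)
  have hs0 : s ≠ 0 := by
    rintro rfl
    rw [map_zero] at hs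
    exact Pointed.of_ne_zero q hs.symm
  have : Nontrivial (X.stalk x) := ⟨0, 1, fun h => hX.not_isUnit_zero x (h ▸ isUnit_one)⟩
  have hsn : s ∈ nonZeroDivisors (X.stalk x) := mem_nonZeroDivisors_of_ne_zero hs0
  have h1 : a ^ k = s ^ k * c := he x (by
    rw [map_mul, map_pow, map_pow, ha, hs, hc, ← Pointed.of_nsmul, ← Pointed.of_nsmul,
      ← Pointed.of_add, smul_sub, add_sub_cancel])
  obtain ⟨d, hd⟩ := (hX.normal x).2 (Localization.mk a ⟨s, hsn⟩) ⟨k, hk, c, by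
    rw [Localization.mk_pow, Localization.mk_eq_mk_iff, Localization.r_iff_exists]
    exact ⟨1, by simp [h1]⟩⟩
  rw [Localization.mk_eq_mk_iff, Localization.r_iff_exists] at hd
  obtain ⟨z, hz⟩ := hd
  have h2 := mul_left_cancel₀ (nonZeroDivisors.ne_zero z.2) hz
  have h3 : a = s * d := by simpa using h2
  refine Pointed.mem_of.mp ((hmem x _).mpr ⟨d, ?_⟩)
  have h4 := congrArg (e x) h3
  rw [map_mul, ha, hs] at h4
  rcases Pointed.eq_zero_or_of (e x d) with h5 | ⟨n, h5⟩
  · rw [h5, mul_zero] at h4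
    exact absurd h4 (Pointed.of_ne_zero p)
  · rw [h5, ← Pointed.of_add] at h4
    rw [h5, Pointed.of_injective h4, add_sub_cancel_left]

include hη in
theorem finite_genericGroup : Module.Finite ℤ (GenericGroup X η) := by
  have h1 : stalkMonoid X hη η = ⊤ := eq_top_iff.mpr fun m _ => mem_stalkMonoid_generic hη m
  have h2 : AddMonoid.FG (GenericGroup X η) := ⟨h1 ▸ hX.fg_stalkMonoid hη η⟩
  exact Module.Finite.iff_addGroup_fg.mpr (AddGroup.fg_iff_addMonoid_fg.mpr h2)

include hη in
theorem free_genericGroup : Module.Free ℤ (GenericGroup X η) := by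
  have := hX.finite_genericGroup hη
  have h1 := hX.torsionfree η
  have h2 : IsAddTorsionFree (GenericGroup X η) := ⟨fun n hn a b h => by
    have h3 : ((a.toMul ^ n : (X.stalk η)ˣ) : X.stalk η) = (b.toMul ^ n : (X.stalk η)ˣ) :=
      congrArg (fun m : GenericGroup X η => (m.toMul : X.stalk η)) h
    rw [Units.val_pow_eq_pow_val, Units.val_pow_eq_pow_val] at h3
    exact Additive.toMul.injective (Units.ext (pow_left_injective hn h3))⟩
  have := Module.isTorsionFree_int_iff_isAddTorsionFree.mpr h2
  infer_instance

theorem system_isLocalized : (hX.system hη).IsLocalized where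
  exists_denom {q p} hqp := by
    obtain ⟨U, hU, B, hB⟩ := hX.exists_isModel hη p
    exact hB.exists_denom (Specializes.mem_open hqp U.isOpen hU) hU
  exists_face p F _ hface := by
    obtain ⟨U, hU, B, hB⟩ := hX.exists_isModel hη p
    exact hB.exists_point_of_face hU (fun y z h => stalkMonoid_anti X hη h) F hface
  le_of_le {q q' p} hq hq' h := by
    obtain ⟨U, hU, B, hB⟩ := hX.exists_isModel hη p
    exact (hB.specializes_iff q (Specializes.mem_open hq U.isOpen hU) q'
      (Specializes.mem_open hq' U.isOpen hU)).mpr fun a _ ha => h ha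

theorem system_hasInfSum : (hX.system hη).HasInfSum := by
  obtain ⟨e, he, hmem, hspec, -⟩ := hX.exists_eval hη
  have := hX.finite
  obtain ⟨i, -⟩ := (hX.system hη).exists_iso X (fun x => x) Function.bijective_id
    (fun x y => Iff.rfl) (fun x => ⟨⟨nhdsKer {x}, isOpen_nhdsKer⟩, subset_nhdsKer rfl,
      fun y hy => mem_nhdsKer_singleton.mp hy⟩) e he hmem hspec
  exact (hX.system_isLocalized hη).hasInfSum (fun p q => ⟨η, hη p, hη q⟩) i hX.isSeparated

/-- The fan of a toric monoid scheme, and the isomorphism with the space of this fan. -/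
theorem exists_fan : ∃ (_ : Module.Free ℤ (GenericLattice X η))
    (_ : Module.Finite ℤ (GenericLattice X η)) (Δ : FanIn (GenericLattice X η))
    (e : X ≅ Fan.functor.obj ⟨GenericLattice X η, Δ⟩),
    Δ.cones = Set.range (stalkCone X hη) ∧
    (∀ x y : X, x ⤳ y ↔ stalkCone X hη x ≤ stalkCone X hη y) ∧
    (∀ x : X, Fan.coneOf ⟨GenericLattice X η, Δ⟩ (e.hom.base x) = stalkCone X hη x) ∧
    (∀ t (m : Module.Dual ℤ (GenericLattice X η)),
      Fan.stalkToLattice ⟨GenericLattice X η, Δ⟩ (e.hom.base η) t =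
        (Multiplicative.ofAdd m : Multiplicative _) →
      ∃ a : GenericGroup X η, e.hom.stalkMap η t = (a.toMul : X.stalk η) ∧
        ∀ n : GenericLattice X η, m n = n a) := by
  have hfin := hX.finite_genericGroup hη
  have hfree := hX.free_genericGroup hη
  have hX' : Finite X := hX.finite
  have hP : Finite hX.Points := hX'
  have hne : Nonempty hX.Points := ⟨η⟩
  have hcone : stalkCone X hη = fun x => dualCone (stalkMonoid X hη x) :=
    funext (stalkCone_eq X hη fun x a ha h0 => by
      rw [h0, map_zero] at ha
      exact hX.not_isUnit_zero η ha)
  have hfg : ∀ x, ((hX.system hη).S x).FG := hX.fg_stalkMonoid hη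
  have hsat : ∀ x (m : GenericGroup X η) (k : ℕ), 1 ≤ k → k • m ∈ (hX.system hη).S x →
    m ∈ (hX.system hη).S x := hX.mem_stalkMonoid_of_nsmul hη
  let Δ : FanIn (GenericLattice X η) :=
    (hX.system_isLocalized hη).fan (hX.system_hasInfSum hη) hfg hsat (hX.exists_sub hη)
  have hle : ∀ x y : X, x ⤳ y ↔
      dualCone (stalkMonoid X hη x) ≤ dualCone (stalkMonoid X hη y) := fun x y =>
    ((hX.system_isLocalized hη).dualCone_le_iff (hX.system_hasInfSum hη) hfg hsat
      (p := x) (q := y)).symm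
  obtain ⟨e, he, hmem, hspec, hgen⟩ := hX.exists_eval hη
  let D : Fan.{u} := ⟨GenericLattice X η, Δ⟩
  let b : X → D.Pt := fun x => ⟨dualCone (stalkMonoid X hη x), x, rfl⟩
  have hb : Function.Bijective b := by
    refine ⟨fun x y h => ?_, ?_⟩
    · have h1 : dualCone (stalkMonoid X hη x) = dualCone (stalkMonoid X hη y) :=
        congrArg Subtype.val h
      exact hX.eq_of_specializes ((hle x y).mpr h1.le) ((hle y x).mpr h1.ge)
    · rintro ⟨_, x, rfl⟩
      exact ⟨x, rfl⟩
  let ι : GenericGroup X η →+ Module.Dual ℤ (GenericLattice X η) :=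
    (Module.Dual.eval ℤ (GenericGroup X η)).toAddMonoidHom
  let ev : ∀ x : X, X.stalk x →*₀ Pointed (Module.Dual ℤ (GenericLattice X η)) := fun x =>
    (Pointed.map ι).comp (e x)
  have hevalinj : Function.Injective ι := (Module.evalEquiv ℤ (GenericGroup X η)).injective
  have hev : ∀ x t, ev x t = Pointed.map ι (e x t) := fun x t => rfl
  obtain ⟨i, hi, hi'⟩ := D.system.exists_iso X b hb hle
    (fun x => ⟨⟨nhdsKer {x}, isOpen_nhdsKer⟩, subset_nhdsKer rfl,
      fun y hy => mem_nhdsKer_singleton.mp hy⟩) ev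
    (fun x => (Pointed.map_injective hevalinj).comp (he x)) (fun x t => by
      constructor
      · rintro (rfl | ⟨μ, hμ, rfl⟩)
        · exact ⟨0, map_zero _⟩
        · obtain ⟨m, rfl⟩ := (Module.evalEquiv ℤ (GenericGroup X η)).surjective μ
          have hm : m ∈ stalkMonoid X hη x :=
            (eval_mem_dualMonoid_dualCone (hfg x) (hsat x)).mp hμ
          obtain ⟨a, ha⟩ := (hmem x _).mp (Pointed.mem_of.mpr hm)
          refine ⟨a, ?_⟩
          rw [hev, ha, Pointed.map_of]
          rfl
      · rintro ⟨a, rfl⟩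
        rw [hev]
        rcases (hmem x _).mpr ⟨a, rfl⟩ with h | ⟨m, hm, h⟩
        · rw [h, map_zero]
          exact Or.inl rfl
        · rw [h, Pointed.map_of]
          exact Pointed.mem_of.mpr ((eval_mem_dualMonoid_dualCone (hfg x) (hsat x)).mpr hm))
    (fun y x h t => congrArg (Pointed.map ι) (hspec y x h t))
  refine ⟨inferInstance, inferInstance, Δ, i, ?_, ?_, ?_, fun t m ht => ?_⟩
  · rw [hcone]
    rfl
  · rw [hcone]
    exact hle
  · rw [hcone]
    exact fun x => congrArg (fun p : D.Pt => p.cone) (hi x)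
  · have h1 : ev η (i.hom.stalkMap η t) = Pointed.of m :=
      (hi' η t).trans ((D.stalkToLattice_eq _ t).symm.trans ht)
    rw [hev] at h1
    rcases Pointed.eq_zero_or_of (e η (i.hom.stalkMap η t)) with h2 | ⟨a, h2⟩
    · rw [h2, map_zero] at h1
      exact absurd h1.symm (Pointed.of_ne_zero m)
    · refine ⟨a, he η (h2.trans (hgen a).symm), fun n => ?_⟩
      rw [h2, Pointed.map_of] at h1
      rw [← Pointed.of_injective h1]
      rfl

end IsToric

namespace Fan

/-- A morphism comes from a (unique) morphism of fans if and only if it preserves the generic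
points. -/
theorem existsUnique_map_eq_iff {Δ Δ' : Fan.{u}} (f : functor.obj Δ ⟶ functor.obj Δ')
    {η : functor.obj Δ} {η' : functor.obj Δ'} (hη : IsMinimalPoint _ η)
    (hη' : IsMinimalPoint _ η') :
    ((∃ φ : Δ ⟶ Δ', functor.map φ = f) ↔ f.base η = η') ∧
      (f.base η = η' → ∃! φ : Δ ⟶ Δ', functor.map φ = f) := by
  have hex : f.base η = η' → ∃ φ : Δ ⟶ Δ', functor.map φ = f := by
    rintro rfl
    exact exists_mapSpace_eq f hη hη'
  refine ⟨⟨?_, hex⟩, fun h => ?_⟩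
  · rintro ⟨φ, rfl⟩
    exact mapBase_of_isMinimalPoint φ hη hη'
  · obtain ⟨φ, hφ⟩ := hex h
    exact ⟨φ, hφ, fun ψ hψ => mapSpace_injective (hψ.trans hφ.symm)⟩

end Fan

end

end MonoidScheme

theorem mainTheorem6 :
    ∃ hX : ∀ Δ : MonoidScheme.Fan.{u}, MonoidScheme.toric (MonoidScheme.Fan.functor.obj Δ),
      -- the functor from fans to toric monoid schemes is faithful and essentially surjective
      (MonoidScheme.toric.lift MonoidScheme.Fan.functor hX).Faithful ∧
      (MonoidScheme.toric.lift MonoidScheme.Fan.functor hX).EssSurj ∧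
      -- every toric monoid scheme `X` has a unique minimal point `η`, and is isomorphic to the
      -- scheme of the fan of the cones `σ_x` in `N_ℝ`, where `N` is the dual of `M_η`
      (∀ X : MonoidScheme.MonoidSpace.{u}, MonoidScheme.IsToric X →
        (∃! η : X, X.IsMinimalPoint η) ∧
        ∀ η : X, X.IsMinimalPoint η →
          (∀ a : X.stalk η, a ≠ 0 ↔ IsUnit a) ∧
          ∃ (hη : ∀ x : X, η ⤳ x)
            (_ : Module.Free ℤ (MonoidScheme.GenericLattice X η))
            (_ : Module.Finite ℤ (MonoidScheme.GenericLattice X η))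
            (Δ : MonoidScheme.FanIn (MonoidScheme.GenericLattice X η))
            (e : X ≅ MonoidScheme.Fan.functor.obj ⟨MonoidScheme.GenericLattice X η, Δ⟩),
            Δ.cones = Set.range (MonoidScheme.stalkCone X hη) ∧
            (∀ x y : X, x ⤳ y ↔
              MonoidScheme.stalkCone X hη x ≤ MonoidScheme.stalkCone X hη y) ∧
            (∀ x : X, MonoidScheme.Fan.coneOf ⟨MonoidScheme.GenericLattice X η, Δ⟩
              (e.hom.base x) = MonoidScheme.stalkCone X hη x) ∧
            -- on generic stalks, `e` is the identification of `M_η` with the dual of `N`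
            (∀ t (m : Module.Dual ℤ (MonoidScheme.GenericLattice X η)),
              MonoidScheme.Fan.stalkToLattice ⟨MonoidScheme.GenericLattice X η, Δ⟩
                (e.hom.base η) t = (Multiplicative.ofAdd m : Multiplicative _) →
              ∃ a : MonoidScheme.GenericGroup X η,
                e.hom.stalkMap η t = (a.toMul : X.stalk η) ∧
                ∀ n : MonoidScheme.GenericLattice X η, m n = n a)) ∧
      -- a morphism comes from a (unique) morphism of fans iff it preserves the generic points
      (∀ (Δ Δ' : MonoidScheme.Fan.{u})
        (f : MonoidScheme.Fan.functor.obj Δ ⟶ MonoidScheme.Fan.functor.obj Δ')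
        (η : MonoidScheme.Fan.functor.obj Δ) (η' : MonoidScheme.Fan.functor.obj Δ'),
        MonoidScheme.MonoidSpace.IsMinimalPoint _ η →
        MonoidScheme.MonoidSpace.IsMinimalPoint _ η' →
          ((∃ φ : Δ ⟶ Δ', MonoidScheme.Fan.functor.map φ = f) ↔ f.base η = η') ∧
          (f.base η = η' → ∃! φ : Δ ⟶ Δ', MonoidScheme.Fan.functor.map φ = f) ∧
          -- the generic stalks are `M_*` and `M'_*`, and `f_η^♯` is dual to `φ`
          Function.Bijective (Δ.stalkToLattice η) ∧
          Function.Bijective (Δ'.stalkToLattice η') ∧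
          ∀ φ : Δ ⟶ Δ', MonoidScheme.Fan.functor.map φ = f →
            ∀ t, Δ.stalkToLattice η (f.stalkMap η t) =
              MonoidScheme.latticePull φ.map (Δ'.stalkToLattice (f.base η) t)) := by
  refine ⟨fun Δ => Δ.isToric_space, ⟨fun {Δ Δ'} φ ψ h => ?_⟩, ⟨fun X => ?_⟩, fun X hX => ?_,
    fun Δ Δ' f η η' hη hη' => ?_⟩
  · exact MonoidScheme.Fan.mapSpace_injective (congrArg (fun f => f.hom) h)
  · obtain ⟨η, hη⟩ := MonoidScheme.IsToric.exists_generic X.property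
    obtain ⟨_, _, Δ, e, -⟩ := MonoidScheme.IsToric.exists_fan X.property hη
    exact ⟨⟨_, Δ⟩, ⟨MonoidScheme.toric.fullyFaithfulι.preimageIso e.symm⟩⟩
  · refine ⟨hX.existsUnique_isMinimalPoint, fun η hη => ?_⟩
    have hη' := hX.specializes_of_isMinimalPoint hη
    exact ⟨hX.ne_zero_iff_isUnit hη', hη', hX.exists_fan hη'⟩
  · obtain ⟨hiff, huniq⟩ := MonoidScheme.Fan.existsUnique_map_eq_iff f hη hη'
    refine ⟨hiff, huniq, MonoidScheme.Fan.stalkToLattice_bijective hη,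
      MonoidScheme.Fan.stalkToLattice_bijective hη', ?_⟩
    rintro φ rfl t
    exact MonoidScheme.Fan.stalkToLattice_mapSpace φ η t
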